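/- Let $W$ be one of the singularities $A_n$ ($n\ge 1$) or $D_{m+1}$ ($m\ge 1$), with the unfoldings $$\Lambda_{A_n}=\frac{x^{n+1}}{n+1}+y^2+\sum_{k=1}^{n}v_kx^{k-1},\qquad \Lambda_{D_{m+1}}=\frac12\Big(\frac{x^{m}}{m}-xy^2\Big)+\sum_{k=1}^{m}v_kx^{k-1}+v_{m+1}y .$$ For every value of $v$ let $c_{ab}^s(v)$ be the structure constants of the algebra $\mathbb C[x,y]/(\partial_x\Lambda,\partial_y\Lambda)$ in the basis $[\partial\Lambda/\partial v_k]$, let $\frac{\partial}{\partial v_a}\circ\frac{\partial}{\partial v_b}=\sum_s c_{ab}^s\frac{\partial}{\partial v_s}$, and let $\eta(\frac{\partial}{\partial v_a},\frac{\partial}{\partial v_b})$ be $c_{ab}^{n}$ for $A_n$ and $c_{ab}^{m}$ for $D_{m+1}$. Let $t_\gamma=t_\gamma(v)$ be the following coordinates, with $|\alpha|=\sum_k\alpha_k$: for $A_n$ and $1\le\gamma\le n$, $$t_\gamma=\sum_{\substack{\alpha_1,\dots,\alpha_n\ge0\\ \sum_k(n+2-k)\alpha_k=n+2-\gamma}}(-1)^{|\alpha|-1}\prod_{k=0}^{|\alpha|-2}(\gamma+k(n+1))\prod_{k=1}^n\frac{v_k^{\alpha_k}}{\alpha_k!},$$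 and for $D_{m+1}$, $t_{m+1}=v_{m+1}$ and, for $1\le\gamma\le m$, $$t_\gamma=\sum_{\substack{\alpha_1,\dots,\alpha_m\ge0\\ \sum_k(m+1-k)\alpha_k=m+1-\gamma}}(-1)^{|\alpha|-1}\prod_{k=0}^{|\alpha|-2}(2\gamma-1+2km)\prod_{k=1}^m\frac{v_k^{\alpha_k}}{\alpha_k!}.$$ A polynomial $F\in\mathbb C[t_1,t_2,\dots]$ in these coordinates is called the potential $F_W$ if * the pairing is constant: $\eta(\frac{\partial}{\partial t_\alpha},\frac{\partial}{\partial t_\beta})=\eta_{\alpha,\beta}$, where $\eta_{\alpha,\beta}=\delta_{\alpha+\beta,n+1}$ for $A_n$, while for $D_{m+1}$ one has $\eta_{m+1,m+1}=1$ and $\eta_{\alpha,\beta}=\delta_{\alpha+\beta,m+1}$ otherwise; * $\frac{\partial}{\partial t_\alpha}\circ\frac{\partial}{\partial t_\beta}=\sum_{\gamma,\delta}\frac{\partial^3F}{\partial t_\alpha\partial t_\beta\partial t_\gamma}\eta^{\gamma\delta}\frac{\partial}{\partial t_\delta}$, where $(\eta^{\gamma\delta})=(\eta_{\gamma,\delta})^{-1}$;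 * $E_WF=(3-\delta_W)F$, where $E_{A_n}=\sum_{\alpha=1}^n\frac{n+2-\alpha}{n+1}t_\alpha\frac{\partial}{\partial t_\alpha}$, $\delta_{A_n}=\frac{n-1}{n+1}$, and $E_{D_{m+1}}=\sum_{\alpha=1}^{m}\frac{m+1-\alpha}{m}t_\alpha\frac{\partial}{\partial t_\alpha}+\frac{m+1}{2m}t_{m+1}\frac{\partial}{\partial t_{m+1}}$, $\delta_{D_{m+1}}=\frac{m-1}{m}$. **Proposition.** Let $N\ge1$. The potentials $F_{A_{2N-1}}$ and $F_{D_{N+1}}$ exist and are unique, and the potential $F_{B_N}$, defined by $F_{B_N}(t_1,\dots,t_N)=F_{A_{2N-1}}(t_1,0,t_2,0,\dots,0,t_N)$, satisfies $$F_{B_N}(t_1,\dots,t_N)=F_{D_{N+1}}(t_1,\dots,t_N,0).$$ Moreover the flat structures agree. For every $u\in\mathbb C^N$ there is $t\in\mathbb C^N$ such that the point $v=(u_1,0,u_2,0,\dots,0,u_N)$ of the $A_{2N-1}$ manifold has the flat coordinates $(t_1,0,t_2,0,\dots,0,t_N)$ and the point $v=(u_1,\dots,u_N,0)$ of the $D_{N+1}$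 manifold has the flat coordinates $(t_1,\dots,t_N,0)$. At these two points $\eta(\frac{\partial}{\partial v_{2a-1}},\frac{\partial}{\partial v_{2b-1}})$ for $A_{2N-1}$ equals $\eta(\frac{\partial}{\partial v_a},\frac{\partial}{\partial v_b})$ for $D_{N+1}$, for all $1\le a,b\le N$. -/

import Mathlib

open MvPolynomial

noncomputable section

/-- The polynomial ring `ℂ[x, y]`; the variable `x` is `X 0` and the variable `y` is `X 1`. -/
abbrev PlanePoly : Type := MvPolynomial (Fin 2) ℂ

/-- The data from which the Frobenius manifold of a singularity with `n` parameters is built.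
Indices are zero-based: the element `k : Fin n` stands for the index `k + 1` of the usual notation.
* `f` is the singularity and `e k = ∂Λ/∂v_{k+1}`, so that the unfolding is
  `Λ = f + ∑ k, v_{k+1} * e k`;
* `top` is the (one-based) index `r` of the pairing `η(∂/∂v_a, ∂/∂v_b) = c_{ab}^r`;
* `flat α` is the flat coordinate `t_{α+1}` as a polynomial in the unfolding parameters `v`;
* `eta` is the constant matrix of the pairing in the flat coordinates;
* `E = ∑ α, weight α * t_α * ∂/∂t_α` is the Euler vector field and `charge` is the number `δ`
  for which `E F = (3 - δ) F`. -/
structure SingularityData (n : ℕ) where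
  f : PlanePoly
  e : Fin n → PlanePoly
  top : ℕ
  flat : Fin n → MvPolynomial (Fin n) ℂ
  eta : Matrix (Fin n) (Fin n) ℂ
  weight : Fin n → ℂ
  charge : ℂ

namespace SingularityData

variable {n : ℕ}

/-- The unfolding `Λ(x, y; v) = f + ∑ k, v_k * e_k`, at the parameter value `v`. -/
def unfolding (S : SingularityData n) (v : Fin n → ℂ) : PlanePoly :=
  S.f + ∑ k, C (v k) * S.e k

/-- The ideal `(∂Λ/∂x, ∂Λ/∂y)` of `ℂ[x, y]`. -/
def jacobianIdeal (S : SingularityData n) (v : Fin n → ℂ) : Ideal PlanePoly :=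
  Ideal.span {pderiv 0 (S.unfolding v), pderiv 1 (S.unfolding v)}

/-- The algebra `𝒜_v = ℂ[x, y] / (∂Λ/∂x, ∂Λ/∂y)`. -/
abbrev LocalAlgebra (S : SingularityData n) (v : Fin n → ℂ) : Type :=
  PlanePoly ⧸ S.jacobianIdeal v

/-- The class `[∂Λ/∂v_k]` in `𝒜_v`. -/
def cls (S : SingularityData n) (v : Fin n → ℂ) (k : Fin n) : S.LocalAlgebra v :=
  Ideal.Quotient.mk (S.jacobianIdeal v) (S.e k)

open Classical in
/-- The structure constant `c_{ab}^s(v)`: the coefficient of `[∂Λ/∂v_s]` in the product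
`[∂Λ/∂v_a] [∂Λ/∂v_b]`, expanded in the basis `[∂Λ/∂v_1], …, [∂Λ/∂v_n]` of `𝒜_v`
(and `0` if these classes are not a basis, which does not happen for the singularities below). -/
def structureConst (S : SingularityData n) (v : Fin n → ℂ) (a b s : Fin n) : ℂ :=
  if h : ∃ B : Module.Basis (Fin n) ℂ (S.LocalAlgebra v), ∀ k, B k = S.cls v k then
    h.choose.repr (S.cls v a * S.cls v b) s
  else 0

/-- The pairing `η(∂/∂v_a, ∂/∂v_b) = c_{ab}^r` at the point `v`, where `r = top`. -/
def pairing (S : SingularityData n) (v : Fin n → ℂ) (a b : Fin n) : ℂ :=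
  ∑ s : Fin n, if (s : ℕ) + 1 = S.top then S.structureConst v a b s else 0

/-- The point with flat coordinates `t(v)`. -/
def flatPoint (S : SingularityData n) (v : Fin n → ℂ) : Fin n → ℂ :=
  fun α => eval v (S.flat α)

/-- `F = F(t_1, …, t_n)` is the Frobenius manifold potential of the singularity in the flat
coordinates `t = t(v)`. Since `∂/∂v_a = ∑ α, (∂t_α/∂v_a) ∂/∂t_α`, the first two conditions are the
identities `η(∂/∂t_α, ∂/∂t_β) = eta α β` and
`∂/∂t_α ∘ ∂/∂t_β = ∑ γ δ, F_{αβγ} η^{γδ} ∂/∂t_δ`, written in the frame `∂/∂v_1, …, ∂/∂v_n`,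
where `∂/∂v_a ∘ ∂/∂v_b = ∑ s, c_{ab}^s ∂/∂v_s`; the WDVV equations for `F` are the associativity
of this product, which holds because it is the product of `𝒜_v`. The last condition is the quasi-homogeneity
`E F = (3 - δ) F`. -/
structure IsPotential (S : SingularityData n) (F : MvPolynomial (Fin n) ℂ) : Prop where
  pairing_flat : ∀ (v : Fin n → ℂ) (a b : Fin n),
    S.pairing v a b =
      ∑ α, ∑ β, S.eta α β * eval v (pderiv a (S.flat α)) * eval v (pderiv b (S.flat β))
  product : ∀ (v : Fin n → ℂ) (a b δ : Fin n),
    ∑ s, S.structureConst v a b s * eval v (pderiv s (S.flat δ)) =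
      ∑ α, ∑ β, ∑ γ, eval v (pderiv a (S.flat α)) * eval v (pderiv b (S.flat β)) *
        eval (S.flatPoint v) (pderiv α (pderiv β (pderiv γ F))) * S.eta⁻¹ γ δ
  euler : ∑ α, C (S.weight α) * X α * pderiv α F = C (3 - S.charge) * F

end SingularityData

/-- The finite set of all `α_1, …, α_r ≥ 0` with `∑ w_k α_k = d`, for positive weights `w_k`. -/
def exponents {r : ℕ} (w : Fin r → ℕ) (d : ℕ) : Finset (Fin r → ℕ) :=
  (Fintype.piFinset fun _ : Fin r => Finset.range (d + 1)).filter fun α => ∑ k, w k * α k = d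

theorem mem_exponents {r : ℕ} {w : Fin r → ℕ} (hw : ∀ k, 0 < w k) {d : ℕ} {α : Fin r → ℕ} :
    α ∈ exponents w d ↔ ∑ k, w k * α k = d := by
  simp only [exponents, Finset.mem_filter, Fintype.mem_piFinset, Finset.mem_range,
    and_iff_right_iff_imp]
  intro h k
  have h1 : w k * α k ≤ ∑ k, w k * α k :=
    Finset.single_le_sum (f := fun k => w k * α k) (fun _ _ => Nat.zero_le _) (Finset.mem_univ k)
  have h2 : α k ≤ w k * α k := Nat.le_mul_of_pos_left _ (hw k)
  omega

/-- The flat coordinate `t_γ` of `A_n`, where `γ` is one more than the zero-based index `g`: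
`t_γ = ∑ (-1)^(|α|-1) ∏_{k=0}^{|α|-2} (γ + k (n+1)) ∏_k v_k^{α_k} / α_k!`, the sum being over all
`α_1, …, α_n ≥ 0` with `∑ (n + 2 - k) α_k = n + 2 - γ`. Each such `α` satisfies `|α| ≥ 1`. -/
def flatA (n : ℕ) (g : Fin n) : MvPolynomial (Fin n) ℂ :=
  ∑ α ∈ exponents (fun k : Fin n => n + 1 - (k : ℕ)) (n + 1 - (g : ℕ)),
    C ((-1) ^ ((∑ k, α k) - 1) *
        (∏ j ∈ Finset.range ((∑ k, α k) - 1), (((g : ℕ) : ℂ) + 1 + (j : ℂ) * ((n : ℂ) + 1))) *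
        ∏ k, (((α k).factorial : ℂ))⁻¹) *
      ∏ k, X k ^ α k

/-- The singularity `A_n`: `Λ = x^(n+1)/(n+1) + y^2 + ∑_{k=1}^n v_k x^(k-1)`. -/
def dataA (n : ℕ) : SingularityData n where
  f := C (1 / ((n : ℂ) + 1)) * X 0 ^ (n + 1) + X 1 ^ 2
  e := fun k => X 0 ^ (k : ℕ)
  top := n
  flat := flatA n
  eta := fun a b => if ((a : ℕ) + 1) + ((b : ℕ) + 1) = n + 1 then 1 else 0
  weight := fun a => ((n : ℂ) + 2 - (((a : ℕ) : ℂ) + 1)) / ((n : ℂ) + 1)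
  charge := ((n : ℂ) - 1) / ((n : ℂ) + 1)

/-- The flat coordinates of `D_{m+1}`. For `1 ≤ γ ≤ m` (where `γ` is one more than the index)
`t_γ = ∑ (-1)^(|α|-1) ∏_{k=0}^{|α|-2} (2γ - 1 + 2 k m) ∏_k v_k^{α_k} / α_k!`, the sum being over
all `α_1, …, α_m ≥ 0` with `∑ (m + 1 - k) α_k = m + 1 - γ`; the last one is `t_{m+1} = v_{m+1}`.
Each such `α` satisfies `|α| ≥ 1`. -/
def flatD (m : ℕ) (g : Fin (m + 1)) : MvPolynomial (Fin (m + 1)) ℂ :=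
  if (g : ℕ) = m then X g
  else
    ∑ α ∈ exponents (fun k : Fin m => m - (k : ℕ)) (m - (g : ℕ)),
      C ((-1) ^ ((∑ k, α k) - 1) *
          (∏ j ∈ Finset.range ((∑ k, α k) - 1),
            (2 * (((g : ℕ) : ℂ) + 1) - 1 + 2 * (j : ℂ) * (m : ℂ))) *
          ∏ k, (((α k).factorial : ℂ))⁻¹) *
        ∏ k : Fin m, X k.castSucc ^ α k

/-- The singularity `D_{m+1}`, in the normalization
`Λ = (x^m/m - x y^2)/2 + ∑_{k=1}^m v_k x^(k-1) + v_{m+1} y`, for which the coordinates `flatD`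
are flat and the pairing has the entries `η_{m+1,m+1} = 1` and `η_{αβ} = δ_{α+β,m+1}` otherwise.
The polynomial `x^m/m + x y^2` is brought to this form by rescaling `x` and `y`, see
`singularityD_rescale`. -/
def dataD (m : ℕ) : SingularityData (m + 1) where
  f := C (1 / 2) * (C (1 / (m : ℂ)) * X 0 ^ m - X 0 * X 1 ^ 2)
  e := fun k => if (k : ℕ) = m then X 1 else X 0 ^ (k : ℕ)
  top := m
  flat := flatD m
  eta := fun a b =>
    if (a : ℕ) = m ∧ (b : ℕ) = m then 1
    else if ((a : ℕ) + 1) + ((b : ℕ) + 1) = m + 1 then 1 else 0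
  weight := fun a =>
    if (a : ℕ) = m then ((m : ℂ) + 1) / (2 * (m : ℂ))
    else ((m : ℂ) + 1 - (((a : ℕ) : ℂ) + 1)) / (m : ℂ)
  charge := ((m : ℂ) - 1) / (m : ℂ)

/-- The linear substitution `x ↦ p x`, `y ↦ q y` with `2 p^m = 1` and `2 p q^2 = -1` takes
`x^m/m + x y^2` to the polynomial used in `dataD`. -/
theorem singularityD_rescale (m : ℕ) (p q : ℂ) (hp : 2 * p ^ m = 1) (hq : 2 * (p * q ^ 2) = -1) :
    aeval (![C p * X 0, C q * X 1] : Fin 2 → PlanePoly)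
      (C (1 / (m : ℂ)) * X 0 ^ m + X 0 * X 1 ^ 2 : PlanePoly) = (dataD m).f := by
  have h1 : p ^ m = 1 / 2 := by linear_combination hp / 2
  have h2 : p * q ^ 2 = -(1 / 2) := by linear_combination hq / 2
  have e2 : (C p * X 0 * (C q * X 1) ^ 2 : PlanePoly) = C (p * q ^ 2) * (X 0 * X 1 ^ 2) := by
    rw [C_mul, C_pow]; ring
  simp only [dataD, map_add, map_mul, map_pow, aeval_X, Matrix.cons_val_zero,
    Matrix.cons_val_one, aeval_C]
  rw [e2, mul_pow, ← C_pow, h1, h2]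
  simp only [algebraMap_eq, C_neg]
  ring

/-- `(t_1, …, t_N) ↦ (t_1, 0, t_2, 0, …, 0, t_N)`. -/
def insertZeros {R : Type*} [Zero R] (N : ℕ) (t : Fin N → R) : Fin (2 * N - 1) → R :=
  fun i => if h : (i : ℕ) % 2 = 0 then t ⟨(i : ℕ) / 2, by have := i.2; omega⟩ else 0

/-- `(t_1, …, t_N) ↦ (t_1, …, t_N, 0)`. -/
def appendZero {R : Type*} [Zero R] (N : ℕ) (t : Fin N → R) : Fin (N + 1) → R :=
  fun i => if h : (i : ℕ) < N then t ⟨i, h⟩ else 0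

/-- The index `2a - 1` (one-based) of the coordinate `t_a` in `(t_1, 0, t_2, 0, …, 0, t_N)`. -/
def oddIndex (N : ℕ) (a : Fin N) : Fin (2 * N - 1) :=
  ⟨2 * (a : ℕ), by have := a.2; omega⟩

/-- `F_{B_N}(t_1, …, t_N) = F_{A_{2N-1}}(t_1, 0, t_2, 0, …, 0, t_N)`. -/
def potentialB (N : ℕ) (FA : MvPolynomial (Fin (2 * N - 1)) ℂ) : MvPolynomial (Fin N) ℂ :=
  aeval (insertZeros N (X : Fin N → MvPolynomial (Fin N) ℂ)) FA

end

/-! Both manifolds are governed by the same residue calculus in one variable. Put `ε = e + 1`, `h =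
ε c` and `z = (x^h + h ∑ v_k x^(ε k))^(1/h)`, expanded at infinity, with `Res` the coefficient of
`x^(-1)`. For `A_n` (`ε = 1`, `c = n + 1`) the function `z^h / h` is the `x`-part of the unfolding.
For `D_{m+1}` (`ε = 2`, `c = m`) it is the unfolding at `y = 0` with `x^2` in place of `x`. The
classical formulas are `t_γ = Res z^(h-1-εγ) / (h-1-εγ)` and, for the gradient of the potential,
`p_γ = Res z^(h+1+εγ) / ((1+εγ)(h+1+εγ))`, with zero-based `γ`.

Let `P` be `unfPoly`, that is `x^e` times the `x`-derivative of `z^h / h`, written in `x^ε`. A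
parameter derivative of `Res x^(ε b) z^(-q)` is `-q Res x^(ε(a+b)) z^(-q-h)`. Dividing `x^(a+b)` by
`P` and integrating the multiple of `P` by parts gives the Gauss–Manin connection
`pderiv_resSeries_eq`. For the `t_γ` the remainder has no residue, so they are flat
(`pderiv_resSeries_nat`). For the `p_γ` the remainder survives and yields the structure constants
(`hessian_flatGrad`). The pairing `topCoeff`, a residue of `f / P`, is compatible with this
connection (`topCoeff_divByMonic_mul_eulerDeriv`). Hence `sum_resSeries_mul_resSeries`: the pairing
is antidiagonal in the `t_γ`. The form `∑ p_γ dt_γ` is closed (`sum_gradFun_mul_comm`), and Euler's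
formula integrates it to the potential.

This settles `A_n`. In the algebra of `D_{m+1}` one has `x y = w` and `y^2 = P / x`, where `w =
v_{m+1} = t_{m+1}`. The potential is therefore the one-variable potential for `ε = 2` plus
`t_{m+1}^2 v_1(t) / 2`; the last term accounts for all products involving `y` or `w`
(`hessian_gradV`, `sum_gradV_mul_resSeries`).

Two potentials have the same third derivatives, so they differ by a polynomial of degree at most
two. All weights are at most `1` while `3 - δ > 2`, so quasi-homogeneity kills the difference
(`IsPotential.eq`).

For the comparison, both `A_{2N-1}` and `D_{N+1}` have `h = 2N`. On the locus `v = (u_1, 0, u_2, …,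
0, u_N)` the two series `z` coincide: residues with even indices agree (`insertHom_resSeries`), and
those of the wrong parity vanish (`insertHom_resSeries_of_odd`). Flat coordinates, gradients and
pairing are built from these residues, and the extra term of `D_{N+1}` vanishes at `t_{N+1} = 0`. -/

/-! ### Residues of powers of the root of the unfolding -/

/-- The coefficient `(-1)^|μ| ∏_{i < |μ|} (q + i h) / μ!` of the binomial expansion of
`(1 + h ∑ v_k)^(-q/h)`. -/
noncomputable def binomCoeff {r : ℕ} (q h : ℂ) (μ : Fin r → ℕ) : ℂ :=
  (-1) ^ (∑ k, μ k) * (∏ i ∈ Finset.range (∑ k, μ k), (q + (i : ℂ) * h)) *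
    ∏ k, (((μ k).factorial : ℂ))⁻¹

/-- Coefficient form of `∂S^(-q/h)/∂v_a = -q S^(-(q+h)/h)` for `S = 1 + h ∑ v_k`. -/
theorem binomCoeff_add_single {r : ℕ} (q h : ℂ) (μ : Fin r →₀ ℕ) (a : Fin r) :
    binomCoeff q h (μ + Finsupp.single a 1 : Fin r →₀ ℕ) * ((μ a : ℂ) + 1) =
      -q * binomCoeff (q + h) h μ := by
  have hs : ∑ k, (μ + Finsupp.single a 1 : Fin r →₀ ℕ) k = (∑ k, μ k) + 1 := by
    simp [Finset.sum_add_distrib, Finsupp.single_apply]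
  have hf : (∏ k, ((((μ + Finsupp.single a 1 : Fin r →₀ ℕ) k).factorial : ℂ))⁻¹) * ((μ a : ℂ) + 1) =
      ∏ k, (((μ k).factorial : ℂ))⁻¹ := by
    rw [← Finset.mul_prod_erase _ _ (Finset.mem_univ a),
      ← Finset.mul_prod_erase Finset.univ (fun k => (((μ k).factorial : ℂ))⁻¹) (Finset.mem_univ a)]
    have h1 : ∏ x ∈ Finset.univ.erase a,
        ((((μ + Finsupp.single a 1 : Fin r →₀ ℕ) x).factorial : ℂ))⁻¹ =
        ∏ x ∈ Finset.univ.erase a, (((μ x).factorial : ℂ))⁻¹ := by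
      refine Finset.prod_congr rfl fun x hx => ?_
      rw [Finsupp.add_apply, Finsupp.single_eq_of_ne (Finset.ne_of_mem_erase hx), add_zero]
    rw [h1, Finsupp.add_apply, Finsupp.single_eq_same, Nat.factorial_succ]
    have h2 : ((μ a : ℂ) + 1) ≠ 0 := by exact_mod_cast Nat.succ_ne_zero (μ a)
    have h3 : ((μ a).factorial : ℂ) ≠ 0 := by exact_mod_cast Nat.factorial_ne_zero (μ a)
    push_cast
    field_simp
  have hp : ∀ N : ℕ, ∏ i ∈ Finset.range (N + 1), (q + (i : ℂ) * h) =
      q * ∏ i ∈ Finset.range N, (q + h + (i : ℂ) * h) := by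
    intro N
    rw [Finset.prod_range_succ', mul_comm]
    congr 1
    · simp
    · refine Finset.prod_congr rfl fun i _ => ?_
      push_cast; ring
  simp only [binomCoeff]
  rw [mul_assoc, hf, hs, hp, pow_succ]
  ring

/-- Coefficient form of `q S^(-(q+h)/h) = (q + h ∑ v_k ∂/∂v_k) S^(-q/h)`. The products over `i`
telescope. -/
theorem mul_binomCoeff_add {r : ℕ} (q h : ℂ) (μ : Fin r → ℕ) :
    q * binomCoeff (q + h) h μ = (q + h * ((∑ k, μ k : ℕ) : ℂ)) * binomCoeff q h μ := by
  have hp : ∀ N : ℕ, q * ∏ i ∈ Finset.range N, (q + h + (i : ℂ) * h) =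
      (q + h * (N : ℂ)) * ∏ i ∈ Finset.range N, (q + (i : ℂ) * h) := by
    intro N
    induction N with
    | zero => simp
    | succ N ih =>
      rw [Finset.prod_range_succ, Finset.prod_range_succ, ← mul_assoc, ih]
      push_cast; ring
  simp only [binomCoeff]
  linear_combination (-1) ^ (∑ k, μ k) * (∏ k, (((μ k).factorial : ℂ))⁻¹) * hp (∑ k, μ k)

theorem coeff_sum_exponents {r : ℕ} {w : Fin r → ℕ} (hw : ∀ k, 0 < w k) (d : ℕ)
    (φ : (Fin r → ℕ) → ℂ) (μ : Fin r →₀ ℕ) :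
    coeff μ (∑ α ∈ exponents w d, C (φ α) * ∏ k, (X k : MvPolynomial (Fin r) ℂ) ^ α k) =
      if ∑ k, w k * μ k = d then φ μ else 0 := by
  have h1 : ∀ α : Fin r → ℕ, C (φ α) * ∏ k, (X k : MvPolynomial (Fin r) ℂ) ^ α k =
      monomial (Finsupp.equivFunOnFinite.symm α) (φ α) := by
    intro α
    rw [monomial_eq, Finsupp.prod_fintype _ _ (by simp)]
    simp
  simp only [h1, coeff_sum, coeff_monomial]
  have h2 : ∀ α : Fin r → ℕ, (Finsupp.equivFunOnFinite.symm α = μ) ↔ (α = μ) := by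
    intro α
    rw [Equiv.symm_apply_eq]; rfl
  simp only [h2, Finset.sum_ite_eq', mem_exponents hw]

/-- The residue at infinity of `x^j z^(-(1 + ε g))` for the root
`z = (x^h + h ∑ v_k x^(ε k))^(1/h)`, `h = ε c`, of the unfolding (with `x^ε` in place of `x`):
the quasi-homogeneous polynomial of degree `j - g` in the parameters `v_k` of degree `c - k`. -/
noncomputable def resSeries (r c ε : ℕ) (g j : ℤ) : MvPolynomial (Fin r) ℂ :=
  if 0 ≤ j - g then
    ∑ α ∈ exponents (fun k : Fin r => c - (k : ℕ)) (j - g).toNat,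
      C (binomCoeff (1 + (ε : ℂ) * (g : ℂ)) ((ε : ℂ) * (c : ℂ)) α) * ∏ k, X k ^ α k
  else 0

section

variable {r c ε : ℕ}

theorem coeff_resSeries (hc : r ≤ c) (g j : ℤ) (μ : Fin r →₀ ℕ) :
    coeff μ (resSeries r c ε g j) =
      if ∑ k : Fin r, ((c : ℤ) - (k : ℕ)) * (μ k : ℤ) = j - g then
        binomCoeff (1 + (ε : ℂ) * (g : ℂ)) ((ε : ℂ) * (c : ℂ)) μ else 0 := by
  have hw : ∀ k : Fin r, 0 < c - (k : ℕ) := fun k => by have := k.2; omega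
  have hz : ∑ k : Fin r, ((c : ℤ) - (k : ℕ)) * (μ k : ℤ) =
      ((∑ k : Fin r, (c - (k : ℕ)) * μ k : ℕ) : ℤ) := by
    push_cast
    refine Finset.sum_congr rfl fun k _ => ?_
    rw [Nat.cast_sub (by have := k.2; omega)]
  rw [hz, resSeries]
  split_ifs with h1 h2 h2
  · rw [coeff_sum_exponents hw, if_pos (by omega)]
  · rw [coeff_sum_exponents hw, if_neg (by omega)]
  · exact absurd (by omega) h1
  · simp

theorem resSeries_of_lt {g j : ℤ} (h : j < g) : resSeries r c ε g j = 0 := by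
  rw [resSeries, if_neg (by omega)]

theorem resSeries_self (hc : r ≤ c) (g : ℤ) : resSeries r c ε g g = 1 := by
  ext μ
  rw [coeff_resSeries hc, coeff_one, sub_self]
  have hnn : ∀ k ∈ Finset.univ, (0 : ℤ) ≤ ((c : ℤ) - ((k : Fin r) : ℕ)) * (μ k : ℤ) := fun k _ =>
    mul_nonneg (by have := k.2; omega) (by positivity)
  simp only [Finset.sum_eq_zero_iff_of_nonneg hnn]
  by_cases h : μ = 0
  · subst h; simp [binomCoeff]
  · rw [if_neg, if_neg (Ne.symm h)]
    intro h'
    apply h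
    ext k
    have := h' k (Finset.mem_univ k)
    rcases mul_eq_zero.1 this with h2 | h2
    · have := k.2; omega
    · simpa using h2

theorem constantCoeff_resSeries (hc : r ≤ c) (g j : ℤ) :
    constantCoeff (resSeries r c ε g j) = if j = g then 1 else 0 := by
  rw [constantCoeff_eq, coeff_resSeries hc]
  have : (0 = j - g) ↔ (j = g) := by omega
  simp [binomCoeff, this]

/-- With `q = 1 + ε g`, this is `∂z^(-q)/∂v_a = -q x^(ε a) z^(-q-h)`; the exponent `q + h`
corresponds to `g + c`. -/
theorem pderiv_resSeries (hc : r ≤ c) (a : Fin r) (g j : ℤ) :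
    pderiv a (resSeries r c ε g j) =
      C (-(1 + (ε : ℂ) * (g : ℂ))) * resSeries r c ε (g + c) (j + (a : ℕ)) := by
  ext μ
  rw [coeff_pderiv, coeff_C_mul, coeff_resSeries hc, coeff_resSeries hc]
  have hs : ∑ k : Fin r, ((c : ℤ) - (k : ℕ)) * (((μ + Finsupp.single a 1 : Fin r →₀ ℕ) k : ℕ) : ℤ) =
      ∑ k : Fin r, ((c : ℤ) - (k : ℕ)) * (μ k : ℤ) + (c - (a : ℕ)) := by
    simp [mul_add, Finset.sum_add_distrib, Finsupp.single_apply]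
  rw [hs]
  have hi : (∑ k : Fin r, ((c : ℤ) - (k : ℕ)) * (μ k : ℤ) + (c - (a : ℕ)) = j - g) ↔
    (∑ k : Fin r, ((c : ℤ) - (k : ℕ)) * (μ k : ℤ) = j + (a : ℕ) - (g + c)) := by
    constructor <;> intro h <;> linarith
  simp only [hi]
  split_ifs with h
  · rw [binomCoeff_add_single]
    push_cast
    ring_nf
  · simp

theorem coeff_X_mul_pderiv (a : Fin r) (f : MvPolynomial (Fin r) ℂ) (μ : Fin r →₀ ℕ) :
    coeff μ (X a * pderiv a f) = (μ a : ℂ) * coeff μ f := by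
  induction f using MvPolynomial.induction_on' with
  | add p q hp hq => rw [map_add, mul_add, coeff_add, coeff_add, hp, hq, mul_add]
  | monomial m x =>
    rw [X_mul_pderiv_monomial, coeff_smul, coeff_monomial]
    split_ifs with h
    · rw [h]; simp
    · simp

theorem resSeries_euler (hc : r ≤ c) (g j : ℤ) :
    ∑ a : Fin r, C ((c : ℂ) - (a : ℕ)) * (X a * pderiv a (resSeries r c ε g j)) =
      C ((j : ℂ) - (g : ℂ)) * resSeries r c ε g j := by
  ext μ
  simp only [coeff_sum, coeff_C_mul, coeff_X_mul_pderiv]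
  simp only [← mul_assoc]
  rw [← Finset.sum_mul, coeff_resSeries hc]
  split_ifs with h
  · have h' := congrArg (Int.cast : ℤ → ℂ) h
    push_cast at h'
    rw [h']
  · simp

/-- Expresses `z^(-q) = z^(-q-h) (x^h + h ∑ v_a x^(ε a))` through residues, the terms with `v_a`
being written as derivatives. -/
theorem resSeries_shift (hc : r ≤ c) (g j : ℤ) :
    C (1 + (ε : ℂ) * (g : ℂ)) * resSeries r c ε (g + c) (j + c) =
      C (1 + (ε : ℂ) * (g : ℂ)) * resSeries r c ε g j +
        C ((ε : ℂ) * (c : ℂ)) * ∑ a : Fin r, X a * pderiv a (resSeries r c ε g j) := by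
  ext μ
  simp only [coeff_add, coeff_sum, coeff_C_mul, coeff_X_mul_pderiv]
  rw [← Finset.sum_mul, coeff_resSeries hc, coeff_resSeries hc, add_sub_add_right_eq_sub]
  split_ifs with h
  · have := mul_binomCoeff_add (1 + (ε : ℂ) * (g : ℂ)) ((ε : ℂ) * (c : ℂ)) μ
    push_cast at this ⊢
    rw [← mul_assoc (((ε : ℂ) * (c : ℂ))), ← add_mul, ← this]
    ring_nf
  · simp

/-- The vanishing of `Res d(x^(1+εj) z^(-q))`. Algebraically it is `resSeries_shift` corrected by
the weighted homogeneity `resSeries_euler`. -/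
theorem resSeries_by_parts (hc : r ≤ c) (g j : ℤ) :
    C (1 + (ε : ℂ) * (j : ℂ)) * resSeries r c ε g j =
      C (1 + (ε : ℂ) * (g : ℂ)) * (resSeries r c ε (g + c) (j + c) +
        ∑ a : Fin r, C ((ε : ℂ) * ((a : ℕ) : ℂ)) * X a *
          resSeries r c ε (g + c) (j + (a : ℕ))) := by
  have h1 := resSeries_shift (ε := ε) hc g j
  have h2 := resSeries_euler (ε := ε) hc g j
  rw [mul_add, h1, Finset.mul_sum, Finset.mul_sum, add_assoc, ← Finset.sum_add_distrib]
  have h3 : ∀ a : Fin r, C ((ε : ℂ) * (c : ℂ)) * (X a * pderiv a (resSeries r c ε g j)) +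
      C (1 + (ε : ℂ) * (g : ℂ)) * (C ((ε : ℂ) * ((a : ℕ) : ℂ)) * X a *
          resSeries r c ε (g + c) (j + (a : ℕ))) =
      C (ε : ℂ) * (C ((c : ℂ) - (a : ℕ)) * (X a * pderiv a (resSeries r c ε g j))) := by
    intro a
    rw [pderiv_resSeries hc]
    simp only [C_mul, C_add, C_neg, C_sub]
    ring
  rw [Finset.sum_congr rfl fun a _ => h3 a, ← Finset.mul_sum, h2]
  simp only [C_mul, C_add, C_sub]
  ring

end

/-! ### The derivation `D` and its adjoint on polynomials -/

section

variable {A : Type*} [CommRing A]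

/-- The derivation `(e + 1) x^e d/dx`, that is `d/dx` for `e = 0` and `2 x d/dx` for `e = 1`. -/
noncomputable def eulerDeriv (e : ℕ) : Derivation A (Polynomial A) (Polynomial A) :=
  (((e + 1 : ℕ) : Polynomial A) * Polynomial.X ^ e) • Polynomial.derivative'

theorem eulerDeriv_apply (e : ℕ) (f : Polynomial A) :
    eulerDeriv e f = (((e + 1 : ℕ) : Polynomial A) * Polynomial.X ^ e) * Polynomial.derivative f := rfl

theorem eulerDeriv_mul (e : ℕ) (f g : Polynomial A) :
    eulerDeriv e (f * g) = eulerDeriv e f * g + f * eulerDeriv e g := by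
  rw [Derivation.leibniz, smul_eq_mul, smul_eq_mul]; ring

/-- The adjoint `f ↦ (e + 1) x^e f' + e f` of `eulerDeriv`. -/
noncomputable def eulerAdj (e : ℕ) : Polynomial A →ₗ[A] Polynomial A :=
  (eulerDeriv e).toLinearMap + (e : A) • LinearMap.id

theorem eulerAdj_apply (e : ℕ) (f : Polynomial A) :
    eulerAdj e f = eulerDeriv e f + (e : A) • f := rfl

theorem coeff_eulerDeriv_zero (f : Polynomial A) (i : ℕ) :
    (eulerDeriv 0 f).coeff i = f.coeff (i + 1) * (i + 1) := by
  simp [eulerDeriv_apply, Polynomial.coeff_derivative]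

theorem coeff_eulerDeriv_one (f : Polynomial A) (i : ℕ) :
    (eulerDeriv 1 f).coeff i = 2 * i * f.coeff i := by
  have h : (((1 + 1 : ℕ) : Polynomial A) * Polynomial.X ^ 1) =
      Polynomial.C (2 : A) * Polynomial.X := by
    simp only [pow_one]; congr 1
  rw [eulerDeriv_apply, h, mul_assoc, Polynomial.coeff_C_mul]
  cases i with
  | zero => simp
  | succ i => simp [Polynomial.coeff_X_mul, Polynomial.coeff_derivative]; ring

theorem degree_eulerDeriv_lt {e : ℕ} (he : e ≤ 1) {f : Polynomial A} {k : ℕ}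
    (hf : f.degree < k) : (eulerDeriv e f).degree < k := by
  rw [Polynomial.degree_lt_iff_coeff_zero] at hf ⊢
  intro i hi
  obtain rfl | rfl : e = 0 ∨ e = 1 := by omega
  · rw [coeff_eulerDeriv_zero, hf _ (by omega), zero_mul]
  · rw [coeff_eulerDeriv_one, hf _ hi, mul_zero]

theorem degree_eulerAdj_lt {e : ℕ} (he : e ≤ 1) {f : Polynomial A} {k : ℕ}
    (hf : f.degree < k) : (eulerAdj e f).degree < k := by
  rw [eulerAdj_apply]
  refine (Polynomial.degree_add_le _ _).trans_lt (max_lt (degree_eulerDeriv_lt he hf) ?_)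
  exact (Polynomial.degree_smul_le _ _).trans_lt hf

/-- The subtraction in `j + e - 1` truncates only for `j = e = 0`, where the coefficient vanishes.
-/
theorem eulerAdj_X_pow (e : ℕ) (he : e ≤ 1) (j : ℕ) :
    eulerAdj e (Polynomial.X ^ j : Polynomial A) =
      (((e + 1) * j + e : ℕ) : A) • Polynomial.X ^ (j + e - 1) := by
  ext i
  obtain rfl | rfl : e = 0 ∨ e = 1 := by omega
  · rw [eulerAdj_apply, Polynomial.coeff_add, coeff_eulerDeriv_zero]
    cases j with
    | zero => simp [Polynomial.coeff_one]
    | succ j =>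
      simp only [Polynomial.coeff_smul, Polynomial.coeff_X_pow]
      by_cases h : i = j
      · subst h; simp
      · simp [h]
  · rw [eulerAdj_apply, Polynomial.coeff_add, coeff_eulerDeriv_one]
    simp only [Polynomial.coeff_smul, Polynomial.coeff_X_pow]
    by_cases h : i = j
    · subst h; simp
    · simp [h]

end

/-! ### Residues modulo a monic polynomial -/

section

variable {A : Type*} [CommRing A] [Nontrivial A] {P : Polynomial A}

set_option linter.unusedSectionVars false

theorem divByMonic_eq_of_degree_lt (hP : P.Monic) {K R f : Polynomial A}
    (hR : R.degree < P.degree) (h : f = K * P + R) : f /ₘ P = K ∧ f %ₘ P = R :=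
  Polynomial.div_modByMonic_unique K R hP ⟨by rw [h]; ring, hR⟩

theorem mul_add_divByMonic (hP : P.Monic) (K f : Polynomial A) :
    (K * P + f) /ₘ P = K + f /ₘ P := by
  refine (divByMonic_eq_of_degree_lt hP (R := f %ₘ P) (Polynomial.degree_modByMonic_lt _ hP) ?_).1
  have := Polynomial.modByMonic_add_div f P
  linear_combination -this

theorem divByMonic_add (hP : P.Monic) (f g : Polynomial A) :
    (f + g) /ₘ P = f /ₘ P + g /ₘ P := by
  have h := mul_add_divByMonic hP (f /ₘ P) (f %ₘ P + g)
  rw [show f /ₘ P * P + (f %ₘ P + g) = f + g by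
    linear_combination Polynomial.modByMonic_add_div f P] at h
  rw [h]
  have h2 := mul_add_divByMonic hP (g /ₘ P) (f %ₘ P + g %ₘ P)
  rw [show g /ₘ P * P + (f %ₘ P + g %ₘ P) = f %ₘ P + g by
    linear_combination Polynomial.modByMonic_add_div g P] at h2
  rw [h2, (Polynomial.divByMonic_eq_zero_iff hP (p := f %ₘ P + g %ₘ P)).2, add_zero]
  exact (Polynomial.degree_add_le _ _).trans_lt
    (max_lt (Polynomial.degree_modByMonic_lt _ hP) (Polynomial.degree_modByMonic_lt _ hP))

theorem degree_divByMonic_lt_of_lt (hP : P.Monic) {f : Polynomial A} {k : ℕ}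
    (hf : f.degree < (P.natDegree + k : ℕ)) : (f /ₘ P).degree < k := by
  by_cases h0 : f /ₘ P = 0
  · rw [h0, Polynomial.degree_zero]; exact WithBot.bot_lt_coe _
  · have hle : P.natDegree ≤ f.natDegree := by
      by_contra hlt
      apply h0
      rw [Polynomial.divByMonic_eq_zero_iff hP]
      exact Polynomial.degree_lt_degree (not_le.1 hlt)
    have hf0 : f ≠ 0 := by rintro rfl; simp at h0
    rw [← Polynomial.natDegree_lt_iff_degree_lt hf0] at hf
    rw [← Polynomial.natDegree_lt_iff_degree_lt h0, Polynomial.natDegree_divByMonic f hP]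
    omega

theorem degree_mul_lt_of_lt {f g : Polynomial A} {m n k : ℕ} (hf : f.degree < m)
    (hg : g.degree < n) (hk : m + n ≤ k + 1) : (f * g).degree < k := by
  by_cases h0 : f * g = 0
  · rw [h0, Polynomial.degree_zero]; exact WithBot.bot_lt_coe _
  · have hf0 : f ≠ 0 := left_ne_zero_of_mul h0
    have hg0 : g ≠ 0 := right_ne_zero_of_mul h0
    rw [← Polynomial.natDegree_lt_iff_degree_lt hf0] at hf
    rw [← Polynomial.natDegree_lt_iff_degree_lt hg0] at hg
    rw [← Polynomial.natDegree_lt_iff_degree_lt h0]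
    have := Polynomial.natDegree_mul_le (p := f) (q := g)
    omega

/-- The residue of `f / P`: the top coefficient of the remainder of `f` modulo `P`. -/
noncomputable def topCoeff (P : Polynomial A) : Polynomial A →ₗ[A] A :=
  (Polynomial.lcoeff A (P.natDegree - 1)).comp P.modByMonicHom

theorem topCoeff_apply (f : Polynomial A) :
    topCoeff P f = (f %ₘ P).coeff (P.natDegree - 1) := rfl

theorem topCoeff_of_degree_lt (hP : P.Monic) {f : Polynomial A} (hf : f.degree < P.natDegree) :
    topCoeff P f = f.coeff (P.natDegree - 1) := by
  rw [topCoeff_apply, (Polynomial.modByMonic_eq_self_iff hP).2]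
  rwa [Polynomial.degree_eq_natDegree hP.ne_zero]

theorem topCoeff_eq_zero (hP : P.Monic) {f : Polynomial A}
    (hf : f.degree < (P.natDegree - 1 : ℕ)) : topCoeff P f = 0 := by
  rw [topCoeff_of_degree_lt hP (hf.trans_le (by exact_mod_cast Nat.sub_le _ _))]
  exact Polynomial.coeff_eq_zero_of_degree_lt hf

theorem topCoeff_mul_self (hP : P.Monic) (f : Polynomial A) : topCoeff P (f * P) = 0 := by
  rw [topCoeff_apply, Polynomial.mul_self_modByMonic hP, Polynomial.coeff_zero]

theorem topCoeff_mul_add (hP : P.Monic) (K f : Polynomial A) :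
    topCoeff P (K * P + f) = topCoeff P f := by
  rw [map_add, topCoeff_mul_self hP, zero_add]

/-- Discards products of two polynomials of degree below `deg P`: these have degree at most `2 deg P
- 2`, so dividing them by `P^2` leaves order at most `-2` at infinity. -/
theorem topCoeff_divByMonic_eq_zero (hP : P.Monic) (h1 : 1 ≤ P.natDegree) {f : Polynomial A}
    (hf : f.degree < (2 * P.natDegree - 1 : ℕ)) : topCoeff P (f /ₘ P) = 0 := by
  refine topCoeff_eq_zero hP (degree_divByMonic_lt_of_lt hP ?_)
  rwa [show P.natDegree + (P.natDegree - 1) = 2 * P.natDegree - 1 by omega]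

theorem degree_modByMonic_lt_natDegree (hP : P.Monic) (f : Polynomial A) :
    (f %ₘ P).degree < P.natDegree := by
  rw [← Polynomial.degree_eq_natDegree hP.ne_zero]
  exact Polynomial.degree_modByMonic_lt _ hP

/-- For `e = 1` the leading term of `P` is an eigenvector of `2 x d/dx` with eigenvalue `2 deg P`;
for `e = 0` the derivative already lowers the degree. -/
theorem degree_eulerDeriv_sub_lt {e : ℕ} (he : e ≤ 1) :
    (eulerDeriv e P - ((2 * e * P.natDegree : ℕ) : A) • P).degree < P.natDegree := by
  rw [Polynomial.degree_lt_iff_coeff_zero]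
  intro i hi
  obtain rfl | rfl : e = 0 ∨ e = 1 := by omega
  · rw [Polynomial.coeff_sub, coeff_eulerDeriv_zero,
      Polynomial.coeff_eq_zero_of_natDegree_lt (by omega)]
    simp
  · rw [Polynomial.coeff_sub, coeff_eulerDeriv_one, Polynomial.coeff_smul]
    rcases hi.eq_or_lt with rfl | h
    · simp
    · rw [Polynomial.coeff_eq_zero_of_natDegree_lt h]; simp

theorem topCoeff_eulerDeriv {e : ℕ} (he : e ≤ 1) (hP : P.Monic) (h1 : 1 ≤ P.natDegree)
    {f : Polynomial A} (hf : f.degree < P.natDegree) :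
    topCoeff P (eulerDeriv e f) + 2 * (e : A) * topCoeff P f =
      ((2 * e * P.natDegree : ℕ) : A) * topCoeff P f := by
  rw [topCoeff_of_degree_lt hP (degree_eulerDeriv_lt he hf), topCoeff_of_degree_lt hP hf]
  obtain rfl | rfl : e = 0 ∨ e = 1 := by omega
  · rw [coeff_eulerDeriv_zero, Nat.sub_add_cancel h1, Polynomial.coeff_eq_zero_of_degree_lt hf]
    simp
  · rw [coeff_eulerDeriv_one]
    push_cast [Nat.cast_sub h1]
    ring

/-- The residue at infinity of a derivative vanishes. -/
theorem two_mul_topCoeff_eulerAdj_divByMonic {e : ℕ} (he : e ≤ 1) (hP : P.Monic)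
    (h1 : 1 ≤ P.natDegree) (w : Polynomial A) :
    2 * topCoeff P (eulerAdj e (w /ₘ P)) = topCoeff P (eulerDeriv e w /ₘ P) := by
  -- Analytically, `(e+1) (x^e w / P^2)'` has no residue, so `2 Res (w DP / P^3) = Res (Dw / P^2) +
  -- 2e Res (w / P^2)`. Two successive divisions by `P`, giving `K` and `K2`, replace the expansions
  -- at infinity.
  set K := w /ₘ P with hK
  set R := w %ₘ P with hR
  set K2 := K /ₘ P with hK2
  set R2 := K %ₘ P with hR2
  set S := eulerDeriv e P - ((2 * e * P.natDegree : ℕ) : A) • P with hS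
  have hw : w = K * P + R := by linear_combination -(Polynomial.modByMonic_add_div w P)
  have hk : K = K2 * P + R2 := by linear_combination -(Polynomial.modByMonic_add_div K P)
  have hRd : R.degree < P.natDegree := degree_modByMonic_lt_natDegree hP w
  have hR2d : R2.degree < P.natDegree := degree_modByMonic_lt_natDegree hP K
  have hSd : S.degree < P.natDegree := degree_eulerDeriv_sub_lt he
  have hDw : eulerDeriv e w = eulerDeriv e K * P + (K * eulerDeriv e P + eulerDeriv e R) := by
    conv_lhs => rw [hw]
    rw [map_add, eulerDeriv_mul]; ring
  have hDR : eulerDeriv e R /ₘ P = 0 := by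
    rw [Polynomial.divByMonic_eq_zero_iff hP, Polynomial.degree_eq_natDegree hP.ne_zero]
    exact degree_eulerDeriv_lt he hRd
  rw [hDw, mul_add_divByMonic hP, divByMonic_add hP, hDR, add_zero, map_add]
  have hKD : K * eulerDeriv e P =
      (K2 * eulerDeriv e P + ((2 * e * P.natDegree : ℕ) : A) • R2) * P + R2 * S := by
    conv_lhs => rw [hk]
    simp only [hS, Algebra.smul_def]
    ring
  have hDK : topCoeff P (eulerDeriv e K) =
      topCoeff P (K2 * eulerDeriv e P) + topCoeff P (eulerDeriv e R2) := by
    conv_lhs => rw [hk]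
    rw [map_add, eulerDeriv_mul, add_assoc, topCoeff_mul_add hP, map_add]
  have hLK : topCoeff P K = topCoeff P R2 := by
    conv_lhs => rw [hk]
    rw [topCoeff_mul_add hP]
  rw [hKD, mul_add_divByMonic hP, map_add, topCoeff_divByMonic_eq_zero hP h1
    (degree_mul_lt_of_lt hR2d hSd (by omega)), add_zero, map_add, map_smul, eulerAdj_apply,
    map_add, map_smul, smul_eq_mul, smul_eq_mul, hLK]
  linear_combination hDK + topCoeff_eulerDeriv he hP h1 hR2d

/-- Both sides are the residue of `a b / P^2`: the error `(a %ₘ P) b / P^2` has order at most `-2`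
at infinity. -/
theorem topCoeff_divByMonic_mul (hP : P.Monic) (h1 : 1 ≤ P.natDegree) (a : Polynomial A)
    {b : Polynomial A} (hb : b.degree < P.natDegree) :
    topCoeff P (a /ₘ P * b) = topCoeff P (a * b /ₘ P) := by
  have h : a * b = (a /ₘ P * b) * P + a %ₘ P * b := by
    linear_combination -b * (Polynomial.modByMonic_add_div a P)
  rw [h, mul_add_divByMonic hP, map_add, topCoeff_divByMonic_eq_zero hP h1
    (degree_mul_lt_of_lt (degree_modByMonic_lt_natDegree hP a) hb (by omega)), add_zero]

/-- The Leibniz rule for `eulerAdj`. Replacing `(a /ₘ P) b` by `a b /ₘ P` changes it by a polynomial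
of degree below `deg P - 1`, which has no top coefficient even after `eulerAdj`. -/
theorem topCoeff_eulerAdj_divByMonic_mul {e : ℕ} (he : e ≤ 1) (hP : P.Monic)
    (h1 : 1 ≤ P.natDegree) (a : Polynomial A) {b : Polynomial A} (hb : b.degree < P.natDegree) :
    topCoeff P (eulerAdj e (a /ₘ P) * b) =
      topCoeff P (eulerAdj e (a * b /ₘ P)) - topCoeff P (a * eulerDeriv e b /ₘ P) := by
  have h : a * b = (a /ₘ P * b) * P + a %ₘ P * b := by
    linear_combination -b * (Polynomial.modByMonic_add_div a P)
  have hd : (a %ₘ P * b /ₘ P).degree < (P.natDegree - 1 : ℕ) := by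
    refine degree_divByMonic_lt_of_lt hP
      (degree_mul_lt_of_lt (degree_modByMonic_lt_natDegree hP a) hb (by omega))
  rw [← topCoeff_divByMonic_mul hP h1 a (degree_eulerDeriv_lt he hb)]
  conv_rhs => rw [h, mul_add_divByMonic hP, map_add, map_add,
    topCoeff_eq_zero hP (degree_eulerAdj_lt he hd), add_zero]
  rw [← map_sub]
  congr 1
  rw [eulerAdj_apply, eulerAdj_apply, eulerDeriv_mul, add_mul, smul_mul_assoc]
  ring

/-- The compatibility of the residue pairing with the flat connection. -/
theorem topCoeff_divByMonic_mul_eulerDeriv {e : ℕ} (he : e ≤ 1) (hP : P.Monic)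
    (h1 : 1 ≤ P.natDegree) {u v g : Polynomial A} (hu : u.degree < P.natDegree)
    (hv : v.degree < P.natDegree) (hg : g.degree < P.natDegree) :
    topCoeff P (u * v /ₘ P * eulerDeriv e g) =
      topCoeff P (eulerAdj e (g * u /ₘ P) * v) + topCoeff P (eulerAdj e (g * v /ₘ P) * u) := by
  rw [topCoeff_eulerAdj_divByMonic_mul he hP h1 _ hv, topCoeff_eulerAdj_divByMonic_mul he hP h1 _ hu,
    topCoeff_divByMonic_mul hP h1 _ (degree_eulerDeriv_lt he hg)]
  -- The two adjoint terms on the right are both the one of `g u v`. Together they give the residue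
  -- of `D(g u v) / P^2`, and the product rule leaves exactly `u v Dg`.
  have h := two_mul_topCoeff_eulerAdj_divByMonic he hP h1 (g * u * v)
  have h2 : eulerDeriv e (g * u * v) = u * v * eulerDeriv e g +
      (g * u * eulerDeriv e v + g * v * eulerDeriv e u) := by
    rw [eulerDeriv_mul, eulerDeriv_mul]; ring
  rw [h2, divByMonic_add hP, divByMonic_add hP, map_add, map_add] at h
  rw [mul_right_comm g v u]
  linear_combination -h

end

section

variable {A : Type*} [CommRing A]

theorem eulerDeriv_X_pow (e k : ℕ) :
    eulerDeriv e (Polynomial.X ^ k : Polynomial A) =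
      (((e + 1) * k : ℕ) : A) • Polynomial.X ^ (k + e - 1) := by
  rw [eulerDeriv_apply, Polynomial.derivative_X_pow]
  cases k with
  | zero => simp
  | succ k =>
    rw [show k + 1 + e - 1 = e + (k + 1 - 1) by omega, pow_add, Algebra.smul_def]
    simp only [map_natCast, map_mul, Nat.cast_mul]
    ring

/-- Linear functionals which agree on `1, x, …, x^(k-1)` agree on all polynomials of degree
less than `k`. -/
theorem linearMap_eq_of_degree_lt {M : Type*} [AddCommGroup M] [Module A M]
    {φ ψ : Polynomial A →ₗ[A] M} {k : ℕ}
    (h : ∀ s < k, φ (Polynomial.X ^ s) = ψ (Polynomial.X ^ s)) {f : Polynomial A}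
    (hf : f.degree < k) : φ f = ψ f := by
  by_cases h0 : f = 0
  · simp [h0]
  have hn : f.natDegree < k := (Polynomial.natDegree_lt_iff_degree_lt h0).2 hf
  rw [f.as_sum_range' k hn, map_sum, map_sum]
  refine Finset.sum_congr rfl fun s hs => ?_
  rw [← Polynomial.smul_X_eq_monomial, map_smul, map_smul, h s (Finset.mem_range.1 hs)]

end

/-! ### Parameter derivatives, the Gauss–Manin connection and the flat pairing -/

/-- The tool for identities between residues: differentiation turns such an identity into identities
of lower order, and the constant term is the value at `v = 0`. -/
theorem eq_of_pderiv_eq {σ : Type*} {f g : MvPolynomial σ ℂ}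
    (h : ∀ a, pderiv a f = pderiv a g) (h0 : constantCoeff f = constantCoeff g) : f = g := by
  classical
  ext μ
  by_cases hμ : μ = 0
  · subst hμ; simpa [constantCoeff_eq] using h0
  · obtain ⟨a, ha⟩ : ∃ a, μ a ≠ 0 := by
      by_contra hcon
      push Not at hcon
      exact hμ (Finsupp.ext hcon)
    have h1 := congrArg (coeff (μ - Finsupp.single a 1)) (h a)
    have h2 : μ - Finsupp.single a 1 + Finsupp.single a 1 = μ :=
      tsub_add_cancel_of_le (Finsupp.single_le_iff.2 (Nat.one_le_iff_ne_zero.2 ha))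
    rw [coeff_pderiv, coeff_pderiv, h2] at h1
    refine mul_right_cancel₀ ?_ h1
    exact Nat.cast_add_one_ne_zero _

/-- The coefficientwise partial derivative of polynomials over a polynomial ring. -/
noncomputable def coeffDeriv {σ : Type*} (a : σ) :
    Derivation ℤ (Polynomial (MvPolynomial σ ℂ)) (Polynomial (MvPolynomial σ ℂ)) :=
  letI : Differential (MvPolynomial σ ℂ) := ⟨(pderiv a).restrictScalars ℤ⟩
  Differential.mapCoeffs

theorem coeff_coeffDeriv {σ : Type*} (a : σ) (f : Polynomial (MvPolynomial σ ℂ)) (i : ℕ) :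
    (coeffDeriv a f).coeff i = pderiv a (f.coeff i) := rfl

theorem coeffDeriv_mul {σ : Type*} (a : σ) (f g : Polynomial (MvPolynomial σ ℂ)) :
    coeffDeriv a (f * g) = coeffDeriv a f * g + f * coeffDeriv a g := by
  rw [Derivation.leibniz, smul_eq_mul, smul_eq_mul]; ring

theorem coeffDeriv_smul_X_pow {σ : Type*} (a : σ) (f : MvPolynomial σ ℂ) (n : ℕ) :
    coeffDeriv a (f • Polynomial.X ^ n) = (pderiv a f) • Polynomial.X ^ n := by
  ext1 i
  rw [coeff_coeffDeriv, Polynomial.coeff_smul, Polynomial.coeff_smul, Polynomial.coeff_X_pow]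
  split_ifs <;> simp

theorem coeffDeriv_X_pow {σ : Type*} (a : σ) (n : ℕ) :
    coeffDeriv a (Polynomial.X ^ n) = 0 := by
  have := coeffDeriv_smul_X_pow a 1 n
  simpa using this

/-- The derivative `x^r + ∑ v_k D(x^k)` of the unfolding in one variable, `D = eulerDeriv e`. -/
noncomputable def unfPoly (r e : ℕ) : Polynomial (MvPolynomial (Fin r) ℂ) :=
  Polynomial.X ^ r + ∑ k : Fin r, (X k : MvPolynomial (Fin r) ℂ) • eulerDeriv e (Polynomial.X ^ (k : ℕ))

/-- The functional `f ↦ Res f z^(-(1 + ε g))`, see `resSeries`. -/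
noncomputable def resFun (r c e : ℕ) (g : ℤ) :
    Polynomial (MvPolynomial (Fin r) ℂ) →ₗ[MvPolynomial (Fin r) ℂ] MvPolynomial (Fin r) ℂ :=
  Polynomial.lsum fun j =>
    LinearMap.toSpanSingleton (MvPolynomial (Fin r) ℂ) _ (resSeries r c (e + 1) g j)

theorem resFun_X_pow (r c e : ℕ) (g : ℤ) (j : ℕ) :
    resFun r c e g (Polynomial.X ^ j) = resSeries r c (e + 1) g j := by
  rw [resFun, Polynomial.lsum_apply, ← Polynomial.monomial_one_right_eq_X_pow,
    Polynomial.sum_monomial_index] <;> simp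

section

variable {r c e : ℕ}

theorem degree_unfPoly_sub_lt (r : ℕ) (he : e ≤ 1) :
    (∑ k : Fin r, (X k : MvPolynomial (Fin r) ℂ) •
      eulerDeriv e (Polynomial.X ^ (k : ℕ) : Polynomial (MvPolynomial (Fin r) ℂ))).degree < r := by
  refine (Polynomial.degree_sum_le _ _).trans_lt ((Finset.sup_lt_iff (WithBot.bot_lt_coe r)).2 ?_)
  intro k _
  refine (Polynomial.degree_smul_le _ _).trans_lt (degree_eulerDeriv_lt he ?_)
  rw [Polynomial.degree_X_pow]
  exact_mod_cast k.2

theorem monic_unfPoly (r : ℕ) (he : e ≤ 1) : (unfPoly r e).Monic :=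
  Polynomial.monic_X_pow_add (degree_unfPoly_sub_lt r he)

theorem natDegree_unfPoly (r : ℕ) (he : e ≤ 1) : (unfPoly r e).natDegree = r := by
  refine Polynomial.natDegree_eq_of_degree_eq_some ?_
  rw [unfPoly, Polynomial.degree_add_eq_left_of_degree_lt] <;> rw [Polynomial.degree_X_pow]
  exact degree_unfPoly_sub_lt r he

theorem coeffDeriv_unfPoly (a : Fin r) :
    coeffDeriv a (unfPoly r e) = eulerDeriv e (Polynomial.X ^ (a : ℕ)) := by
  rw [unfPoly, map_add, coeffDeriv_X_pow, zero_add, map_sum, Finset.sum_eq_single a]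
  · rw [eulerDeriv_X_pow, smul_smul, coeffDeriv_smul_X_pow, pderiv_mul, pderiv_X_self,
      ← C_eq_coe_nat, pderiv_C]
    simp
  · intro k _ hk
    rw [eulerDeriv_X_pow, smul_smul, coeffDeriv_smul_X_pow, pderiv_mul, pderiv_X_of_ne hk,
      ← C_eq_coe_nat, pderiv_C]
    simp
  · simp

/-- For `j < g` the integrand `x^(ε j) z^(-(1 + ε g))` has order below `-1` at infinity. -/
theorem resFun_eq_zero {g k : ℕ} (hk : k ≤ g) {f : Polynomial (MvPolynomial (Fin r) ℂ)}
    (hf : f.degree < k) : resFun r c e g f = 0 := by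
  refine (linearMap_eq_of_degree_lt (ψ := 0) (fun s hs => ?_) hf).trans (LinearMap.zero_apply _)
  rw [resFun_X_pow, resSeries_of_lt (by omega), LinearMap.zero_apply]

/-- Integration by parts, extended linearly from monomials. Here `eulerAdj e f` is the derivative of
`x^e f(x^ε)`, and `unfPoly` is `x^e` times that of `z^h / h`. -/
theorem resFun_eulerAdj (he : e ≤ 1) (hc : c + e = r + 1) (g : ℤ)
    (f : Polynomial (MvPolynomial (Fin r) ℂ)) :
    resFun r c e g (eulerAdj e f) =
      C (1 + ((e + 1 : ℕ) : ℂ) * (g : ℂ)) * resFun r c e (g + c) (f * unfPoly r e) := by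
  induction f using Polynomial.induction_on' with
  | add p q hp hq => rw [map_add, map_add, hp, hq, add_mul, map_add (resFun _ _ _ _), mul_add]
  | monomial j a =>
    rw [← Polynomial.smul_X_eq_monomial, map_smul, map_smul, smul_mul_assoc, map_smul,
      smul_eq_mul, smul_eq_mul, mul_left_comm]
    congr 1
    rw [eulerAdj_X_pow e he, map_smul, resFun_X_pow, unfPoly, mul_add, map_add (resFun _ _ _ _), ← pow_add,
      resFun_X_pow, Finset.mul_sum, map_sum]
    -- The index is an integer because it equals `-1` for `j = e = 0`; the factor `1 + ε (-1)` then
    -- vanishes, matching the truncated exponent of `eulerAdj_X_pow`.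
    have h := resSeries_by_parts (r := r) (c := c) (ε := e + 1) (by omega) g (j + e - 1 : ℤ)
    have h1 : (((e + 1) * j + e : ℕ) : MvPolynomial (Fin r) ℂ) •
        resSeries r c (e + 1) g ((j + e - 1 : ℕ) : ℤ) =
        C (1 + ((e + 1 : ℕ) : ℂ) * ((j + e - 1 : ℤ) : ℂ)) *
          resSeries r c (e + 1) g (j + e - 1 : ℤ) := by
      rw [smul_eq_mul, ← C_eq_coe_nat]
      by_cases h0 : j + e = 0
      · obtain ⟨rfl, rfl⟩ : j = 0 ∧ e = 0 := by omega
        simp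
      · rw [show ((j + e - 1 : ℕ) : ℤ) = j + e - 1 by omega]
        congr 2
        obtain rfl | rfl : e = 0 ∨ e = 1 := by omega
        · push_cast; ring
        · push_cast; ring
    rw [h1, h]
    congr 2
    · congr 1; push_cast; omega
    · refine Finset.sum_congr rfl fun k _ => ?_
      rw [mul_smul_comm, eulerDeriv_X_pow, mul_smul_comm, map_smul, map_smul, ← pow_add,
        resFun_X_pow, smul_eq_mul, smul_eq_mul, ← C_eq_coe_nat]
      by_cases h0 : (k : ℕ) + e = 0
      · have : (k : ℕ) = 0 := by omega
        simp [this]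
      · rw [show ((j + ((k : ℕ) + e - 1) : ℕ) : ℤ) = j + e - 1 + (k : ℕ) by omega]
        push_cast
        ring

/-- The Gauss–Manin connection on the residues `resFun g (x^b)`. -/
theorem pderiv_resSeries_eq (he : e ≤ 1) (hc : c + e = r + 1) (a b : Fin r) (g : ℤ) :
    pderiv a (resSeries r c (e + 1) g (b : ℕ)) =
      C (-(1 + ((e + 1 : ℕ) : ℂ) * (g : ℂ))) *
          resFun r c e (g + c) (Polynomial.X ^ ((a : ℕ) + b) %ₘ unfPoly r e) -
        resFun r c e g (eulerAdj e (Polynomial.X ^ ((a : ℕ) + b) /ₘ unfPoly r e)) := by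
  rw [pderiv_resSeries (by omega), resFun_eulerAdj he hc,
    show ((b : ℕ) : ℤ) + (a : ℕ) = (((a : ℕ) + b : ℕ) : ℤ) by push_cast; ring, ← resFun_X_pow]
  -- The multiple of `P` is brought back from level `g + c` to level `g` by `resFun_eulerAdj`; only
  -- the remainder stays at level `g + c`.
  conv_lhs => rw [← Polynomial.modByMonic_add_div (Polynomial.X ^ ((a : ℕ) + b)) (unfPoly r e)]
  rw [map_add, mul_comm (unfPoly r e)]
  simp only [C_neg]
  ring

/-- For `g ≥ 0` the remainder has degree below `r ≤ g + c`, hence no residue. What is left involves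
`g` only through `resFun`, so all these residues are solutions of one and the same connection. -/
theorem pderiv_resSeries_nat (he : e ≤ 1) (hc : c + e = r + 1) (a b : Fin r) (g : ℕ) :
    pderiv a (resSeries r c (e + 1) g (b : ℕ)) =
      -resFun r c e g (eulerAdj e (Polynomial.X ^ ((a : ℕ) + b) /ₘ unfPoly r e)) := by
  rw [pderiv_resSeries_eq he hc, ← Nat.cast_add, resFun_eq_zero (k := r) (by omega)]
  · simp
  · have := degree_modByMonic_lt_natDegree (monic_unfPoly r he) (Polynomial.X ^ ((a : ℕ) + b))
    rwa [natDegree_unfPoly r he] at this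

/-- Drives the inductions on `a + b`: differentiating the factor with index `b` produces only powers
below `x^b`. -/
theorem degree_eulerAdj_divByMonic_lt (he : e ≤ 1) (a : Fin r) (b : ℕ) :
    (eulerAdj e (Polynomial.X ^ ((a : ℕ) + b) /ₘ unfPoly r e)).degree < b := by
  refine degree_eulerAdj_lt he (degree_divByMonic_lt_of_lt (monic_unfPoly r he) ?_)
  rw [natDegree_unfPoly r he, Polynomial.degree_X_pow]
  exact_mod_cast Nat.add_lt_add_right a.2 b

/-- Comes from differentiating `x^n = P K + R` in `v_a`, where `∂P/∂v_a = D(x^a)`, and taking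
`topCoeff`, which kills the multiple of `P`. -/
theorem pderiv_topCoeff_X_pow (he : e ≤ 1) (a : Fin r) (n : ℕ) :
    pderiv a (topCoeff (unfPoly r e) (Polynomial.X ^ n)) =
      -topCoeff (unfPoly r e)
        (Polynomial.X ^ n /ₘ unfPoly r e * eulerDeriv e (Polynomial.X ^ (a : ℕ))) := by
  have hP := monic_unfPoly r he
  set P := unfPoly r e with hPdef
  have h := congrArg (coeffDeriv a) (Polynomial.modByMonic_add_div (Polynomial.X ^ n) P)
  rw [map_add, coeffDeriv_mul, coeffDeriv_X_pow, coeffDeriv_unfPoly] at h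
  have hd : (coeffDeriv a (Polynomial.X ^ n %ₘ P)).degree < P.natDegree := by
    have := degree_modByMonic_lt_natDegree hP (Polynomial.X ^ n)
    rw [Polynomial.degree_lt_iff_coeff_zero] at this ⊢
    intro i hi
    rw [coeff_coeffDeriv, this i hi, map_zero]
  have h2 := congrArg (topCoeff P) h
  rw [map_add, map_add, mul_comm P, topCoeff_mul_self hP, add_zero, map_zero,
    topCoeff_of_degree_lt hP hd, coeff_coeffDeriv, ← topCoeff_apply, mul_comm (eulerDeriv _ _)] at h2
  linear_combination h2

theorem constantCoeff_topCoeff_X_pow (he : e ≤ 1) (n : ℕ) (hr : 1 ≤ r) :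
    constantCoeff (topCoeff (unfPoly r e) (Polynomial.X ^ n)) = if n + 1 = r then 1 else 0 := by
  have hP := monic_unfPoly r he
  have hmap : (unfPoly r e).map (constantCoeff : MvPolynomial (Fin r) ℂ →+* ℂ) =
      Polynomial.X ^ r := by
    rw [unfPoly, Polynomial.map_add, Polynomial.map_pow, Polynomial.map_X, Polynomial.map_sum,
      Finset.sum_eq_zero, add_zero]
    intro k _
    rw [Polynomial.map_smul, constantCoeff_X, zero_smul]
  rw [topCoeff_apply, ← Polynomial.coeff_map, Polynomial.map_modByMonic _ hP, hmap,
    natDegree_unfPoly r he, Polynomial.map_pow, Polynomial.map_X]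
  by_cases hn : n < r
  · rw [(Polynomial.modByMonic_eq_self_iff (Polynomial.monic_X_pow r)).2, Polynomial.coeff_X_pow]
    · congr 1
      exact propext (by omega)
    · rw [Polynomial.degree_X_pow, Polynomial.degree_X_pow]
      exact_mod_cast hn
  · rw [(Polynomial.modByMonic_eq_zero_iff_dvd (Polynomial.monic_X_pow r)).2
      (pow_dvd_pow _ (not_lt.1 hn)), if_neg (by omega), Polynomial.coeff_zero]

/-- The functions `resSeries γ` are flat coordinates of the residue pairing. -/
theorem sum_resSeries_mul_resSeries (he : e ≤ 1) (hc : c + e = r + 1) (hr : 1 ≤ r) (a b : Fin r) :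
    ∑ γ : Fin r, resSeries r c (e + 1) (γ : ℕ) (a : ℕ) *
        resSeries r c (e + 1) ((r - 1 - γ : ℕ) : ℤ) (b : ℕ) =
      topCoeff (unfPoly r e) (Polynomial.X ^ ((a : ℕ) + b)) := by
  obtain ⟨n, hn⟩ : ∃ n, (a : ℕ) + b = n := ⟨_, rfl⟩
  induction n using Nat.strong_induction_on generalizing a b with
  | _ n ih =>
  have hP := monic_unfPoly r he
  have hPn := natDegree_unfPoly r he
  have hrc : r ≤ c := by omega
  -- By linearity, the induction hypothesis holds with `x^a` replaced by any `f` of degree below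
  -- `a`; `key2` does the same for `x^b`.
  have key1 : ∀ f : Polynomial (MvPolynomial (Fin r) ℂ), f.degree < (a : ℕ) →
      ∑ γ : Fin r, resFun r c e (γ : ℕ) f *
        resSeries r c (e + 1) ((r - 1 - γ : ℕ) : ℤ) (b : ℕ) =
      topCoeff (unfPoly r e) (f * Polynomial.X ^ (b : ℕ)) := by
    intro f hf
    have := linearMap_eq_of_degree_lt
      (φ := ∑ γ : Fin r, resSeries r c (e + 1) ((r - 1 - γ : ℕ) : ℤ) (b : ℕ) •
        resFun r c e (γ : ℕ))
      (ψ := (topCoeff (unfPoly r e)).comp (LinearMap.mulRight _ (Polynomial.X ^ (b : ℕ))))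
      (k := a) (fun s hs => ?_) hf
    · simpa [mul_comm] using this
    · have := ih (s + b) (by omega) ⟨s, by omega⟩ b rfl
      simp only [LinearMap.sum_apply, LinearMap.smul_apply, resFun_X_pow, smul_eq_mul,
        LinearMap.comp_apply, LinearMap.mulRight_apply, ← pow_add]
      simpa [mul_comm] using this
  have key2 : ∀ f : Polynomial (MvPolynomial (Fin r) ℂ), f.degree < (b : ℕ) →
      ∑ γ : Fin r, resSeries r c (e + 1) (γ : ℕ) (a : ℕ) *
        resFun r c e ((r - 1 - γ : ℕ) : ℤ) f =
      topCoeff (unfPoly r e) (f * Polynomial.X ^ (a : ℕ)) := by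
    intro f hf
    have := linearMap_eq_of_degree_lt
      (φ := ∑ γ : Fin r, resSeries r c (e + 1) (γ : ℕ) (a : ℕ) •
        resFun r c e ((r - 1 - γ : ℕ) : ℤ))
      (ψ := (topCoeff (unfPoly r e)).comp (LinearMap.mulRight _ (Polynomial.X ^ (a : ℕ))))
      (k := b) (fun s hs => ?_) hf
    · simpa using this
    · have := ih (a + s) (by omega) a ⟨s, by omega⟩ rfl
      simp only [LinearMap.sum_apply, LinearMap.smul_apply, resFun_X_pow, smul_eq_mul,
        LinearMap.comp_apply, LinearMap.mulRight_apply, ← pow_add]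
      simpa [add_comm] using this
  refine eq_of_pderiv_eq (fun s => ?_) ?_
  · rw [pderiv_topCoeff_X_pow he, map_sum]
    simp only [pderiv_mul, pderiv_resSeries_nat he hc]
    rw [Finset.sum_add_distrib]
    simp only [neg_mul, mul_neg, Finset.sum_neg_distrib]
    rw [key1 _ (degree_eulerAdj_divByMonic_lt he s a), key2 _ (degree_eulerAdj_divByMonic_lt he s b)]
    have hdeg : ∀ i : Fin r, (Polynomial.X ^ (i : ℕ) : Polynomial (MvPolynomial (Fin r) ℂ)).degree <
        (unfPoly r e).natDegree := fun i => by
      rw [hPn, Polynomial.degree_X_pow]; exact_mod_cast i.2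
    -- After `key1` and `key2`, equality of the derivatives is the metric compatibility for `u =
    -- x^a`, `v = x^b`, `g = x^s`.
    have := topCoeff_divByMonic_mul_eulerDeriv he hP (by omega) (hdeg a) (hdeg b) (hdeg s)
    simp only [← pow_add] at this
    linear_combination this
  · rw [map_sum, constantCoeff_topCoeff_X_pow he _ hr]
    simp only [map_mul, constantCoeff_resSeries hrc]
    -- At `v = 0` the matrix of residues is the identity, so only `γ = a` can contribute, and it
    -- does exactly when `a + b = r - 1`.
    rw [Finset.sum_eq_single a]
    · rw [if_pos rfl, one_mul]
      congr 1
      exact propext (by have := a.2; omega)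
    · intro k _ hk
      rw [if_neg, zero_mul]
      intro h
      exact hk (Fin.ext (by omega))
    · simp

end

/-! ### Flat coordinates and the gradient of the potential -/

/-- The flat coordinate `t_γ` (with zero-based `γ`). -/
noncomputable def flatCoord (r c e : ℕ) (γ : Fin r) : MvPolynomial (Fin r) ℂ :=
  C (-(1 + ((e + 1 : ℕ) : ℂ) * (((γ : ℕ) - c : ℤ) : ℂ))⁻¹) *
    resSeries r c (e + 1) ((γ : ℕ) - c) 0

/-- The index for which `1 + ε * dualIndex = -(1 + ε γ)`, where `ε = e + 1 ∈ {1, 2}`. -/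
def dualIndex (e γ : ℕ) : ℤ := -(γ : ℤ) - 2 + e

/-- The functional whose values on `x^a` are the derivatives `∂p_γ/∂v_a` of `flatGrad`. -/
noncomputable def gradFun (r c e γ : ℕ) :
    Polynomial (MvPolynomial (Fin r) ℂ) →ₗ[MvPolynomial (Fin r) ℂ] MvPolynomial (Fin r) ℂ :=
  (C (-(1 + ((e + 1 : ℕ) : ℂ) * (dualIndex e γ : ℂ))⁻¹) : MvPolynomial (Fin r) ℂ) •
    resFun r c e (dualIndex e γ)

/-- The derivative `p_γ = ∂F/∂t_γ` of the potential, as a function of the unfolding parameters. -/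
noncomputable def flatGrad (r c e : ℕ) (γ : Fin r) : MvPolynomial (Fin r) ℂ :=
  C (((1 + ((e + 1 : ℕ) : ℂ) * (dualIndex e γ : ℂ)) *
      (1 + ((e + 1 : ℕ) : ℂ) * ((dualIndex e γ - c : ℤ) : ℂ)))⁻¹) *
    resSeries r c (e + 1) (dualIndex e γ - c) 0

/-- The degree of the flat coordinate `t_γ`. -/
noncomputable def flatWeight (c γ : ℕ) : ℂ := ((c : ℂ) - (γ : ℂ)) / (c : ℂ)

/-- The degree of the potential. -/
noncomputable def potentialDegree (c e : ℕ) : ℂ := (2 * (c : ℂ) + 2 - (e : ℂ)) / (c : ℂ)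

/-- The potential as a function of the unfolding parameters. -/
noncomputable def unfPotential (r c e : ℕ) : MvPolynomial (Fin r) ℂ :=
  C ((potentialDegree c e)⁻¹) *
    ∑ γ : Fin r, C (flatWeight c γ) * flatCoord r c e γ * flatGrad r c e γ

section

variable {r c e : ℕ}

/-- For `ε = 2` the integer `1 + ε g` is odd; for `ε = 1` it vanishes only at `g = -1`. All
normalizing denominators have this form. -/
theorem one_add_mul_ne_zero (he : e ≤ 1) {g : ℤ} (hg : g ≠ -1 ∨ e = 1) :
    (1 + ((e + 1 : ℕ) : ℂ) * (g : ℂ)) ≠ 0 := by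
  have : (1 + ((e + 1 : ℕ) : ℤ) * g) ≠ 0 := by
    obtain rfl | rfl : e = 0 ∨ e = 1 := by omega
    · push_cast; omega
    · push_cast; omega
  exact_mod_cast this

theorem pderiv_flatCoord (he : e ≤ 1) (hc : c + e = r + 1) (a γ : Fin r) :
    pderiv a (flatCoord r c e γ) = resSeries r c (e + 1) (γ : ℕ) (a : ℕ) := by
  have h := one_add_mul_ne_zero he (g := (γ : ℕ) - c) (by have := γ.2; omega)
  rw [flatCoord, pderiv_C_mul, pderiv_resSeries (by omega), ← mul_assoc, ← C_mul, neg_mul_neg,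
    inv_mul_cancel₀ h, C_1, one_mul, sub_add_cancel, zero_add]

theorem pderiv_flatGrad (he : e ≤ 1) (hc : c + e = r + 1) (a γ : Fin r) :
    pderiv a (flatGrad r c e γ) = gradFun r c e γ (Polynomial.X ^ (a : ℕ)) := by
  have h := one_add_mul_ne_zero he (g := dualIndex e γ - c)
    (by have := γ.2; simp only [dualIndex]; omega)
  rw [flatGrad, pderiv_C_mul, pderiv_resSeries (by omega), gradFun, LinearMap.smul_apply,
    resFun_X_pow, ← mul_assoc, ← C_mul, sub_add_cancel, zero_add, smul_eq_mul]
  congr 2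
  rw [mul_inv]
  field_simp

/-- The Gauss–Manin connection at the negative index `dualIndex e γ`. The remainder moves to level
`dualIndex e γ + c = r - 1 - γ`, where it has a residue in general, and the normalization of
`gradFun` makes its coefficient `1`. -/
theorem pderiv_gradFun_X_pow (he : e ≤ 1) (hc : c + e = r + 1) (a b γ : Fin r) :
    pderiv a (gradFun r c e γ (Polynomial.X ^ (b : ℕ))) =
      resFun r c e ((r - 1 - γ : ℕ) : ℤ) (Polynomial.X ^ ((a : ℕ) + b) %ₘ unfPoly r e) -
        gradFun r c e γ (eulerAdj e (Polynomial.X ^ ((a : ℕ) + b) /ₘ unfPoly r e)) := by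
  have h := one_add_mul_ne_zero he (g := dualIndex e γ)
    (by have := γ.2; simp only [dualIndex]; omega)
  have hi : dualIndex e γ + c = ((r - 1 - γ : ℕ) : ℤ) := by
    have := γ.2; simp only [dualIndex]; omega
  simp only [gradFun, LinearMap.smul_apply, smul_eq_mul]
  rw [pderiv_C_mul, resFun_X_pow, pderiv_resSeries_eq he hc, hi, mul_sub, ← mul_assoc, ← C_mul,
    neg_mul_neg, inv_mul_cancel₀ h, C_1, one_mul]

theorem sum_resFun_mul_resSeries (he : e ≤ 1) (hc : c + e = r + 1) (hr : 1 ≤ r) (b : Fin r)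
    {f : Polynomial (MvPolynomial (Fin r) ℂ)} (hf : f.degree < r) :
    ∑ γ : Fin r, resFun r c e ((r - 1 - γ : ℕ) : ℤ) f * resSeries r c (e + 1) (γ : ℕ) (b : ℕ) =
      topCoeff (unfPoly r e) (f * Polynomial.X ^ (b : ℕ)) := by
  have := linearMap_eq_of_degree_lt
    (φ := ∑ γ : Fin r, resSeries r c (e + 1) (γ : ℕ) (b : ℕ) •
      resFun r c e ((r - 1 - γ : ℕ) : ℤ))
    (ψ := (topCoeff (unfPoly r e)).comp (LinearMap.mulRight _ (Polynomial.X ^ (b : ℕ))))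
    (k := r) (fun s hs => ?_) hf
  · simpa [mul_comm] using this
  · have := sum_resSeries_mul_resSeries he hc hr b ⟨s, hs⟩
    simp only [LinearMap.sum_apply, LinearMap.smul_apply, resFun_X_pow, smul_eq_mul,
      LinearMap.comp_apply, LinearMap.mulRight_apply, ← pow_add]
    rw [add_comm s (b : ℕ)]
    exact this

theorem degree_modByMonic_unfPoly_lt (he : e ≤ 1) (f : Polynomial (MvPolynomial (Fin r) ℂ)) :
    (f %ₘ unfPoly r e).degree < r := by
  have := degree_modByMonic_lt_natDegree (monic_unfPoly r he) f
  rwa [natDegree_unfPoly r he] at this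

theorem topCoeff_modByMonic_mul (he : e ≤ 1) (f g : Polynomial (MvPolynomial (Fin r) ℂ)) :
    topCoeff (unfPoly r e) ((f %ₘ unfPoly r e) * g) = topCoeff (unfPoly r e) (f * g) := by
  conv_rhs => rw [← Polynomial.modByMonic_add_div f (unfPoly r e), add_mul, map_add,
    mul_assoc, mul_comm (unfPoly r e), topCoeff_mul_self (monic_unfPoly r he), add_zero]

/-- The one-form `∑ p_γ dt_γ` is closed. -/
theorem sum_gradFun_mul_comm (he : e ≤ 1) (hc : c + e = r + 1) (hr : 1 ≤ r) (a b : Fin r) :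
    ∑ γ : Fin r, gradFun r c e γ (Polynomial.X ^ (a : ℕ)) *
        resSeries r c (e + 1) (γ : ℕ) (b : ℕ) =
      ∑ γ : Fin r, gradFun r c e γ (Polynomial.X ^ (b : ℕ)) *
        resSeries r c (e + 1) (γ : ℕ) (a : ℕ) := by
  obtain ⟨n, hn⟩ : ∃ n, (a : ℕ) + b = n := ⟨_, rfl⟩
  induction n using Nat.strong_induction_on generalizing a b with
  | _ n ih =>
  have key : ∀ a b : Fin r, (a : ℕ) + b = n → ∀ f : Polynomial (MvPolynomial (Fin r) ℂ),
      f.degree < (a : ℕ) →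
      ∑ γ : Fin r, gradFun r c e γ f * resSeries r c (e + 1) (γ : ℕ) (b : ℕ) =
      ∑ γ : Fin r, gradFun r c e γ (Polynomial.X ^ (b : ℕ)) * resFun r c e (γ : ℕ) f := by
    intro a b hab f hf
    have := linearMap_eq_of_degree_lt
      (φ := ∑ γ : Fin r, resSeries r c (e + 1) (γ : ℕ) (b : ℕ) • gradFun r c e γ)
      (ψ := ∑ γ : Fin r, gradFun r c e γ (Polynomial.X ^ (b : ℕ)) • resFun r c e (γ : ℕ))
      (k := a) (fun s hs => ?_) hf
    · simpa [mul_comm] using this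
    · have := ih (s + b) (by omega) ⟨s, by omega⟩ b rfl
      simp only [LinearMap.sum_apply, LinearMap.smul_apply, resFun_X_pow, smul_eq_mul]
      simpa [mul_comm] using this
  refine eq_of_pderiv_eq (fun s => ?_) ?_
  · simp only [map_sum, pderiv_mul, pderiv_gradFun_X_pow he hc, pderiv_resSeries_nat he hc,
      sub_mul, mul_neg, Finset.sum_add_distrib, Finset.sum_sub_distrib, Finset.sum_neg_distrib]
    -- On either side the remainders pair to `topCoeff` of `x^(s+a+b)`, which is symmetric in `a`
    -- and `b`. The connection terms have lower order, and `key` exchanges them.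
    rw [sum_resFun_mul_resSeries he hc hr b (degree_modByMonic_unfPoly_lt he _),
      sum_resFun_mul_resSeries he hc hr a (degree_modByMonic_unfPoly_lt he _),
      topCoeff_modByMonic_mul he, topCoeff_modByMonic_mul he,
      key a b hn _ (degree_eulerAdj_divByMonic_lt he s a),
      key b a (by omega) _ (degree_eulerAdj_divByMonic_lt he s b), ← pow_add, ← pow_add,
      add_right_comm]
    ring
  · have h0 : ∀ γ k : Fin r, constantCoeff (gradFun r c e γ (Polynomial.X ^ (k : ℕ))) = 0 := by
      intro γ k
      rw [gradFun, LinearMap.smul_apply, resFun_X_pow, smul_eq_mul, map_mul,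
        constantCoeff_resSeries (by omega), if_neg, mul_zero]
      simp only [dualIndex]; omega
    simp only [map_sum, map_mul, h0, zero_mul]

theorem euler_flatCoord (hc : r ≤ c) (γ : Fin r) :
    ∑ a : Fin r, C ((c : ℂ) - (a : ℕ)) * (X a * pderiv a (flatCoord r c e γ)) =
      C ((c : ℂ) - (γ : ℕ)) * flatCoord r c e γ := by
  have h := resSeries_euler (r := r) (c := c) (ε := e + 1) hc ((γ : ℕ) - c) 0
  simp only [flatCoord, pderiv_C_mul]
  push_cast at h ⊢
  rw [mul_left_comm, show ((c : ℂ) - (γ : ℕ)) = 0 - ((γ : ℕ) - (c : ℂ)) by ring, ← h,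
    Finset.mul_sum]
  exact Finset.sum_congr rfl fun a _ => by ring

theorem euler_flatGrad (hc : r ≤ c) (γ : Fin r) :
    ∑ a : Fin r, C ((c : ℂ) - (a : ℕ)) * (X a * pderiv a (flatGrad r c e γ)) =
      C ((c : ℂ) + (γ : ℕ) + 2 - e) * flatGrad r c e γ := by
  have h := resSeries_euler (r := r) (c := c) (ε := e + 1) hc (dualIndex e γ - c) 0
  simp only [flatGrad, pderiv_C_mul]
  rw [mul_left_comm, show ((c : ℂ) + (γ : ℕ) + 2 - e) = (0 : ℤ) - ((dualIndex e γ - c : ℤ) : ℂ) by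
    simp only [dualIndex]; push_cast; ring, ← h, Finset.mul_sum]
  exact Finset.sum_congr rfl fun a _ => by ring

theorem potentialDegree_ne_zero (he : e ≤ 1) (hc : 1 ≤ c) : potentialDegree c e ≠ 0 := by
  have h1 : (c : ℂ) ≠ 0 := by exact_mod_cast (show c ≠ 0 by omega)
  have h2 : (2 * (c : ℂ) + 2 - (e : ℂ)) ≠ 0 := by
    have : (2 * (c : ℤ) + 2 - (e : ℤ)) ≠ 0 := by omega
    exact_mod_cast this
  exact div_ne_zero h2 h1

/-- Contraction of the closed form with the Euler field: `t_γ` is replaced by its Euler derivative,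
closedness exchanges `a` and `b`, and the Euler derivative of `p_γ` is collected. -/
theorem sum_flatWeight_mul (he : e ≤ 1) (hc : c + e = r + 1) (hr : 1 ≤ r) (a : Fin r) :
    ∑ γ : Fin r, C (flatWeight c γ) * flatCoord r c e γ * pderiv a (flatGrad r c e γ) =
      ∑ γ : Fin r, C ((c : ℂ)⁻¹ * ((c : ℂ) + (γ : ℕ) + 2 - e)) * flatGrad r c e γ *
        pderiv a (flatCoord r c e γ) := by
  have hrc : r ≤ c := by omega
  have hl : ∀ γ : Fin r, C (flatWeight c γ) * flatCoord r c e γ * pderiv a (flatGrad r c e γ) =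
      ∑ b : Fin r, C ((c : ℂ)⁻¹) * (C ((c : ℂ) - (b : ℕ)) * X b) *
        (pderiv a (flatGrad r c e γ) * pderiv b (flatCoord r c e γ)) := by
    intro γ
    rw [flatWeight, div_eq_inv_mul, C_mul, mul_assoc (C ((c : ℂ)⁻¹)), ← euler_flatCoord hrc,
      Finset.mul_sum, Finset.sum_mul]
    exact Finset.sum_congr rfl fun b _ => by ring
  have hrr : ∀ γ : Fin r, C ((c : ℂ)⁻¹ * ((c : ℂ) + (γ : ℕ) + 2 - e)) * flatGrad r c e γ *
      pderiv a (flatCoord r c e γ) =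
      ∑ b : Fin r, C ((c : ℂ)⁻¹) * (C ((c : ℂ) - (b : ℕ)) * X b) *
        (pderiv b (flatGrad r c e γ) * pderiv a (flatCoord r c e γ)) := by
    intro γ
    rw [C_mul, mul_assoc (C ((c : ℂ)⁻¹)), ← euler_flatGrad hrc, Finset.mul_sum, Finset.sum_mul]
    exact Finset.sum_congr rfl fun b _ => by ring
  rw [Finset.sum_congr rfl fun γ _ => hl γ, Finset.sum_congr rfl fun γ _ => hrr γ]
  refine Finset.sum_comm.trans (Eq.trans ?_ Finset.sum_comm)
  refine Finset.sum_congr rfl fun b _ => ?_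
  rw [← Finset.mul_sum, ← Finset.mul_sum]
  simp only [pderiv_flatGrad he hc, pderiv_flatCoord he hc]
  rw [sum_gradFun_mul_comm he hc hr a b]

/-- States `dF = ∑ p_γ dt_γ`. The degrees of `t_γ` and `p_γ` add up to `potentialDegree`, which
cancels the prefactor of `unfPotential`. -/
theorem pderiv_unfPotential (he : e ≤ 1) (hc : c + e = r + 1) (hr : 1 ≤ r) (a : Fin r) :
    pderiv a (unfPotential r c e) =
      ∑ γ : Fin r, flatGrad r c e γ * resSeries r c (e + 1) (γ : ℕ) (a : ℕ) := by
  have hc0 : (c : ℂ) ≠ 0 := by exact_mod_cast (show c ≠ 0 by omega)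
  have h2 := sum_flatWeight_mul he hc hr a
  have hk := potentialDegree_ne_zero he (show 1 ≤ c by omega)
  rw [unfPotential, pderiv_C_mul, map_sum]
  simp only [pderiv_mul, pderiv_C, zero_mul, zero_add, Finset.sum_add_distrib]
  rw [h2, ← Finset.sum_add_distrib, Finset.mul_sum]
  refine Finset.sum_congr rfl fun γ _ => ?_
  rw [pderiv_flatCoord he hc]
  have h3 : C ((potentialDegree c e)⁻¹) * (C (flatWeight c γ) +
      C ((c : ℂ)⁻¹ * ((c : ℂ) + (γ : ℕ) + 2 - e))) = (1 : MvPolynomial (Fin r) ℂ) := by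
    rw [← C_add, ← C_mul, ← C_1]
    congr 1
    rw [inv_mul_eq_one₀ hk, potentialDegree, flatWeight]
    field_simp
    ring
  linear_combination flatGrad r c e γ * resSeries r c (e + 1) (γ : ℕ) (a : ℕ) * h3

/-! ### The polynomial change to flat coordinates -/

/-- The Jacobian matrix of the flat coordinates is unitriangular. -/
theorem eq_zero_of_sum_mul_resSeries {B : Type*} [CommRing B] (hc : r ≤ c)
    (φ : MvPolynomial (Fin r) ℂ →+* B) {y : Fin r → B}
    (h : ∀ a : Fin r, ∑ γ : Fin r, y γ * φ (resSeries r c (e + 1) (γ : ℕ) (a : ℕ)) = 0) :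
    ∀ γ, y γ = 0 := by
  intro γ
  obtain ⟨n, hn⟩ : ∃ n, (γ : ℕ) = n := ⟨_, rfl⟩
  induction n using Nat.strong_induction_on generalizing γ with
  | _ n ih =>
  have h1 := h γ
  rw [Finset.sum_eq_single γ, resSeries_self hc, map_one, mul_one] at h1
  · exact h1
  · intro b _ hb
    rcases lt_or_gt_of_ne (fun h' => hb (Fin.ext h') : (b : ℕ) ≠ γ) with hlt | hgt
    · rw [ih b (by omega) b rfl, zero_mul]
    · rw [resSeries_of_lt (by omega), map_zero, mul_zero]
  · simp

theorem notMem_vars_of_pderiv_eq_zero {σ : Type*} {f : MvPolynomial σ ℂ} {a : σ}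
    (h : pderiv a f = 0) : a ∉ f.vars := by
  classical
  rw [mem_vars_iff_mem_support]
  rintro ⟨μ, hμ, ha⟩
  rw [mem_support_iff] at hμ
  have h1 := congrArg (coeff (μ - Finsupp.single a 1)) h
  rw [coeff_pderiv, tsub_add_cancel_of_le (Finsupp.single_le_iff.2
    (Nat.one_le_iff_ne_zero.2 (Finsupp.mem_support_iff.1 ha))), coeff_zero] at h1
  rcases mul_eq_zero.1 h1 with h2 | h2
  · exact hμ h2
  · exact Nat.cast_add_one_ne_zero _ h2

/-- The Jacobian is unitriangular, so `t_k - v_k` involves only the `v_j` with `j > k`, and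
descending induction recovers every `v_k`. -/
theorem aeval_flatCoord_surjective (he : e ≤ 1) (hc : c + e = r + 1) :
    Function.Surjective (aeval (flatCoord r c e) : MvPolynomial (Fin r) ℂ →ₐ[ℂ] _) := by
  rw [← AlgHom.range_eq_top, eq_top_iff, ← adjoin_range_X, Algebra.adjoin_le_iff]
  rintro _ ⟨k, rfl⟩
  obtain ⟨n, hn⟩ : ∃ n, r - (k : ℕ) = n := ⟨_, rfl⟩
  induction n using Nat.strong_induction_on generalizing k with
  | _ n ih =>
  have hrc : r ≤ c := by omega
  have hs : flatCoord r c e k - X k ∈ supported ℂ {j : Fin r | k < j} := by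
    rw [mem_supported]
    intro a ha
    by_contra hak
    refine notMem_vars_of_pderiv_eq_zero ?_ ha
    rw [map_sub, pderiv_flatCoord he hc]
    rcases (not_lt.1 hak : a ≤ k).eq_or_lt with rfl | hlt
    · rw [resSeries_self hrc, pderiv_X_self, sub_self]
    · rw [resSeries_of_lt (by exact_mod_cast hlt), pderiv_X_of_ne hlt.ne', sub_self]
  have hle : supported ℂ {j : Fin r | k < j} ≤
      (aeval (flatCoord r c e) : MvPolynomial (Fin r) ℂ →ₐ[ℂ] _).range := by
    rw [supported_eq_adjoin_X, Algebra.adjoin_le_iff]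
    rintro _ ⟨j, hj, rfl⟩
    have hj' : (k : ℕ) < j := hj
    exact ih (r - j) (by have := j.2; omega) j rfl
  have h1 : flatCoord r c e k ∈
      (aeval (flatCoord r c e) : MvPolynomial (Fin r) ℂ →ₐ[ℂ] _).range := ⟨X k, by simp⟩
  have := sub_mem h1 (hle hs)
  simpa using this

/-- The kernels of the iterates stabilize, and surjectivity of `φ^n` pulls an element of `ker φ`
back to `ker φ^(n+1) = ker φ^n`. This gives algebraic independence of the flat coordinates. -/
theorem injective_of_surjective_of_isNoetherianRing {B : Type*} [CommRing B] [IsNoetherianRing B]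
    (φ : B →+* B) (h : Function.Surjective φ) : Function.Injective φ := by
  let K : ℕ →o Ideal B :=
    ⟨fun n => RingHom.ker (φ ^ n), monotone_nat_of_le_succ fun n x hx => by
      rw [RingHom.mem_ker] at hx ⊢
      rw [pow_succ', RingHom.mul_def, RingHom.comp_apply, hx, map_zero]⟩
  obtain ⟨n, hn⟩ := monotone_stabilizes_iff_noetherian.2 ‹_› K
  have hsurj : Function.Surjective ((φ ^ n : B →+* B) : B → B) := by
    rw [RingHom.coe_pow]; exact h.iterate n
  rw [injective_iff_map_eq_zero]
  intro x hx
  obtain ⟨y, rfl⟩ := hsurj x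
  have hy : y ∈ K (n + 1) := by
    change y ∈ RingHom.ker (φ ^ (n + 1))
    rw [RingHom.mem_ker, pow_succ', RingHom.mul_def, RingHom.comp_apply, hx]
  rw [← hn (n + 1) (Nat.le_succ n)] at hy
  exact hy

/-- The isomorphism of the functions of the flat coordinates with the functions of the unfolding
parameters. -/
noncomputable def flatEquiv (he : e ≤ 1) (hc : c + e = r + 1) :
    MvPolynomial (Fin r) ℂ ≃ₐ[ℂ] MvPolynomial (Fin r) ℂ :=
  AlgEquiv.ofBijective (aeval (flatCoord r c e))
    ⟨injective_of_surjective_of_isNoetherianRing (aeval (flatCoord r c e)).toRingHom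
      (aeval_flatCoord_surjective he hc), aeval_flatCoord_surjective he hc⟩

theorem flatEquiv_apply (he : e ≤ 1) (hc : c + e = r + 1) (f : MvPolynomial (Fin r) ℂ) :
    flatEquiv he hc f = aeval (flatCoord r c e) f := rfl

end

/-! ### The potential in flat coordinates and covariant Hessians -/

/-- The chain rule for partial derivatives of polynomials. -/
theorem pderiv_aeval_chain {σ τ : Type*} [Fintype σ] (t : σ → MvPolynomial τ ℂ) (a : τ)
    (F : MvPolynomial σ ℂ) :
    pderiv a (aeval t F) = ∑ β, aeval t (pderiv β F) * pderiv a (t β) := by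
  classical
  induction F using MvPolynomial.induction_on with
  | C x => simp
  | add p q hp hq =>
    simp only [map_add, hp, hq, add_mul, Finset.sum_add_distrib]
  | mul_X p i hp =>
    have h : ∀ β, aeval t (pderiv β (p * X i)) * pderiv a (t β) =
        aeval t (pderiv β p) * pderiv a (t β) * t i +
          if β = i then aeval t p * pderiv a (t i) else 0 := by
      intro β
      rw [pderiv_mul, map_add, map_mul, map_mul, aeval_X]
      split_ifs with h
      · subst h
        rw [pderiv_X_self, map_one]; ring
      · rw [pderiv_X_of_ne (Ne.symm h), map_zero]; ring
    rw [map_mul, aeval_X, pderiv_mul, hp, Finset.sum_mul, Finset.sum_congr rfl fun β _ => h β,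
      Finset.sum_add_distrib, Finset.sum_ite_eq', if_pos (Finset.mem_univ i)]

section

variable {r c e : ℕ}

/-- The potential as a function of the flat coordinates. -/
noncomputable def flatPotential (he : e ≤ 1) (hc : c + e = r + 1) : MvPolynomial (Fin r) ℂ :=
  (flatEquiv he hc).symm (unfPotential r c e)

theorem aeval_flatPotential (he : e ≤ 1) (hc : c + e = r + 1) :
    aeval (flatCoord r c e) (flatPotential he hc) = unfPotential r c e :=
  (flatEquiv he hc).apply_symm_apply _

/-- Since the Jacobian is invertible, the coefficients of `dt_γ` in a differential are unique, hence
equal to the `t`-derivatives. -/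
theorem eq_aeval_pderiv (he : e ≤ 1) (hc : c + e = r + 1) {F : MvPolynomial (Fin r) ℂ}
    {p : Fin r → MvPolynomial (Fin r) ℂ}
    (h : ∀ a : Fin r, pderiv a (aeval (flatCoord r c e) F) =
      ∑ γ : Fin r, p γ * resSeries r c (e + 1) (γ : ℕ) (a : ℕ)) (γ : Fin r) :
    aeval (flatCoord r c e) (pderiv γ F) = p γ := by
  refine sub_eq_zero.1 (eq_zero_of_sum_mul_resSeries (c := c) (e := e) (by omega) (RingHom.id _)
    (y := fun γ => aeval (flatCoord r c e) (pderiv γ F) - p γ) (fun a => ?_) γ)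
  have := h a
  rw [pderiv_aeval_chain] at this
  simp only [pderiv_flatCoord he hc] at this
  simp only [RingHom.id_apply, sub_mul, Finset.sum_sub_distrib, this, sub_self]

theorem aeval_pderiv_flatPotential (he : e ≤ 1) (hc : c + e = r + 1) (hr : 1 ≤ r) (γ : Fin r) :
    aeval (flatCoord r c e) (pderiv γ (flatPotential he hc)) = flatGrad r c e γ :=
  eq_aeval_pderiv he hc (fun a => by
    rw [aeval_flatPotential, pderiv_unfPotential he hc hr]) γ

theorem euler_flatPotential (he : e ≤ 1) (hc : c + e = r + 1) (hr : 1 ≤ r) :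
    ∑ γ : Fin r, C (flatWeight c γ) * X γ * pderiv γ (flatPotential he hc) =
      C (potentialDegree c e) * flatPotential he hc := by
  apply (flatEquiv he hc).injective
  rw [flatEquiv_apply, flatEquiv_apply, map_sum, map_mul, aeval_flatPotential, unfPotential]
  simp only [map_mul, aeval_pderiv_flatPotential he hc hr, aeval_X, algHom_C, algebraMap_eq]
  rw [← mul_assoc, ← C_mul, mul_inv_cancel₀ (potentialDegree_ne_zero he (by omega)), C_1, one_mul]

end

theorem eval_aeval_eq {σ τ : Type*} (t : σ → MvPolynomial τ ℂ) (v : τ → ℂ) (f : MvPolynomial σ ℂ) :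
    eval v (aeval t f) = eval (fun α => eval v (t α)) f := by
  induction f using MvPolynomial.induction_on with
  | C x => simp
  | add p q hp hq => simp only [map_add, hp, hq]
  | mul_X p i hp => simp only [map_mul, hp, aeval_X, eval_X]

/-- The covariant Hessian of a function of the flat coordinates. -/
theorem sum_pderiv_mul_pderiv_mul_aeval {σ τ : Type*} [Fintype σ] [Fintype τ]
    (t : σ → MvPolynomial τ ℂ) (a b : τ) (Γ : τ → MvPolynomial τ ℂ)
    (h : ∀ β, pderiv a (pderiv b (t β)) = ∑ s, Γ s * pderiv s (t β)) (G : MvPolynomial σ ℂ) :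
    ∑ α, ∑ β, pderiv a (t α) * pderiv b (t β) * aeval t (pderiv α (pderiv β G)) =
      pderiv a (pderiv b (aeval t G)) - ∑ s, Γ s * pderiv s (aeval t G) := by
  have h1 : ∀ β, pderiv a (aeval t (pderiv β G) * pderiv b (t β)) =
      ∑ α, pderiv a (t α) * pderiv b (t β) * aeval t (pderiv α (pderiv β G)) +
        ∑ s, Γ s * (aeval t (pderiv β G) * pderiv s (t β)) := by
    intro β
    rw [pderiv_mul, pderiv_aeval_chain, h, Finset.sum_mul, Finset.mul_sum]
    exact congrArg₂ (· + ·) (Finset.sum_congr rfl fun α _ => by ring)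
      (Finset.sum_congr rfl fun α _ => by ring)
  have h2 : ∑ s, Γ s * pderiv s (aeval t G) =
      ∑ β, ∑ s, Γ s * (aeval t (pderiv β G) * pderiv s (t β)) := by
    rw [Finset.sum_comm]
    exact Finset.sum_congr rfl fun s _ => by rw [pderiv_aeval_chain, Finset.mul_sum]
  rw [h2, pderiv_aeval_chain t b, map_sum, Finset.sum_congr rfl fun β _ => h1 β,
    Finset.sum_add_distrib, add_sub_cancel_right, Finset.sum_comm]

/-! ### Uniqueness of potentials and computation of structure constants -/

theorem coeff_eq_zero_of_forall_pderiv {σ : Type*} {f : MvPolynomial σ ℂ} {k : ℕ}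
    (h : ∀ a (ν : σ →₀ ℕ), k ≤ ν.degree → coeff ν (pderiv a f) = 0) (μ : σ →₀ ℕ)
    (hμ : k + 1 ≤ μ.degree) : coeff μ f = 0 := by
  classical
  obtain ⟨a, ha⟩ : ∃ a, μ a ≠ 0 := by
    by_contra hcon
    push Not at hcon
    have : μ = 0 := Finsupp.ext hcon
    rw [this] at hμ
    simp at hμ
  have h2 : μ - Finsupp.single a 1 + Finsupp.single a 1 = μ :=
    tsub_add_cancel_of_le (Finsupp.single_le_iff.2 (Nat.one_le_iff_ne_zero.2 ha))
  have h3 : k ≤ (μ - Finsupp.single a 1).degree := by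
    have := congrArg Finsupp.degree h2
    rw [map_add, Finsupp.degree_single] at this
    omega
  have h1 := h a _ h3
  rw [coeff_pderiv, h2] at h1
  exact (mul_eq_zero.1 h1).resolve_right (Nat.cast_add_one_ne_zero _)

namespace SingularityData

variable {n : ℕ} {S : SingularityData n}

theorem eval_flatPoint (v : Fin n → ℂ) (f : MvPolynomial (Fin n) ℂ) :
    eval (S.flatPoint v) f = eval v (aeval S.flat f) := (eval_aeval_eq S.flat v f).symm

/-- The product determines all third derivatives, because the Jacobian and `eta` are invertible.
Here `d` clears the denominators of the weights. A monomial of degree at most two has scaled weight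
at most `2 d < M`, so it cannot occur in a difference that is homogeneous of weight `M`. -/
theorem IsPotential.eq {F F' : MvPolynomial (Fin n) ℂ} (hF : S.IsPotential F)
    (hF' : S.IsPotential F') (hinj : Function.Injective (aeval S.flat : MvPolynomial (Fin n) ℂ → _))
    (heta : S.eta * S.eta = 1)
    (hJ : ∀ y : Fin n → MvPolynomial (Fin n) ℂ,
      (∀ a, ∑ γ, y γ * pderiv a (S.flat γ) = 0) → ∀ γ, y γ = 0)
    {d M : ℕ} {ω : Fin n → ℕ} (hω : ∀ α, S.weight α * d = ω α) (hM : (3 - S.charge) * d = M)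
    (hle : ∀ α, ω α ≤ d) (hlt : 2 * d < M) : F = F' := by
  have hinv : S.eta⁻¹ = S.eta := Matrix.inv_eq_right_inv heta
  have h1 : ∀ a b δ, ∑ α, (∑ β, (∑ γ, aeval S.flat (pderiv α (pderiv β (pderiv γ (F - F')))) *
      C (S.eta γ δ)) * pderiv b (S.flat β)) * pderiv a (S.flat α) = 0 := by
    intro a b δ
    refine MvPolynomial.funext fun v => ?_
    have h := (hF.product v a b δ).symm.trans (hF'.product v a b δ)
    rw [← sub_eq_zero] at h
    simp only [eval_flatPoint, hinv, ← Finset.sum_sub_distrib] at h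
    rw [map_zero, ← h]
    simp only [map_sum, map_mul, eval_C, map_sub, Finset.sum_mul]
    refine Finset.sum_congr rfl fun α _ => Finset.sum_congr rfl fun β _ =>
      Finset.sum_congr rfl fun γ _ => ?_
    ring
  have h2 : ∀ α β δ, ∑ γ, aeval S.flat (pderiv α (pderiv β (pderiv γ (F - F')))) *
      C (S.eta γ δ) = 0 := by
    intro α β δ
    exact hJ _ (fun b => hJ _ (fun a => h1 a b δ) α) β
  -- Multiplication by `eta` once more undoes the contraction, as `eta` is its own inverse.
  have h3 : ∀ α β γ, pderiv α (pderiv β (pderiv γ (F - F'))) = 0 := by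
    intro α β γ
    apply hinj
    rw [map_zero]
    have h4 : ∑ δ, (∑ ρ, aeval S.flat (pderiv α (pderiv β (pderiv ρ (F - F')))) *
      C (S.eta ρ δ)) * C (S.eta δ γ) = aeval S.flat (pderiv α (pderiv β (pderiv γ (F - F')))) := by
      simp only [Finset.sum_mul]
      rw [Finset.sum_comm]
      simp only [mul_assoc, ← C_mul, ← Finset.mul_sum, ← map_sum, ← Matrix.mul_apply, heta,
        Matrix.one_apply]
      rw [Finset.sum_eq_single γ]
      · simp
      · intro b _ hb
        simp [hb]
      · simp
    rw [← h4]
    exact Finset.sum_eq_zero fun δ _ => by rw [h2, zero_mul]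
  rw [← sub_eq_zero]
  have h5 : ∀ μ : Fin n →₀ ℕ, 3 ≤ μ.degree → coeff μ (F - F') = 0 :=
    coeff_eq_zero_of_forall_pderiv fun γ => coeff_eq_zero_of_forall_pderiv fun β =>
      coeff_eq_zero_of_forall_pderiv (k := 0) fun α ν _ => by rw [h3, coeff_zero]
  ext μ
  rw [coeff_zero]
  by_cases hμ : 3 ≤ μ.degree
  · exact h5 μ hμ
  have h6 : ∑ α, C (S.weight α) * (X α * pderiv α (F - F')) = C (3 - S.charge) * (F - F') := by
    have e1 := hF.euler
    have e2 := hF'.euler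
    simp only [mul_assoc] at e1 e2
    rw [mul_sub, ← e1, ← e2, ← Finset.sum_sub_distrib]
    exact Finset.sum_congr rfl fun α _ => by rw [map_sub]; ring
  have h7 := congrArg (coeff μ) h6
  simp only [coeff_sum, coeff_C_mul, coeff_X_mul_pderiv] at h7
  by_contra hne
  have h8 : ∑ α, S.weight α * (μ α : ℂ) = 3 - S.charge := by
    apply mul_right_cancel₀ hne
    rw [← h7, Finset.sum_mul]
    exact Finset.sum_congr rfl fun α _ => by ring
  have h9 : ∑ α, ω α * μ α = M := by
    have : ((∑ α, ω α * μ α : ℕ) : ℂ) = (M : ℂ) := by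
      rw [← hM, ← h8, Finset.sum_mul]
      push_cast
      exact Finset.sum_congr rfl fun α _ => by rw [← hω]; ring
    exact_mod_cast this
  have h10 : ∑ α, ω α * μ α ≤ d * μ.degree := by
    rw [Finsupp.degree_eq_sum, Finset.mul_sum]
    exact Finset.sum_le_sum fun α _ => Nat.mul_le_mul_right _ (hle α)
  have h11 : d * μ.degree ≤ d * 2 := Nat.mul_le_mul_left _ (by omega)
  omega

theorem structureConst_eq {v : Fin n → ℂ} (hli : LinearIndependent ℂ (S.cls v))
    (hsp : Submodule.span ℂ (Set.range (S.cls v)) = ⊤) {a b : Fin n} {x : Fin n → ℂ}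
    (h : S.cls v a * S.cls v b = ∑ s, x s • S.cls v s) (s : Fin n) :
    S.structureConst v a b s = x s := by
  have hB : ∃ B : Module.Basis (Fin n) ℂ (S.LocalAlgebra v), ∀ k, B k = S.cls v k :=
    ⟨Module.Basis.mk hli hsp.ge, fun k => Module.Basis.mk_apply hli hsp.ge k⟩
  rw [structureConst, dif_pos hB, h]
  have h2 := hB.choose.repr_sum_self x
  simp only [hB.choose_spec] at h2
  exact congrFun h2 s

theorem pairing_eq {v : Fin n → ℂ} {a b s : Fin n} (hs : (s : ℕ) + 1 = S.top) :
    S.pairing v a b = S.structureConst v a b s := by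
  rw [pairing, Finset.sum_eq_single s]
  · rw [if_pos hs]
  · intro k _ hk
    rw [if_neg]
    intro h
    exact hk (Fin.ext (by omega))
  · simp

theorem span_cls_eq_top {v : Fin n → ℂ} (h1 : 1 ∈ Submodule.span ℂ (Set.range (S.cls v)))
    (h : ∀ i k, Ideal.Quotient.mk (S.jacobianIdeal v) (X i) * S.cls v k ∈
      Submodule.span ℂ (Set.range (S.cls v))) :
    Submodule.span ℂ (Set.range (S.cls v)) = ⊤ := by
  have hmul : ∀ i, ∀ z ∈ Submodule.span ℂ (Set.range (S.cls v)),
      Ideal.Quotient.mk (S.jacobianIdeal v) (X i) * z ∈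
        Submodule.span ℂ (Set.range (S.cls v)) := by
    intro i z hz
    induction hz using Submodule.span_induction with
    | mem x hx => obtain ⟨k, rfl⟩ := hx; exact h i k
    | zero => rw [mul_zero]; exact zero_mem _
    | add x y _ _ hx hy => rw [mul_add]; exact add_mem hx hy
    | smul c x _ hx => rw [mul_smul_comm]; exact Submodule.smul_mem _ _ hx
  rw [eq_top_iff]
  rintro z -
  obtain ⟨g, rfl⟩ := Ideal.Quotient.mk_surjective z
  induction g using MvPolynomial.induction_on with
  | C x =>
    have : Ideal.Quotient.mk (S.jacobianIdeal v) (C x) = x • (1 : S.LocalAlgebra v) := by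
      rw [C_eq_smul_one]; rfl
    rw [this]
    exact Submodule.smul_mem _ _ h1
  | add p q hp hq => rw [map_add]; exact add_mem hp hq
  | mul_X p i hp => rw [map_mul, mul_comm]; exact hmul i _ hp

end SingularityData

/-! ### Christoffel symbols and the explicit flat coordinates -/

section

variable {r c e : ℕ}

theorem resFun_eq_sum (g : ℤ) {f : Polynomial (MvPolynomial (Fin r) ℂ)} (hf : f.degree < r) :
    resFun r c e g f = ∑ s : Fin r, f.coeff s * resSeries r c (e + 1) g (s : ℕ) := by
  have := linearMap_eq_of_degree_lt
    (φ := resFun r c e g)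
    (ψ := ∑ s : Fin r, resSeries r c (e + 1) g (s : ℕ) •
      Polynomial.lcoeff (MvPolynomial (Fin r) ℂ) s) (k := r) (fun s hs => ?_) hf
  · rw [this]
    simp [mul_comm]
  · rw [resFun_X_pow, LinearMap.sum_apply, Finset.sum_eq_single ⟨s, hs⟩]
    · simp
    · intro b _ hb
      have : (b : ℕ) ≠ s := fun h => hb (Fin.ext h)
      simp [Polynomial.coeff_X_pow, this]
    · simp

theorem gradFun_eq_sum (γ : ℕ) {f : Polynomial (MvPolynomial (Fin r) ℂ)} (hf : f.degree < r) :
    gradFun r c e γ f = ∑ s : Fin r, f.coeff s * gradFun r c e γ (Polynomial.X ^ (s : ℕ)) := by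
  simp only [gradFun, LinearMap.smul_apply, resFun_eq_sum _ hf, Finset.mul_sum, resFun_X_pow,
    smul_eq_mul]
  exact Finset.sum_congr rfl fun s _ => by ring

/-- The Christoffel symbols of the flat connection in the unfolding parameters. -/
noncomputable def christoffel (r e : ℕ) (a b s : Fin r) : MvPolynomial (Fin r) ℂ :=
  -(eulerAdj e (Polynomial.X ^ ((a : ℕ) + b) /ₘ unfPoly r e)).coeff s

theorem degree_eulerAdj_lt_natDegree (he : e ≤ 1) (a b : Fin r) :
    (eulerAdj e (Polynomial.X ^ ((a : ℕ) + b) /ₘ unfPoly r e)).degree < r :=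
  (degree_eulerAdj_divByMonic_lt he a b).trans (by exact_mod_cast b.2)

theorem pderiv_pderiv_flatCoord (he : e ≤ 1) (hc : c + e = r + 1) (a b γ : Fin r) :
    pderiv a (pderiv b (flatCoord r c e γ)) =
      ∑ s, christoffel r e a b s * pderiv s (flatCoord r c e γ) := by
  simp only [pderiv_flatCoord he hc, pderiv_resSeries_nat he hc, christoffel,
    resFun_eq_sum _ (degree_eulerAdj_lt_natDegree he a b), neg_mul, Finset.sum_neg_distrib]

/-- The product condition in disguise: expanding the remainder in powers of `x` turns the right side
into `∑ c_ab^s ∂t_(r-1-γ)/∂v_s`, and `r - 1 - γ` is the index paired with `γ`. -/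
theorem hessian_flatGrad (he : e ≤ 1) (hc : c + e = r + 1) (a b γ : Fin r) :
    pderiv a (pderiv b (flatGrad r c e γ)) -
        ∑ s, christoffel r e a b s * pderiv s (flatGrad r c e γ) =
      resFun r c e ((r - 1 - γ : ℕ) : ℤ) (Polynomial.X ^ ((a : ℕ) + b) %ₘ unfPoly r e) := by
  simp only [pderiv_flatGrad he hc, pderiv_gradFun_X_pow he hc, christoffel,
    gradFun_eq_sum _ (degree_eulerAdj_lt_natDegree he a b), neg_mul, Finset.sum_neg_distrib]
  ring

/-- The factor `i = 0` of `binomCoeff` is `1 + ε(γ - c)`, which cancels the normalization; the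
remaining factors are shifted by `h = ε c`. -/
theorem flatCoord_eq_sum (he : e ≤ 1) (hc : c + e = r + 1) (γ : Fin r) :
    flatCoord r c e γ =
      ∑ α ∈ exponents (fun k : Fin r => c - (k : ℕ)) (c - (γ : ℕ)),
        C ((-1) ^ ((∑ k, α k) - 1) *
            (∏ j ∈ Finset.range ((∑ k, α k) - 1),
              (1 + ((e + 1 : ℕ) : ℂ) * ((γ : ℕ) : ℂ) + (j : ℂ) * (((e + 1 : ℕ) : ℂ) * (c : ℂ)))) *
            ∏ k, (((α k).factorial : ℂ))⁻¹) *
          ∏ k, X k ^ α k := by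
  have hq := one_add_mul_ne_zero he (g := (γ : ℕ) - c) (by have := γ.2; omega)
  have hγ := γ.2
  rw [flatCoord, resSeries, if_pos (by omega), show ((0 - ((γ : ℕ) - c : ℤ)).toNat) = c - γ by omega,
    Finset.mul_sum]
  refine Finset.sum_congr rfl fun α hα => ?_
  rw [← mul_assoc, ← C_mul]
  congr 2
  rw [mem_exponents (fun k => by have := k.2; omega)] at hα
  -- As `c - γ > 0`, the multi-index is nonzero, so `|α| - 1` is not truncated.
  obtain ⟨N, hN⟩ : ∃ N, ∑ k, α k = N + 1 := by
    refine Nat.exists_eq_succ_of_ne_zero fun h0 => ?_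
    rw [Finset.sum_eq_zero_iff] at h0
    rw [Finset.sum_eq_zero fun k hk => by rw [h0 k hk, mul_zero]] at hα
    omega
  rw [binomCoeff, hN, Nat.add_sub_cancel, Finset.prod_range_succ', pow_succ]
  have hp : ∏ k ∈ Finset.range N, (1 + ((e + 1 : ℕ) : ℂ) * (((γ : ℕ) - c : ℤ) : ℂ) +
      ((k + 1 : ℕ) : ℂ) * (((e + 1 : ℕ) : ℂ) * (c : ℂ))) =
      ∏ j ∈ Finset.range N, (1 + ((e + 1 : ℕ) : ℂ) * ((γ : ℕ) : ℂ) +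
        (j : ℂ) * (((e + 1 : ℕ) : ℂ) * (c : ℂ))) :=
    Finset.prod_congr rfl fun k _ => by push_cast; ring
  rw [hp, Nat.cast_zero, zero_mul, add_zero]
  linear_combination (-1) ^ N * (∏ j ∈ Finset.range N, (1 + ((e + 1 : ℕ) : ℂ) * ((γ : ℕ) : ℂ) +
    (j : ℂ) * (((e + 1 : ℕ) : ℂ) * (c : ℂ)))) * (∏ k, (((α k).factorial : ℂ))⁻¹) *
    inv_mul_cancel₀ hq

end

section

variable {r c e : ℕ}

theorem aeval_eq_sum_fin {B : Type*} [CommRing B] [Algebra ℂ B] (x : B) {f : Polynomial ℂ} {n : ℕ}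
    (hf : f.degree < n) : Polynomial.aeval x f = ∑ s : Fin n, f.coeff s • x ^ (s : ℕ) := by
  by_cases h0 : f = 0
  · simp [h0]
  rw [Polynomial.aeval_eq_sum_range' ((Polynomial.natDegree_lt_iff_degree_lt h0).2 hf),
    Fin.sum_univ_eq_sum_range (fun s => f.coeff s • x ^ s)]

theorem map_unfPoly (v : Fin r → ℂ) :
    (unfPoly r e).map (eval v) = Polynomial.X ^ r +
      ∑ k : Fin r, (v k * ((e + 1) * (k : ℕ) : ℕ)) • (Polynomial.X : Polynomial ℂ) ^ ((k : ℕ) + e - 1) := by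
  rw [unfPoly, Polynomial.map_add, Polynomial.map_pow, Polynomial.map_X, Polynomial.map_sum]
  refine congrArg₂ (· + ·) rfl (Finset.sum_congr rfl fun k _ => ?_)
  rw [eulerDeriv_X_pow, smul_smul, Polynomial.map_smul, Polynomial.map_pow, Polynomial.map_X,
    map_mul, eval_X, map_natCast]

theorem monic_map_unfPoly (he : e ≤ 1) (v : Fin r → ℂ) :
    ((unfPoly r e).map (eval v)).Monic := (monic_unfPoly r he).map _

theorem degree_map_unfPoly (he : e ≤ 1) (v : Fin r → ℂ) :
    ((unfPoly r e).map (eval v)).degree = r := by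
  rw [(monic_unfPoly r he).degree_map, Polynomial.degree_eq_natDegree (monic_unfPoly r he).ne_zero,
    natDegree_unfPoly r he]

theorem map_X_pow_modByMonic (he : e ≤ 1) (v : Fin r → ℂ) (n : ℕ) :
    (Polynomial.X ^ n %ₘ unfPoly r e).map (eval v) =
      Polynomial.X ^ n %ₘ (unfPoly r e).map (eval v) := by
  rw [Polynomial.map_modByMonic _ (monic_unfPoly r he), Polynomial.map_pow, Polynomial.map_X]

theorem map_X_pow_divByMonic (he : e ≤ 1) (v : Fin r → ℂ) (n : ℕ) :
    (Polynomial.X ^ n /ₘ unfPoly r e).map (eval v) =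
      Polynomial.X ^ n /ₘ (unfPoly r e).map (eval v) := by
  rw [Polynomial.map_divByMonic _ (monic_unfPoly r he), Polynomial.map_pow, Polynomial.map_X]

theorem degree_X_pow_modByMonic_lt (he : e ≤ 1) (v : Fin r → ℂ) (f : Polynomial ℂ) :
    (f %ₘ (unfPoly r e).map (eval v)).degree < r := by
  rw [← degree_map_unfPoly he v]
  exact Polynomial.degree_modByMonic_lt _ (monic_map_unfPoly he v)

end

/-! ### The singularity `A_n` -/

namespace SingularityData

section A

variable {n : ℕ} (v : Fin n → ℂ)

theorem cls_dataA (k : Fin n) : (dataA n).cls v k =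
    (Ideal.Quotient.mk ((dataA n).jacobianIdeal v) (X 0)) ^ (k : ℕ) := by
  rw [← map_pow]; rfl

theorem pderiv_zero_unfolding_dataA :
    pderiv 0 ((dataA n).unfolding v) =
      Polynomial.aeval (X 0 : PlanePoly) ((unfPoly n 0).map (eval v)) := by
  have hn : ((n : ℂ) + 1) ≠ 0 := Nat.cast_add_one_ne_zero n
  rw [map_unfPoly, unfolding, map_add, map_sum, map_add, map_sum]
  refine congrArg₂ (· + ·) ?_ (Finset.sum_congr rfl fun k _ => ?_)
  · have h : (C (1 / ((n : ℂ) + 1)) * ((n + 1 : ℕ) : PlanePoly)) = 1 := by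
      rw [← C_eq_coe_nat, ← C_mul, ← C_1]
      congr 1
      push_cast
      field_simp
    simp only [dataA, map_add, pderiv_mul, pderiv_C, pderiv_pow, pderiv_X_self, zero_mul, zero_add,
      map_pow, Polynomial.aeval_X, pderiv_X_of_ne (show (1 : Fin 2) ≠ 0 by decide), mul_zero,
      add_zero, mul_one, Nat.add_sub_cancel]
    rw [← mul_assoc, h, one_mul]
  · simp only [dataA, pderiv_mul, pderiv_C, pderiv_pow, pderiv_X_self, zero_mul, zero_add,
      map_smul, map_pow, Polynomial.aeval_X, mul_one, smul_eq_C_mul, C_mul, add_zero, one_mul]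
    rw [← C_eq_coe_nat, mul_assoc]

theorem pderiv_one_unfolding_dataA :
    pderiv 1 ((dataA n).unfolding v) = C 2 * X 1 := by
  rw [unfolding, map_add, map_sum, Finset.sum_eq_zero, add_zero]
  · simp only [dataA, map_add, pderiv_mul, pderiv_C, pderiv_pow, pderiv_X_self, zero_mul, zero_add,
      pderiv_X_of_ne (show (0 : Fin 2) ≠ 1 by decide), mul_zero, mul_one]
    rw [pow_one, ← C_eq_coe_nat]; rfl
  · intro k _
    simp only [dataA, pderiv_mul, pderiv_C, pderiv_pow,
      pderiv_X_of_ne (show (0 : Fin 2) ≠ 1 by decide), mul_zero, zero_mul, add_zero]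

theorem aeval_dataA_modByMonic (f : Polynomial ℂ) :
    Polynomial.aeval (Ideal.Quotient.mk ((dataA n).jacobianIdeal v) (X 0)) f =
      ∑ s : Fin n, (f %ₘ (unfPoly n 0).map (eval v)).coeff s • (dataA n).cls v s := by
  have h0 : Polynomial.aeval (Ideal.Quotient.mk ((dataA n).jacobianIdeal v) (X 0))
      ((unfPoly n 0).map (eval v)) = 0 := by
    have h1 : Ideal.Quotient.mk ((dataA n).jacobianIdeal v)
        (pderiv 0 ((dataA n).unfolding v)) = 0 :=
      Ideal.Quotient.eq_zero_iff_mem.2 (Ideal.subset_span (Set.mem_insert _ _))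
    rw [pderiv_zero_unfolding_dataA] at h1
    rw [← h1]
    exact Polynomial.aeval_algHom_apply (Ideal.Quotient.mkₐ ℂ ((dataA n).jacobianIdeal v)) _ _
  conv_lhs => rw [← Polynomial.modByMonic_add_div f ((unfPoly n 0).map (eval v))]
  rw [map_add, map_mul, h0, zero_mul, add_zero,
    aeval_eq_sum_fin _ (degree_X_pow_modByMonic_lt (by omega) v f)]
  simp only [cls_dataA]

theorem linearIndependent_cls_dataA : LinearIndependent ℂ ((dataA n).cls v) := by
  rw [Fintype.linearIndependent_iff]
  intro g hg
  -- Setting `y = 0` maps the algebra to `ℂ[x]/(P)`, where the powers of `x` below `deg P = n` are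
  -- independent.
  let φ : PlanePoly →ₐ[ℂ] Polynomial ℂ := aeval ![Polynomial.X, 0]
  have hφ0 : φ (X 0) = Polynomial.X := by simp [φ]
  have hφ1 : φ (X 1) = 0 := by simp [φ]
  have hI : (dataA n).jacobianIdeal v ≤
      (Ideal.span {(unfPoly n 0).map (eval v)}).comap φ.toRingHom := by
    rw [jacobianIdeal, Ideal.span_le]
    rintro _ (rfl | rfl)
    · change φ _ ∈ Ideal.span {(unfPoly n 0).map (eval v)}
      rw [pderiv_zero_unfolding_dataA, ← Polynomial.aeval_algHom_apply, hφ0,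
        Polynomial.aeval_X_left_apply]
      exact Ideal.mem_span_singleton_self _
    · change φ _ ∈ Ideal.span {(unfPoly n 0).map (eval v)}
      rw [pderiv_one_unfolding_dataA, map_mul, hφ1, mul_zero]
      exact zero_mem _
  have h1 : ∑ k : Fin n, C (g k) * (X 0 : PlanePoly) ^ (k : ℕ) ∈ (dataA n).jacobianIdeal v := by
    rw [← Ideal.Quotient.eq_zero_iff_mem, ← hg, map_sum]
    refine Finset.sum_congr rfl fun k _ => ?_
    rw [← smul_eq_C_mul]
    rfl
  have h2 : φ _ ∈ Ideal.span {(unfPoly n 0).map (eval v)} := hI h1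
  rw [Ideal.mem_span_singleton] at h2
  have h3 : φ (∑ k : Fin n, C (g k) * (X 0 : PlanePoly) ^ (k : ℕ)) =
      ∑ k : Fin n, Polynomial.C (g k) * Polynomial.X ^ (k : ℕ) := by
    simp only [map_sum, map_mul, map_pow, hφ0, algHom_C, Polynomial.algebraMap_eq]
  rw [h3] at h2
  have h4 := Polynomial.eq_zero_of_dvd_of_degree_lt h2
    (by rw [degree_map_unfPoly (by omega) v]; exact Polynomial.degree_sum_fin_lt g)
  intro k
  have h5 := congrArg (fun p => Polynomial.coeff p (k : ℕ)) h4
  simp only [Polynomial.finsetSum_coeff, Polynomial.coeff_C_mul, Polynomial.coeff_X_pow,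
    Polynomial.coeff_zero] at h5
  rw [Finset.sum_eq_single k] at h5
  · simpa using h5
  · intro b _ hb
    rw [if_neg fun h => hb (Fin.ext h.symm), mul_zero]
  · simp

theorem span_cls_dataA :
    Submodule.span ℂ (Set.range ((dataA n).cls v)) = ⊤ := by
  have haev : ∀ f : Polynomial ℂ,
      Polynomial.aeval (Ideal.Quotient.mk ((dataA n).jacobianIdeal v) (X 0)) f ∈
        Submodule.span ℂ (Set.range ((dataA n).cls v)) := by
    intro f
    rw [aeval_dataA_modByMonic]
    exact Submodule.sum_mem _ fun s _ =>
      Submodule.smul_mem _ _ (Submodule.subset_span (Set.mem_range_self s))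
  have hX1 : Ideal.Quotient.mk ((dataA n).jacobianIdeal v) (X 1) = 0 := by
    rw [Ideal.Quotient.eq_zero_iff_mem]
    have h1 : pderiv 1 ((dataA n).unfolding v) ∈ (dataA n).jacobianIdeal v :=
      Ideal.subset_span (Set.mem_insert_of_mem _ rfl)
    rw [pderiv_one_unfolding_dataA] at h1
    have := Ideal.mul_mem_left _ (C (2⁻¹ : ℂ)) h1
    rwa [← mul_assoc, ← C_mul, inv_mul_cancel₀ two_ne_zero, C_1, one_mul] at this
  refine span_cls_eq_top ?_ fun i k => ?_
  · simpa using haev 1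
  · fin_cases i
    · have := haev (Polynomial.X ^ ((k : ℕ) + 1))
      rwa [map_pow, Polynomial.aeval_X, pow_succ', ← cls_dataA] at this
    · change Ideal.Quotient.mk ((dataA n).jacobianIdeal v) (X 1) * _ ∈ _
      rw [hX1, zero_mul]
      exact zero_mem _

theorem structureConst_dataA (a b s : Fin n) :
    (dataA n).structureConst v a b s =
      eval v ((Polynomial.X ^ ((a : ℕ) + b) %ₘ unfPoly n 0).coeff s) := by
  rw [← Polynomial.coeff_map, map_X_pow_modByMonic (by omega)]
  refine structureConst_eq (linearIndependent_cls_dataA v) (span_cls_dataA v)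
    (x := fun s => (Polynomial.X ^ ((a : ℕ) + b) %ₘ (unfPoly n 0).map (eval v)).coeff s) ?_ s
  rw [← aeval_dataA_modByMonic, cls_dataA, cls_dataA, ← pow_add, map_pow, Polynomial.aeval_X]

theorem pairing_dataA (hn : 1 ≤ n) (a b : Fin n) :
    (dataA n).pairing v a b =
      eval v (topCoeff (unfPoly n 0) (Polynomial.X ^ ((a : ℕ) + b))) := by
  rw [pairing_eq (s := ⟨n - 1, by omega⟩) (by simp only [dataA]; omega),
    structureConst_dataA v, topCoeff_apply, natDegree_unfPoly n (by omega)]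

theorem flatA_eq (γ : Fin n) : flatA n γ = flatCoord n (n + 1) 0 γ := by
  rw [flatCoord_eq_sum (by omega) (by omega), flatA]
  refine Finset.sum_congr rfl fun α _ => ?_
  congr 3
  congr 1
  refine Finset.prod_congr rfl fun j _ => ?_
  push_cast
  ring

theorem eta_dataA (a b : Fin n) : (dataA n).eta a b = if b = Fin.rev a then 1 else 0 := by
  simp only [dataA]
  congr 1
  rw [eq_iff_iff, Fin.ext_iff, Fin.val_rev]
  have := a.2
  have := b.2
  omega

theorem eta_mul_eta_dataA : (dataA n).eta * (dataA n).eta = 1 := by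
  ext a b
  rw [Matrix.mul_apply, Finset.sum_eq_single (Fin.rev a)]
  · rw [eta_dataA, eta_dataA, if_pos rfl, one_mul, Fin.rev_rev, Matrix.one_apply]
    simp only [eq_comm]
  · intro k _ hk
    rw [eta_dataA, if_neg hk, zero_mul]
  · simp

theorem isPotential_dataA (hn : 1 ≤ n) :
    (dataA n).IsPotential (flatPotential (r := n) (c := n + 1) (e := 0) (by omega) (by omega)) := by
  have hflat : (dataA n).flat = flatCoord n (n + 1) 0 := funext flatA_eq
  have he : 0 ≤ 1 := by omega
  have hc : (n + 1) + 0 = n + 1 := by omega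
  have hrev : ∀ γ : Fin n, ((Fin.rev γ : Fin n) : ℕ) = n - 1 - γ := fun γ => by
    rw [Fin.val_rev]; omega
  refine ⟨fun v a b => ?_, fun v a b δ => ?_, ?_⟩
  · rw [pairing_dataA v hn, hflat, ← sum_resSeries_mul_resSeries he hc hn, map_sum]
    refine Finset.sum_congr rfl fun α _ => ?_
    simp only [eta_dataA, pderiv_flatCoord he hc]
    rw [Finset.sum_eq_single (Fin.rev α)]
    · rw [if_pos rfl, one_mul, hrev, map_mul]
    · intro β _ hβ
      rw [if_neg hβ]; ring
    · simp
  · rw [Matrix.inv_eq_right_inv eta_mul_eta_dataA]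
    have h1 := hessian_flatGrad he hc a b (Fin.rev δ)
    rw [← aeval_pderiv_flatPotential he hc hn, ← sum_pderiv_mul_pderiv_mul_aeval
      (flatCoord n (n + 1) 0) a b _ (pderiv_pderiv_flatCoord he hc a b),
      resFun_eq_sum _ (degree_modByMonic_unfPoly_lt he _)] at h1
    have h2 := congrArg (eval v) h1
    simp only [map_sum, map_mul] at h2
    have h3 : n - 1 - (Fin.rev δ : Fin n) = (δ : ℕ) := by
      rw [hrev]; have := δ.2; omega
    rw [h3] at h2
    simp only [structureConst_dataA v, eval_flatPoint, hflat]
    simp only [pderiv_flatCoord he hc] at h2 ⊢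
    rw [← h2]
    refine Finset.sum_congr rfl fun α _ => Finset.sum_congr rfl fun β _ => ?_
    rw [Finset.sum_eq_single (Fin.rev δ)]
    · rw [eta_dataA, Fin.rev_rev, if_pos rfl, mul_one]
    · intro γ _ hγ
      rw [eta_dataA, if_neg, mul_zero]
      rintro rfl
      exact hγ (Fin.rev_rev γ).symm
    · simp
  · have h := euler_flatPotential (r := n) (c := n + 1) (e := 0) he hc hn
    convert h using 3 with γ
    · refine congrArg₂ (· * ·) (congrArg C ?_) rfl
      simp only [dataA, flatWeight]
      push_cast
      ring
    · have hn1 : ((n : ℂ) + 1) ≠ 0 := Nat.cast_add_one_ne_zero n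
      simp only [dataA, potentialDegree]
      push_cast
      field_simp
      ring

theorem isPotential_dataA_iff (hn : 1 ≤ n) (F : MvPolynomial (Fin n) ℂ) :
    (dataA n).IsPotential F ↔
      F = flatPotential (r := n) (c := n + 1) (e := 0) (by omega) (by omega) := by
  have hflat : (dataA n).flat = flatCoord n (n + 1) 0 := funext flatA_eq
  have he : 0 ≤ 1 := by omega
  have hc : (n + 1) + 0 = n + 1 := by omega
  have hn1 : ((n : ℂ) + 1) ≠ 0 := Nat.cast_add_one_ne_zero n
  -- Weights and degree are multiplied by `n + 1`, and `3 - δ = (2n + 4)/(n + 1)`.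
  refine ⟨fun h => h.eq (isPotential_dataA hn) ?_ eta_mul_eta_dataA ?_ (d := n + 1)
    (M := 2 * n + 4) (ω := fun γ => n + 1 - γ) ?_ ?_ ?_ ?_, fun h => h ▸ isPotential_dataA hn⟩
  · rw [hflat]
    exact (flatEquiv he hc).injective
  · intro y hy
    rw [hflat] at hy
    simp only [pderiv_flatCoord he hc] at hy
    exact eq_zero_of_sum_mul_resSeries (r := n) (c := n + 1) (e := 0) (by omega) (RingHom.id _) hy
  · intro α
    simp only [dataA]
    rw [Nat.cast_sub (by have := α.2; omega)]
    push_cast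
    field_simp
    ring
  · simp only [dataA]
    push_cast
    field_simp
    ring
  · intro α; omega
  · omega

end A

end SingularityData

/-! ### The algebra of `D_{m+1}` -/

section

variable {r : ℕ}

/-- For `e = 1` one has `D(x^k) = 2k x^k`, so the parameter `v_1` drops out and `P` is divisible by
`x`. -/
theorem unfPoly_one_eq (hr : 1 ≤ r) :
    unfPoly r 1 = Polynomial.X * (Polynomial.X ^ (r - 1) +
      ∑ k : Fin r, ((X k : MvPolynomial (Fin r) ℂ) * ((2 * (k : ℕ) : ℕ) : MvPolynomial (Fin r) ℂ)) •
        Polynomial.X ^ ((k : ℕ) - 1)) := by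
  rw [unfPoly, mul_add, ← pow_succ', Nat.sub_add_cancel hr, Finset.mul_sum]
  refine congrArg₂ (· + ·) rfl (Finset.sum_congr rfl fun k _ => ?_)
  rw [eulerDeriv_X_pow, smul_smul, mul_smul_comm]
  rcases Nat.eq_zero_or_pos (k : ℕ) with h | h
  · simp [h]
  · rw [← pow_succ', Nat.sub_add_cancel h, Nat.add_sub_cancel]

theorem divX_X_mul {A : Type*} [Semiring A] (f : Polynomial A) :
    Polynomial.divX (Polynomial.X * f) = f := by
  ext i
  rw [Polynomial.coeff_divX, Polynomial.coeff_X_mul]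

theorem divX_unfPoly (hr : 1 ≤ r) :
    Polynomial.divX (unfPoly r 1) = Polynomial.X ^ (r - 1) +
      ∑ k : Fin r, ((X k : MvPolynomial (Fin r) ℂ) * ((2 * (k : ℕ) : ℕ) : MvPolynomial (Fin r) ℂ)) •
        Polynomial.X ^ ((k : ℕ) - 1) := by
  rw [unfPoly_one_eq hr, divX_X_mul]

theorem X_mul_divX_unfPoly (hr : 1 ≤ r) :
    Polynomial.X * Polynomial.divX (unfPoly r 1) = unfPoly r 1 := by
  rw [divX_unfPoly hr, ← unfPoly_one_eq hr]

theorem map_divX {A B : Type*} [Semiring A] [Semiring B] (φ : A →+* B) (f : Polynomial A) :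
    (Polynomial.divX f).map φ = Polynomial.divX (f.map φ) := by
  ext i
  rw [Polynomial.coeff_map, Polynomial.coeff_divX, Polynomial.coeff_divX, Polynomial.coeff_map]

theorem degree_divX_lt_of_lt {A : Type*} [Semiring A] {f : Polynomial A} {k : ℕ}
    (hf : f.degree < (k + 1 : ℕ)) : (Polynomial.divX f).degree < k := by
  rw [Polynomial.degree_lt_iff_coeff_zero] at hf ⊢
  intro i hi
  rw [Polynomial.coeff_divX, hf _ (by omega)]

/-- Write `f = K P + R`. The relations give `P(x) = x y^2 = w y`, and splitting `K = x divX K +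
K(0)` and using `x y = w` again turns `K P` into `w^2 divX K + w K(0) y`. -/
theorem aeval_eq_of_mul_eq {B : Type*} [CommRing B] [Algebra ℂ B] {x y : B} {w : ℂ}
    {P : Polynomial ℂ} (hxy : x * y = w • 1)
    (hyy : y * y = Polynomial.aeval x (Polynomial.divX P))
    (hX : Polynomial.X * Polynomial.divX P = P) (f : Polynomial ℂ) :
    Polynomial.aeval x f = Polynomial.aeval x (f %ₘ P + (w ^ 2) • Polynomial.divX (f /ₘ P)) +
      (w * (f /ₘ P).coeff 0) • y := by
  have hP : Polynomial.aeval x P = w • y := by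
    rw [← hX, map_mul, Polynomial.aeval_X, ← hyy, ← mul_assoc, hxy, smul_mul_assoc, one_mul]
  have hK : Polynomial.aeval x (f /ₘ P) =
      x * Polynomial.aeval x (Polynomial.divX (f /ₘ P)) + (f /ₘ P).coeff 0 • 1 := by
    conv_lhs => rw [← Polynomial.X_mul_divX_add (f /ₘ P)]
    rw [map_add, map_mul, Polynomial.aeval_X, Polynomial.aeval_C, Algebra.algebraMap_eq_smul_one]
  conv_lhs => rw [← Polynomial.modByMonic_add_div f P]
  rw [map_add, map_mul, hP, hK, map_add, map_smul]
  rw [Algebra.smul_def] at hxy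
  simp only [Algebra.smul_def, map_mul, map_pow]
  linear_combination (algebraMap ℂ _ w) * Polynomial.aeval x (Polynomial.divX (f /ₘ P)) * hxy

end

namespace SingularityData

section D

variable {m : ℕ} (v : Fin (m + 1) → ℂ)

/-- The derivative `x^m + 2 ∑ k v_{k+1} x^k` of the unfolding of `D_{m+1}` at `v`. -/
noncomputable def polyD : Polynomial ℂ := (unfPoly m 1).map (eval fun k => v k.castSucc)

theorem polyD_monic : (polyD v).Monic := monic_map_unfPoly (by omega) _

theorem degree_polyD : (polyD v).degree = m := degree_map_unfPoly (by omega) _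

theorem X_mul_divX_polyD (hm : 1 ≤ m) :
    Polynomial.X * Polynomial.divX (polyD v) = polyD v := by
  rw [polyD, ← map_divX]
  conv_rhs => rw [← X_mul_divX_unfPoly hm]
  rw [Polynomial.map_mul, Polynomial.map_X]

theorem divX_polyD (hm : 1 ≤ m) :
    Polynomial.divX (polyD v) = Polynomial.X ^ (m - 1) +
      ∑ k : Fin m, (v k.castSucc * ((2 * (k : ℕ) : ℕ) : ℂ)) • Polynomial.X ^ ((k : ℕ) - 1) := by
  rw [polyD, ← map_divX, divX_unfPoly hm, Polynomial.map_add, Polynomial.map_pow, Polynomial.map_X,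
    Polynomial.map_sum]
  refine congrArg₂ (· + ·) rfl (Finset.sum_congr rfl fun k _ => ?_)
  rw [Polynomial.map_smul, Polynomial.map_pow, Polynomial.map_X, map_mul, eval_X, map_natCast]

theorem cls_dataD_castSucc (k : Fin m) : (dataD m).cls v k.castSucc =
    (Ideal.Quotient.mk ((dataD m).jacobianIdeal v) (X 0)) ^ (k : ℕ) := by
  rw [← map_pow, cls]
  have := k.2
  simp only [dataD, Fin.val_castSucc]
  rw [if_neg (by omega)]

theorem cls_dataD_last : (dataD m).cls v (Fin.last m) =
    Ideal.Quotient.mk ((dataD m).jacobianIdeal v) (X 1) := by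
  rw [cls]
  simp only [dataD, Fin.val_last, if_true]

theorem unfolding_dataD : (dataD m).unfolding v =
    C (1 / 2) * (C (1 / (m : ℂ)) * X 0 ^ m - X 0 * X 1 ^ 2) +
      (∑ k : Fin m, C (v k.castSucc) * X 0 ^ (k : ℕ) + C (v (Fin.last m)) * X 1) := by
  rw [unfolding, Fin.sum_univ_castSucc]
  refine congrArg₂ (· + ·) rfl (congrArg₂ (· + ·) (Finset.sum_congr rfl fun k _ => ?_) ?_)
  · have := k.2
    simp only [dataD, Fin.val_castSucc]
    rw [if_neg (by omega)]
  · simp only [dataD, Fin.val_last, if_true]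

theorem two_mul_pderiv_zero_unfolding_dataD (hm : 1 ≤ m) :
    C 2 * pderiv 0 ((dataD m).unfolding v) =
      Polynomial.aeval (X 0 : PlanePoly) (Polynomial.divX (polyD v)) - X 1 ^ 2 := by
  have hm0 : (m : ℂ) ≠ 0 := by exact_mod_cast (show m ≠ 0 by omega)
  rw [divX_polyD v hm, unfolding_dataD]
  have h10 : pderiv (0 : Fin 2) (X 1 : PlanePoly) = 0 :=
    pderiv_X_of_ne (show (1 : Fin 2) ≠ 0 by decide)
  simp only [map_add, map_sub, map_sum, pderiv_mul, pderiv_C, pderiv_pow, pderiv_X_self, h10,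
    zero_mul, zero_add, mul_zero, add_zero, mul_one, one_mul, map_smul, map_pow,
    Polynomial.aeval_X, smul_eq_C_mul]
  rw [mul_add, Finset.mul_sum]
  have h1 : C 2 * (C (1 / 2) * (C (1 / (m : ℂ)) * ((m : PlanePoly) * X 0 ^ (m - 1)) - X 1 ^ 2)) =
      (X 0 : PlanePoly) ^ (m - 1) - X 1 ^ 2 := by
    rw [← mul_assoc, ← C_mul, show (2 : ℂ) * (1 / 2) = 1 by norm_num, C_1, one_mul, ← mul_assoc,
      ← C_eq_coe_nat, ← C_mul, one_div, inv_mul_cancel₀ hm0, C_1, one_mul]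
  rw [h1]
  have h2 : ∀ k : Fin m, C 2 * (C (v k.castSucc) * (((k : ℕ) : PlanePoly) * X 0 ^ ((k : ℕ) - 1))) =
      C (v k.castSucc * ((2 * (k : ℕ) : ℕ) : ℂ)) * X 0 ^ ((k : ℕ) - 1) := by
    intro k
    rw [← C_eq_coe_nat]
    push_cast
    simp only [C_mul]
    ring
  rw [Finset.sum_congr rfl fun k _ => h2 k]
  ring

theorem pderiv_one_unfolding_dataD :
    pderiv 1 ((dataD m).unfolding v) = C (v (Fin.last m)) - X 0 * X 1 := by
  have h01 : pderiv (1 : Fin 2) (X 0 : PlanePoly) = 0 :=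
    pderiv_X_of_ne (show (0 : Fin 2) ≠ 1 by decide)
  rw [unfolding_dataD]
  simp only [map_add, map_sub, map_sum, pderiv_mul, pderiv_C, pderiv_pow, pderiv_X_self, h01,
    zero_mul, zero_add, mul_zero, add_zero, mul_one, Finset.sum_const_zero, zero_sub]
  have : (C (1 / 2) : PlanePoly) * C 2 = 1 := by
    rw [← C_mul, ← C_1]; norm_num
  rw [show ((2 : ℕ) : PlanePoly) = C 2 by rw [← C_eq_coe_nat]; rfl]
  linear_combination (-(X 0 * X 1 ^ (2 - 1)) : PlanePoly) * this

theorem jacobianIdeal_dataD_eq (hm : 1 ≤ m) : (dataD m).jacobianIdeal v =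
    Ideal.span {Polynomial.aeval (X 0 : PlanePoly) (Polynomial.divX (polyD v)) - X 1 ^ 2,
      C (v (Fin.last m)) - X 0 * X 1} := by
  rw [jacobianIdeal, ← pderiv_one_unfolding_dataD, ← two_mul_pderiv_zero_unfolding_dataD v hm]
  apply le_antisymm
  · rw [Ideal.span_le]
    rintro _ (rfl | rfl)
    · have h1 : C 2 * pderiv 0 ((dataD m).unfolding v) ∈ Ideal.span
          {C 2 * pderiv 0 ((dataD m).unfolding v), pderiv 1 ((dataD m).unfolding v)} :=
        Ideal.subset_span (Set.mem_insert _ _)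
      have := Ideal.mul_mem_left _ (C (2⁻¹ : ℂ)) h1
      rwa [← mul_assoc, ← C_mul, inv_mul_cancel₀ two_ne_zero, C_1, one_mul] at this
    · exact Ideal.subset_span (Set.mem_insert_of_mem _ rfl)
  · rw [Ideal.span_le]
    rintro _ (rfl | rfl)
    · exact Ideal.mul_mem_left _ _ (Ideal.subset_span (Set.mem_insert _ _))
    · exact Ideal.subset_span (Set.mem_insert_of_mem _ rfl)

theorem mk_X_zero_mul_mk_X_one :
    Ideal.Quotient.mk ((dataD m).jacobianIdeal v) (X 0) *
      Ideal.Quotient.mk ((dataD m).jacobianIdeal v) (X 1) =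
      v (Fin.last m) • (1 : (dataD m).LocalAlgebra v) := by
  have h1 : Ideal.Quotient.mk ((dataD m).jacobianIdeal v)
      (pderiv 1 ((dataD m).unfolding v)) = 0 :=
    Ideal.Quotient.eq_zero_iff_mem.2 (Ideal.subset_span (Set.mem_insert_of_mem _ rfl))
  rw [pderiv_one_unfolding_dataD, map_sub, map_mul, sub_eq_zero] at h1
  rw [← h1, C_eq_smul_one]
  rfl

theorem mk_X_one_mul_mk_X_one (hm : 1 ≤ m) :
    Ideal.Quotient.mk ((dataD m).jacobianIdeal v) (X 1) *
      Ideal.Quotient.mk ((dataD m).jacobianIdeal v) (X 1) =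
      Polynomial.aeval (Ideal.Quotient.mk ((dataD m).jacobianIdeal v) (X 0))
        (Polynomial.divX (polyD v)) := by
  have h1 : Ideal.Quotient.mk ((dataD m).jacobianIdeal v)
      (C 2 * pderiv 0 ((dataD m).unfolding v)) = 0 :=
    Ideal.Quotient.eq_zero_iff_mem.2 (Ideal.mul_mem_left _ _
      (Ideal.subset_span (Set.mem_insert _ _)))
  rw [two_mul_pderiv_zero_unfolding_dataD v hm, map_sub, sub_eq_zero, map_pow, sq] at h1
  rw [← h1]
  exact (Polynomial.aeval_algHom_apply (Ideal.Quotient.mkₐ ℂ ((dataD m).jacobianIdeal v)) _ _).symm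

theorem aeval_dataD (hm : 1 ≤ m) (f : Polynomial ℂ) :
    Polynomial.aeval (Ideal.Quotient.mk ((dataD m).jacobianIdeal v) (X 0)) f =
      Polynomial.aeval (Ideal.Quotient.mk ((dataD m).jacobianIdeal v) (X 0))
        (f %ₘ polyD v + (v (Fin.last m) ^ 2) • Polynomial.divX (f /ₘ polyD v)) +
      (v (Fin.last m) * (f /ₘ polyD v).coeff 0) • (dataD m).cls v (Fin.last m) := by
  rw [cls_dataD_last]
  exact aeval_eq_of_mul_eq (mk_X_zero_mul_mk_X_one v) (mk_X_one_mul_mk_X_one v hm)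
    (X_mul_divX_polyD v hm) f

theorem aeval_dataD_eq_sum {f : Polynomial ℂ} (hf : f.degree < m) :
    Polynomial.aeval (Ideal.Quotient.mk ((dataD m).jacobianIdeal v) (X 0)) f =
      ∑ s : Fin m, f.coeff s • (dataD m).cls v s.castSucc := by
  rw [aeval_eq_sum_fin _ hf]
  simp only [cls_dataD_castSucc]

/-- The coordinates of the class of `f(x)`. -/
noncomputable def coordD (f : Polynomial ℂ) : Fin (m + 1) → ℂ :=
  Fin.snoc (α := fun _ => ℂ) (fun s : Fin m => (f %ₘ polyD v +
    (v (Fin.last m) ^ 2) • Polynomial.divX (f /ₘ polyD v)).coeff s)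
    (v (Fin.last m) * (f /ₘ polyD v).coeff 0)

theorem aeval_dataD_eq_sum_coordD (hm : 1 ≤ m) {f : Polynomial ℂ} (hf : f.degree < (2 * m : ℕ)) :
    Polynomial.aeval (Ideal.Quotient.mk ((dataD m).jacobianIdeal v) (X 0)) f =
      ∑ s, coordD v f s • (dataD m).cls v s := by
  have hn : (polyD v).natDegree = m := Polynomial.natDegree_eq_of_degree_eq_some (degree_polyD v)
  have hdeg : (f %ₘ polyD v +
      (v (Fin.last m) ^ 2) • Polynomial.divX (f /ₘ polyD v)).degree < m := by
    refine (Polynomial.degree_add_le _ _).trans_lt (max_lt ?_ ?_)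
    · rw [← degree_polyD v]
      exact Polynomial.degree_modByMonic_lt _ (polyD_monic v)
    · refine (Polynomial.degree_smul_le _ _).trans_lt (degree_divX_lt_of_lt ?_)
      refine (degree_divByMonic_lt_of_lt (k := m) (polyD_monic v) ?_).trans
        (by exact_mod_cast Nat.lt_succ_self m)
      rwa [hn, ← two_mul]
  rw [aeval_dataD v hm, aeval_dataD_eq_sum v hdeg, Fin.sum_univ_castSucc]
  simp only [coordD, Fin.snoc_castSucc, Fin.snoc_last]

theorem span_cls_dataD (hm : 1 ≤ m) :
    Submodule.span ℂ (Set.range ((dataD m).cls v)) = ⊤ := by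
  have haev : ∀ f : Polynomial ℂ, f.degree < (2 * m : ℕ) →
      Polynomial.aeval (Ideal.Quotient.mk ((dataD m).jacobianIdeal v) (X 0)) f ∈
        Submodule.span ℂ (Set.range ((dataD m).cls v)) := by
    intro f hf
    rw [aeval_dataD_eq_sum_coordD v hm hf]
    exact Submodule.sum_mem _ fun s _ =>
      Submodule.smul_mem _ _ (Submodule.subset_span (Set.mem_range_self s))
  have hpow : ∀ k ≤ m, (Ideal.Quotient.mk ((dataD m).jacobianIdeal v) (X 0)) ^ k ∈
      Submodule.span ℂ (Set.range ((dataD m).cls v)) := by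
    intro k hk
    have := haev (Polynomial.X ^ k) (by
      rw [Polynomial.degree_X_pow]; exact_mod_cast (show k < 2 * m by omega))
    rwa [map_pow, Polynomial.aeval_X] at this
  have h1 : (1 : (dataD m).LocalAlgebra v) ∈ Submodule.span ℂ (Set.range ((dataD m).cls v)) := by
    simpa using hpow 0 (Nat.zero_le m)
  refine span_cls_eq_top h1 fun i k => ?_
  fin_cases i
  · change Ideal.Quotient.mk ((dataD m).jacobianIdeal v) (X 0) * _ ∈ _
    refine Fin.lastCases ?_ (fun k => ?_) k
    · rw [cls_dataD_last, mk_X_zero_mul_mk_X_one]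
      exact Submodule.smul_mem _ _ h1
    · rw [cls_dataD_castSucc, ← pow_succ']
      exact hpow _ k.2
  · change Ideal.Quotient.mk ((dataD m).jacobianIdeal v) (X 1) * _ ∈ _
    refine Fin.lastCases ?_ (fun k => ?_) k
    · rw [cls_dataD_last, mk_X_one_mul_mk_X_one v hm]
      refine haev _ (lt_of_lt_of_le (degree_divX_lt_of_lt (k := m) ?_)
        (by exact_mod_cast (show m ≤ 2 * m by omega)))
      rw [degree_polyD]
      exact_mod_cast Nat.lt_succ_self m
    · rw [cls_dataD_castSucc]
      rcases Nat.eq_zero_or_pos (k : ℕ) with h | h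
      · rw [h, pow_zero, mul_one, ← cls_dataD_last]
        exact Submodule.subset_span (Set.mem_range_self _)
      · rw [← Nat.sub_add_cancel h, pow_succ', ← mul_assoc, mul_comm (Ideal.Quotient.mk _ (X 1)),
          mk_X_zero_mul_mk_X_one, smul_mul_assoc, one_mul]
        exact Submodule.smul_mem _ _ (hpow _ (by have := k.2; omega))

theorem eq_zero_of_sum_smul_X_pow_eq_zero {m : ℕ} {g : Fin m → ℂ}
    (h : ∑ k : Fin m, Polynomial.C (g k) * Polynomial.X ^ (k : ℕ) = 0) (k : Fin m) : g k = 0 := by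
  have h5 := congrArg (fun p => Polynomial.coeff p (k : ℕ)) h
  simp only [Polynomial.finsetSum_coeff, Polynomial.coeff_C_mul, Polynomial.coeff_X_pow,
    Polynomial.coeff_zero] at h5
  rw [Finset.sum_eq_single k] at h5
  · simpa using h5
  · intro b _ hb
    rw [if_neg fun h => hb (Fin.ext h.symm), mul_zero]
  · simp

/-- For `w ≠ 0` the relation `w y = P(x)` eliminates `y`, and the algebra maps to `ℂ[x]/(x P -
w^2)`, whose modulus has degree `m + 1`. -/
theorem eq_zero_of_mem_jacobianIdeal_dataD_of_ne (hm : 1 ≤ m) (hw : v (Fin.last m) ≠ 0)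
    {g : Fin m → ℂ} {b : ℂ}
    (h : ∑ k : Fin m, C (g k) * X 0 ^ (k : ℕ) + C b * X 1 ∈ (dataD m).jacobianIdeal v) :
    (∀ k, g k = 0) ∧ b = 0 := by
  set w := v (Fin.last m) with hwdef
  let φ : PlanePoly →ₐ[ℂ] Polynomial ℂ :=
    aeval ![Polynomial.X, Polynomial.C w⁻¹ * polyD v]
  have hφ0 : φ (X 0) = Polynomial.X := by simp [φ]
  have hφ1 : φ (X 1) = Polynomial.C w⁻¹ * polyD v := by simp [φ]
  have hww : Polynomial.C w⁻¹ * Polynomial.C w = 1 := by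
    rw [← Polynomial.C_mul, inv_mul_cancel₀ hw, Polynomial.C_1]
  set Q := Polynomial.X * polyD v - Polynomial.C (w ^ 2) with hQ
  have hI : (dataD m).jacobianIdeal v ≤ (Ideal.span {Q}).comap φ.toRingHom := by
    rw [jacobianIdeal_dataD_eq v hm, Ideal.span_le]
    rintro _ (rfl | rfl)
    · change φ _ ∈ Ideal.span {Q}
      rw [map_sub, ← Polynomial.aeval_algHom_apply, map_pow, hφ0, hφ1,
        Polynomial.aeval_X_left_apply, Ideal.mem_span_singleton]
      refine ⟨-(Polynomial.C w⁻¹ ^ 2 * Polynomial.divX (polyD v)), ?_⟩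
      have hX := X_mul_divX_polyD v hm
      rw [hQ, Polynomial.C_pow]
      linear_combination (-Polynomial.divX (polyD v) * (1 + Polynomial.C w⁻¹ * Polynomial.C w)) *
        hww + Polynomial.C w⁻¹ ^ 2 * polyD v * hX
    · change φ _ ∈ Ideal.span {Q}
      rw [map_sub, map_mul, algHom_C, hφ0, hφ1, Ideal.mem_span_singleton,
        Polynomial.algebraMap_eq, ← hwdef]
      refine ⟨-Polynomial.C w⁻¹, ?_⟩
      rw [hQ, Polynomial.C_pow]
      linear_combination (-Polynomial.C w) * hww
  have h2 : φ _ ∈ Ideal.span {Q} := hI h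
  rw [Ideal.mem_span_singleton] at h2
  have h3 : φ (∑ k : Fin m, C (g k) * X 0 ^ (k : ℕ) + C b * X 1) =
      ∑ k : Fin m, Polynomial.C (g k) * Polynomial.X ^ (k : ℕ) +
        Polynomial.C (b * w⁻¹) * polyD v := by
    simp only [map_sum, map_add, map_mul, map_pow, hφ0, hφ1, algHom_C, Polynomial.algebraMap_eq]
    ring
  rw [h3] at h2
  have hPm : (polyD v).degree < ((m + 1 : ℕ) : WithBot ℕ) := by
    rw [degree_polyD]; exact_mod_cast Nat.lt_succ_self m
  have hQd : Q.degree = ((m + 1 : ℕ) : WithBot ℕ) := by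
    have hXP : (Polynomial.X * polyD v).degree = ((m + 1 : ℕ) : WithBot ℕ) := by
      rw [Polynomial.degree_mul, Polynomial.degree_X, degree_polyD, add_comm]; rfl
    rw [hQ, Polynomial.degree_sub_eq_left_of_degree_lt, hXP]
    rw [hXP]
    exact Polynomial.degree_C_le.trans_lt (by exact_mod_cast Nat.succ_pos m)
  have h4 := Polynomial.eq_zero_of_dvd_of_degree_lt h2 (by
    rw [hQd]
    refine (Polynomial.degree_add_le _ _).trans_lt (max_lt ?_ ?_)
    · exact (Polynomial.degree_sum_fin_lt g).trans (by exact_mod_cast Nat.lt_succ_self m)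
    · rw [← Polynomial.smul_eq_C_mul]
      exact (Polynomial.degree_smul_le _ _).trans_lt hPm)
  have hb : b * w⁻¹ = 0 := by
    have h5 := congrArg (fun p => Polynomial.coeff p m) h4
    have hn : (polyD v).coeff m = 1 := by
      have := (polyD_monic v).coeff_natDegree
      rwa [Polynomial.natDegree_eq_of_degree_eq_some (degree_polyD v)] at this
    simp only [Polynomial.coeff_add, Polynomial.coeff_C_mul, hn, Polynomial.coeff_zero] at h5
    rw [Polynomial.coeff_eq_zero_of_degree_lt (Polynomial.degree_sum_fin_lt g)] at h5
    simpa using h5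
  rw [hb, Polynomial.C_0, zero_mul, add_zero] at h4
  exact ⟨eq_zero_of_sum_smul_X_pow_eq_zero h4,
    (mul_eq_zero.1 hb).resolve_right (inv_ne_zero hw)⟩

/-- For `w = 0` the relation `x y = 0` suggests restricting to the two axes. On `x = 0` a degree
count gives `b = 0` and `A = 0`; hence `A` vanishes at the origin, and on `y = 0` it supplies the
factor `x` that completes `P / x` to `P`. -/
theorem eq_zero_of_mem_jacobianIdeal_dataD_of_eq (hm : 1 ≤ m) (hw : v (Fin.last m) = 0)
    {g : Fin m → ℂ} {b : ℂ}
    (h : ∑ k : Fin m, C (g k) * X 0 ^ (k : ℕ) + C b * X 1 ∈ (dataD m).jacobianIdeal v) :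
    (∀ k, g k = 0) ∧ b = 0 := by
  rw [jacobianIdeal_dataD_eq v hm, hw, Ideal.mem_span_pair] at h
  obtain ⟨A, B, hAB⟩ := h
  let φ : PlanePoly →ₐ[ℂ] Polynomial ℂ := aeval ![Polynomial.X, 0]
  have hφ0 : φ (X 0) = Polynomial.X := by simp [φ]
  have hφ1 : φ (X 1) = 0 := by simp [φ]
  let ψ : PlanePoly →ₐ[ℂ] Polynomial ℂ := aeval ![0, Polynomial.X]
  have hψ0 : ψ (X 0) = 0 := by simp [ψ]
  have hψ1 : ψ (X 1) = Polynomial.X := by simp [ψ]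
  have hcomp : (φ A).coeff 0 = (ψ A).coeff 0 := by
    have : (Polynomial.aeval (0 : ℂ)).comp φ = (Polynomial.aeval (0 : ℂ)).comp ψ := by
      apply MvPolynomial.algHom_ext
      intro i
      fin_cases i <;> simp [φ, ψ]
    have h1 := congrArg (fun F : PlanePoly →ₐ[ℂ] ℂ => F A) this
    simpa [Polynomial.coeff_zero_eq_aeval_zero] using h1
  have e1 := congrArg ψ hAB
  simp only [map_add, map_mul, map_sub, map_pow, map_sum, hψ0, hψ1, algHom_C,
    ← Polynomial.aeval_algHom_apply, zero_mul, map_zero, sub_zero, mul_zero, add_zero,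
    Polynomial.algebraMap_eq] at e1
  have hsum : ∑ k : Fin m, Polynomial.C (g k) * (0 : Polynomial ℂ) ^ (k : ℕ) =
      Polynomial.C (g ⟨0, hm⟩) := by
    rw [Finset.sum_eq_single ⟨0, hm⟩]
    · simp
    · intro k _ hk
      rw [zero_pow fun h => hk (Fin.ext h), mul_zero]
    · simp
  have hp0 : Polynomial.aeval (0 : Polynomial ℂ) (Polynomial.divX (polyD v)) =
      Polynomial.C ((Polynomial.divX (polyD v)).coeff 0) := by
    rw [Polynomial.coeff_zero_eq_aeval_zero, ← Polynomial.algebraMap_eq,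
      ← Polynomial.aeval_algebraMap_apply, map_zero]
  rw [hsum, hp0] at e1
  set q0 := (Polynomial.divX (polyD v)).coeff 0
  have hmon : (Polynomial.X ^ 2 - Polynomial.C q0).Monic := Polynomial.monic_X_pow_sub_C _ (by omega)
  have hz : Polynomial.C (g ⟨0, hm⟩) + Polynomial.C b * Polynomial.X = 0 := by
    refine Polynomial.eq_zero_of_dvd_of_degree_lt
      (p := Polynomial.X ^ 2 - Polynomial.C q0) ⟨-ψ A, ?_⟩ ?_
    · rw [← e1]; ring
    · rw [Polynomial.degree_X_pow_sub_C (by omega)]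
      refine (Polynomial.degree_add_le _ _).trans_lt (max_lt ?_ ?_)
      · exact Polynomial.degree_C_le.trans_lt (by norm_num)
      · exact (Polynomial.degree_C_mul_X_le _).trans_lt (by norm_num)
  have hb : b = 0 := by
    have := congrArg (fun p => Polynomial.coeff p 1) hz
    simpa using this
  have hA : ψ A = 0 := by
    rw [hz] at e1
    rcases mul_eq_zero.1 e1 with h1 | h1
    · exact h1
    · exfalso
      apply hmon.ne_zero
      rw [← neg_sub, h1, neg_zero]
  rw [hA, Polynomial.coeff_zero] at hcomp
  refine ⟨?_, hb⟩
  have e2 := congrArg φ hAB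
  simp only [map_add, map_mul, map_sub, map_pow, map_sum, hφ0, hφ1, algHom_C,
    ← Polynomial.aeval_algHom_apply, map_zero, sub_zero, mul_zero, add_zero, Polynomial.algebraMap_eq,
    Polynomial.aeval_X_left_apply, ne_eq, OfNat.ofNat_ne_zero, not_false_eq_true, zero_pow] at e2
  have h6 : φ A = Polynomial.X * Polynomial.divX (φ A) := by
    conv_lhs => rw [← Polynomial.X_mul_divX_add (φ A)]
    rw [hcomp, Polynomial.C_0, add_zero]
  refine eq_zero_of_sum_smul_X_pow_eq_zero (Polynomial.eq_zero_of_dvd_of_degree_lt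
    (p := polyD v) ⟨Polynomial.divX (φ A), ?_⟩ ?_)
  · rw [← e2]
    conv_lhs => rw [h6]
    conv_rhs => rw [← X_mul_divX_polyD v hm]
    ring
  · rw [degree_polyD]
    exact Polynomial.degree_sum_fin_lt g

theorem linearIndependent_cls_dataD (hm : 1 ≤ m) : LinearIndependent ℂ ((dataD m).cls v) := by
  rw [Fintype.linearIndependent_iff]
  intro g hg
  have h1 : ∑ k : Fin m, C (g k.castSucc) * (X 0 : PlanePoly) ^ (k : ℕ) + C (g (Fin.last m)) * X 1 ∈
      (dataD m).jacobianIdeal v := by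
    rw [← Ideal.Quotient.eq_zero_iff_mem, ← hg, Fin.sum_univ_castSucc, map_add, map_sum,
      cls_dataD_last]
    refine congrArg₂ (· + ·) (Finset.sum_congr rfl fun k _ => ?_) ?_
    · rw [cls_dataD_castSucc, ← map_pow, ← smul_eq_C_mul]
      rfl
    · rw [← smul_eq_C_mul]
      rfl
  have h2 : (∀ k : Fin m, g k.castSucc = 0) ∧ g (Fin.last m) = 0 := by
    by_cases hw : v (Fin.last m) = 0
    · exact eq_zero_of_mem_jacobianIdeal_dataD_of_eq v hm hw h1
    · exact eq_zero_of_mem_jacobianIdeal_dataD_of_ne v hm hw h1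
  exact fun k => Fin.lastCases h2.2 h2.1 k

theorem structureConst_comm {n : ℕ} (S : SingularityData n) (v : Fin n → ℂ) (a b s : Fin n) :
    S.structureConst v a b s = S.structureConst v b a s := by
  simp only [structureConst, mul_comm]

theorem structureConst_dataD_xx (hm : 1 ≤ m) (a b : Fin m) (s : Fin (m + 1)) :
    (dataD m).structureConst v a.castSucc b.castSucc s =
      coordD v (Polynomial.X ^ ((a : ℕ) + b)) s := by
  refine structureConst_eq (linearIndependent_cls_dataD v hm) (span_cls_dataD v hm) ?_ s
  rw [← aeval_dataD_eq_sum_coordD v hm, cls_dataD_castSucc, cls_dataD_castSucc, ← pow_add, map_pow,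
    Polynomial.aeval_X]
  rw [Polynomial.degree_X_pow]
  exact_mod_cast (show (a : ℕ) + b < 2 * m by omega)

theorem structureConst_dataD_xy (hm : 1 ≤ m) (a : Fin m) (s : Fin (m + 1)) :
    (dataD m).structureConst v a.castSucc (Fin.last m) s =
      Fin.snoc (α := fun _ => ℂ) (fun s : Fin m => if (s : ℕ) + 1 = a then v (Fin.last m) else 0)
        (if (a : ℕ) = 0 then 1 else 0) s := by
  refine structureConst_eq (linearIndependent_cls_dataD v hm) (span_cls_dataD v hm) ?_ s
  rw [Fin.sum_univ_castSucc]
  simp only [Fin.snoc_castSucc, Fin.snoc_last]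
  rcases Nat.eq_zero_or_pos (a : ℕ) with h | h
  · rw [Finset.sum_eq_zero, zero_add, if_pos h, one_smul, cls_dataD_castSucc, h, pow_zero, one_mul]
    intro k _
    rw [if_neg (by omega), zero_smul]
  · have ha := a.2
    rw [if_neg (by omega), zero_smul, add_zero, Finset.sum_eq_single ⟨(a : ℕ) - 1, by omega⟩]
    · rw [if_pos (Nat.sub_add_cancel h), cls_dataD_castSucc, cls_dataD_castSucc, cls_dataD_last]
      conv_lhs => rw [← Nat.sub_add_cancel h, pow_succ, mul_assoc, mk_X_zero_mul_mk_X_one,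
        mul_smul_comm, mul_one]
    · intro k _ hk
      rw [if_neg, zero_smul]
      intro h'
      exact hk (Fin.ext (by simp only; omega))
    · simp

theorem structureConst_dataD_yy (hm : 1 ≤ m) (s : Fin (m + 1)) :
    (dataD m).structureConst v (Fin.last m) (Fin.last m) s =
      Fin.snoc (α := fun _ => ℂ) (fun s : Fin m => (Polynomial.divX (polyD v)).coeff s) 0 s := by
  refine structureConst_eq (linearIndependent_cls_dataD v hm) (span_cls_dataD v hm) ?_ s
  rw [Fin.sum_univ_castSucc]
  simp only [Fin.snoc_castSucc, Fin.snoc_last, zero_smul, add_zero]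
  rw [cls_dataD_last, mk_X_one_mul_mk_X_one v hm, aeval_dataD_eq_sum]
  refine degree_divX_lt_of_lt ?_
  rw [degree_polyD]
  exact_mod_cast Nat.lt_succ_self m

end D

end SingularityData

/-! ### The parameter `v_1` as a function of the flat coordinates -/

section

variable {m : ℕ}

theorem coeff_eulerAdj_one {A : Type*} [CommRing A] (f : Polynomial A) (i : ℕ) :
    (eulerAdj 1 f).coeff i = (2 * i + 1) * f.coeff i := by
  rw [eulerAdj_apply, Polynomial.coeff_add, coeff_eulerDeriv_one, Polynomial.coeff_smul]
  push_cast
  rw [one_smul]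
  ring

theorem divX_eulerAdj_one {A : Type*} [CommRing A] (f : Polynomial A) :
    Polynomial.divX (eulerAdj 1 f) =
      (2 : A) • Polynomial.divX f + eulerAdj 1 (Polynomial.divX f) := by
  ext i
  rw [Polynomial.coeff_add, Polynomial.coeff_smul, coeff_eulerAdj_one, Polynomial.coeff_divX,
    Polynomial.coeff_divX, coeff_eulerAdj_one, smul_eq_mul]
  push_cast
  ring

/-- The derivative `∂v_1/∂t_γ`, as a function of the unfolding parameters. -/
noncomputable def gradV (m : ℕ) (γ : Fin m) : MvPolynomial (Fin m) ℂ :=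
  resFun m m 1 ((m - 1 - γ : ℕ) : ℤ) (Polynomial.divX (unfPoly m 1))

theorem degree_divX_unfPoly_lt (m : ℕ) : (Polynomial.divX (unfPoly m 1)).degree < m := by
  refine degree_divX_lt_of_lt ?_
  rw [Polynomial.degree_eq_natDegree (monic_unfPoly m le_rfl).ne_zero, natDegree_unfPoly m le_rfl]
  exact_mod_cast Nat.lt_succ_self m

/-- Integration by parts at `j = -1`, where `1 + 2j = -1`; the resulting combination of residues is
that of `P / x`. The closed form makes `gradV` easy to differentiate. -/
theorem gradV_eq (hm : 1 ≤ m) (γ : Fin m) :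
    gradV m γ = C (-(1 + ((1 + 1 : ℕ) : ℂ) * (dualIndex 1 γ : ℂ))⁻¹) *
      resSeries m m (1 + 1) (dualIndex 1 γ) (-1) := by
  have hq := one_add_mul_ne_zero (e := 1) le_rfl (g := dualIndex 1 γ) (Or.inr rfl)
  have hi : dualIndex 1 γ + m = ((m - 1 - γ : ℕ) : ℤ) := by
    have := γ.2; simp only [dualIndex]; omega
  have h := resSeries_by_parts (r := m) (c := m) (ε := 1 + 1) le_rfl (dualIndex 1 γ) (-1)
  have h1 : gradV m γ = resSeries m m (1 + 1) (dualIndex 1 γ + m) (-1 + m) +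
        ∑ a : Fin m, C (((1 + 1 : ℕ) : ℂ) * ((a : ℕ) : ℂ)) * X a *
          resSeries m m (1 + 1) (dualIndex 1 γ + m) (-1 + (a : ℕ)) := by
    rw [gradV, divX_unfPoly hm, map_add, resFun_X_pow, map_sum, hi]
    refine congrArg₂ (· + ·) (by congr 1; omega) (Finset.sum_congr rfl fun a _ => ?_)
    rw [map_smul, resFun_X_pow, smul_eq_mul, ← C_eq_coe_nat]
    rcases Nat.eq_zero_or_pos (a : ℕ) with h0 | h0
    · simp [h0]
    · rw [show (((a : ℕ) - 1 : ℕ) : ℤ) = -1 + (a : ℕ) by omega]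
      push_cast
      ring
  rw [← h1] at h
  have h2 : C ((1 + ((1 + 1 : ℕ) : ℂ) * (dualIndex 1 γ : ℂ))⁻¹) *
      C (1 + ((1 + 1 : ℕ) : ℂ) * (dualIndex 1 γ : ℂ)) = (1 : MvPolynomial (Fin m) ℂ) := by
    rw [← C_mul, inv_mul_cancel₀ hq, C_1]
  have h3 : (C (1 + ((1 + 1 : ℕ) : ℂ) * ((-1 : ℤ) : ℂ)) : MvPolynomial (Fin m) ℂ) = -1 := by
    rw [← C_1, ← C_neg]
    congr 1
    norm_num
  rw [h3] at h
  rw [C_neg]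
  linear_combination -gradV m γ * h2 -
    C ((1 + ((1 + 1 : ℕ) : ℂ) * (dualIndex 1 γ : ℂ))⁻¹) * h

theorem pderiv_gradV (hm : 1 ≤ m) (a γ : Fin m) :
    pderiv a (gradV m γ) = resSeries m m (1 + 1) ((m - 1 - γ : ℕ) : ℤ) ((a : ℕ) - 1) := by
  have hq := one_add_mul_ne_zero (e := 1) le_rfl (g := dualIndex 1 γ) (Or.inr rfl)
  have hi : dualIndex 1 γ + m = ((m - 1 - γ : ℕ) : ℤ) := by
    have := γ.2; simp only [dualIndex]; omega
  rw [gradV_eq hm, pderiv_C_mul, pderiv_resSeries le_rfl, ← mul_assoc, ← C_mul, neg_mul_neg,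
    inv_mul_cancel₀ hq, C_1, one_mul, hi]
  congr 1

/-- The left side pairs `P / x` with `x^a`. For `a > 0` the product is a multiple of `P`; for `a =
0` its top coefficient is `1`. This identifies `gradV` with the gradient of `v_1`. -/
theorem sum_gradV_mul_resSeries (hm : 1 ≤ m) (a : Fin m) :
    ∑ γ : Fin m, gradV m γ * resSeries m m (1 + 1) (γ : ℕ) (a : ℕ) =
      if (a : ℕ) = 0 then 1 else 0 := by
  have hP := monic_unfPoly m (e := 1) le_rfl
  have hn := natDegree_unfPoly m (e := 1) le_rfl
  simp only [gradV]
  rw [sum_resFun_mul_resSeries le_rfl rfl hm a (degree_divX_unfPoly_lt m)]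
  split_ifs with h
  · rw [h, pow_zero, mul_one, topCoeff_of_degree_lt hP (by rw [hn]; exact degree_divX_unfPoly_lt m),
      Polynomial.coeff_divX, hn, Nat.sub_add_cancel hm]
    rw [Polynomial.Monic, Polynomial.leadingCoeff, hn] at hP
    exact hP
  · rw [← Nat.sub_add_cancel (Nat.one_le_iff_ne_zero.2 h), pow_succ', ← mul_assoc,
      mul_comm _ Polynomial.X, X_mul_divX_unfPoly hm, mul_comm, topCoeff_mul_self hP]

theorem resFun_eulerAdj_one (g : ℤ) (f : Polynomial (MvPolynomial (Fin m) ℂ)) :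
    resFun m m 1 g (eulerAdj 1 f) =
      C (1 + ((1 + 1 : ℕ) : ℂ) * (g : ℂ)) * resFun m m 1 (g + m) (f * unfPoly m 1) :=
  resFun_eulerAdj le_rfl rfl g f

/-- The term `s = 0` on the right does no harm: its residue has index `-1 < g`. -/
theorem resFun_divX_eq_sum (g : ℕ) {f : Polynomial (MvPolynomial (Fin m) ℂ)} (hf : f.degree < m) :
    resFun m m 1 g (Polynomial.divX f) =
      ∑ s : Fin m, f.coeff s * resSeries m m (1 + 1) g ((s : ℕ) - 1) := by
  have hd : (Polynomial.divX f).degree < m :=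
    degree_divX_lt_of_lt (hf.trans (by exact_mod_cast Nat.lt_succ_self m))
  rw [resFun_eq_sum _ hd]
  have h0 : f.coeff m = 0 := Polynomial.coeff_eq_zero_of_degree_lt hf
  simp only [Polynomial.coeff_divX]
  rw [Fin.sum_univ_eq_sum_range (fun s => f.coeff (s + 1) * resSeries m m (1 + 1) g (s : ℕ)),
    Fin.sum_univ_eq_sum_range (fun s => f.coeff s * resSeries m m (1 + 1) g ((s : ℕ) - 1 : ℤ))]
  have h1 := Finset.sum_range_succ' (fun s => f.coeff s * resSeries m m (1 + 1) g ((s : ℕ) - 1 : ℤ)) m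
  rw [Finset.sum_range_succ, h0, zero_mul, add_zero, resSeries_of_lt (j := ((0 : ℕ) : ℤ) - 1) (by omega),
    mul_zero, add_zero] at h1
  rw [h1]
  refine Finset.sum_congr rfl fun s _ => ?_
  congr 2
  push_cast
  ring

/-- Modulo terms of degree below `m`, which have no residue at level `g + m`, `divX` of `x^(a+b)` is
`divX K * P`. Integration by parts gives `eulerAdj (divX K)`, and its failure to commute with `divX`
leaves `2 divX K`. -/
theorem hessian_gradV (hm : 1 ≤ m) (a b γ : Fin m) :
    pderiv a (pderiv b (gradV m γ)) - ∑ s, christoffel m 1 a b s * pderiv s (gradV m γ) =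
      2 * resFun m m 1 ((m - 1 - γ : ℕ) : ℤ)
        (Polynomial.divX (Polynomial.X ^ ((a : ℕ) + b) /ₘ unfPoly m 1)) := by
  have hP := monic_unfPoly m (e := 1) le_rfl
  set P := unfPoly m 1 with hPdef
  set K := Polynomial.X ^ ((a : ℕ) + b) /ₘ P with hK
  set g : ℕ := m - 1 - γ with hg
  have h1 : ∑ s, christoffel m 1 a b s * pderiv s (gradV m γ) =
      -resFun m m 1 g (Polynomial.divX (eulerAdj 1 K)) := by
    rw [resFun_divX_eq_sum _ (degree_eulerAdj_lt_natDegree le_rfl a b)]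
    simp only [christoffel, pderiv_gradV hm, neg_mul, Finset.sum_neg_distrib]
    rfl
  have h2 : pderiv a (pderiv b (gradV m γ)) =
      C (-(1 + ((1 + 1 : ℕ) : ℂ) * ((g : ℤ) : ℂ))) *
        resFun m m 1 (g + m) (Polynomial.divX (Polynomial.X ^ ((a : ℕ) + b))) := by
    rw [pderiv_gradV hm, pderiv_resSeries le_rfl, Polynomial.divX_X_pow]
    congr 1
    split_ifs with h0
    · rw [map_zero, resSeries_of_lt (by omega)]
    · rw [resFun_X_pow]
      congr 1
      omega
  have h3 : Polynomial.divX (Polynomial.X ^ ((a : ℕ) + b)) =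
      Polynomial.divX K * P + (Polynomial.C (K.coeff 0) * Polynomial.divX P +
        Polynomial.divX (Polynomial.X ^ ((a : ℕ) + b) %ₘ P)) := by
    conv_lhs => rw [← Polynomial.modByMonic_add_div (Polynomial.X ^ ((a : ℕ) + b)) P, ← hK,
      Polynomial.divX_add]
    have h4 : P * K = Polynomial.X * (Polynomial.divX K * P +
        Polynomial.C (K.coeff 0) * Polynomial.divX P) := by
      have e1 := Polynomial.X_mul_divX_add K
      have e2 := X_mul_divX_unfPoly hm
      rw [← hPdef] at e2
      linear_combination (-P) * e1 - Polynomial.C (K.coeff 0) * e2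
    rw [h4, divX_X_mul]
    ring
  have h5 : resFun m m 1 (g + m) (Polynomial.divX (Polynomial.X ^ ((a : ℕ) + b))) =
      resFun m m 1 (g + m) (Polynomial.divX K * P) := by
    rw [h3, map_add, ← Nat.cast_add, resFun_eq_zero (k := m) (g := g + m) (by omega)
      (f := Polynomial.C (K.coeff 0) * _ + _), add_zero]
    refine (Polynomial.degree_add_le _ _).trans_lt (max_lt ?_ ?_)
    · rw [← Polynomial.smul_eq_C_mul]
      exact (Polynomial.degree_smul_le _ _).trans_lt (degree_divX_unfPoly_lt m)
    · exact degree_divX_lt_of_lt ((degree_modByMonic_unfPoly_lt le_rfl _).trans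
        (by exact_mod_cast Nat.lt_succ_self m))
  have h6 := resFun_eulerAdj_one (m := m) g (Polynomial.divX K)
  rw [h1, h2, h5, divX_eulerAdj_one, map_add, map_smul, smul_eq_mul, h6, C_neg]
  ring

/-- The unfolding parameter `v_1` as a function of the flat coordinates. -/
noncomputable def flatV (hm : 1 ≤ m) : MvPolynomial (Fin m) ℂ :=
  (flatEquiv (r := m) (c := m) (e := 1) le_rfl rfl).symm (X ⟨0, hm⟩)

theorem aeval_flatV (hm : 1 ≤ m) : aeval (flatCoord m m 1) (flatV hm) = X ⟨0, hm⟩ :=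
  (flatEquiv (r := m) (c := m) (e := 1) le_rfl rfl).apply_symm_apply _

theorem pderiv_X_zero (hm : 1 ≤ m) (a : Fin m) :
    pderiv a (X ⟨0, hm⟩ : MvPolynomial (Fin m) ℂ) = if (a : ℕ) = 0 then 1 else 0 := by
  split_ifs with h
  · obtain rfl : a = ⟨0, hm⟩ := Fin.ext h
    rw [pderiv_X_self]
  · exact pderiv_X_of_ne fun h' => h (by rw [← h'])

theorem aeval_pderiv_flatV (hm : 1 ≤ m) (γ : Fin m) :
    aeval (flatCoord m m 1) (pderiv γ (flatV hm)) = gradV m γ :=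
  eq_aeval_pderiv le_rfl rfl (fun a => by
    rw [aeval_flatV, pderiv_X_zero, ← sum_gradV_mul_resSeries hm]) γ

theorem euler_flatV (hm : 1 ≤ m) :
    ∑ γ : Fin m, C (flatWeight m γ) * X γ * pderiv γ (flatV hm) = flatV hm := by
  have hm0 : (m : ℂ) ≠ 0 := by exact_mod_cast (show m ≠ 0 by omega)
  apply (flatEquiv (r := m) (c := m) (e := 1) le_rfl rfl).injective
  rw [flatEquiv_apply, flatEquiv_apply, map_sum, aeval_flatV]
  simp only [map_mul, aeval_pderiv_flatV hm, aeval_X, algHom_C, algebraMap_eq]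
  have h1 : ∀ γ : Fin m, C (flatWeight m γ) * flatCoord m m 1 γ * gradV m γ =
      ∑ b : Fin m, C ((m : ℂ)⁻¹) * (C ((m : ℂ) - (b : ℕ)) * X b) *
        (gradV m γ * resSeries m m (1 + 1) (γ : ℕ) (b : ℕ)) := by
    intro γ
    rw [flatWeight, div_eq_inv_mul, C_mul, mul_assoc (C ((m : ℂ)⁻¹)),
      ← euler_flatCoord (r := m) le_rfl, Finset.mul_sum, Finset.sum_mul]
    refine Finset.sum_congr rfl fun b _ => ?_
    rw [pderiv_flatCoord le_rfl rfl]
    ring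
  rw [Finset.sum_congr rfl fun γ _ => h1 γ, Finset.sum_comm]
  simp only [← Finset.mul_sum, sum_gradV_mul_resSeries hm]
  rw [Finset.sum_eq_single ⟨0, hm⟩]
  · rw [if_pos rfl, mul_one, ← mul_assoc, ← C_mul]
    simp [hm0]
  · intro b _ hb
    rw [if_neg fun h => hb (Fin.ext h), mul_zero]
  · simp

end

/-! ### The potential of `D_{m+1}` -/

namespace SingularityData

section D

variable {m : ℕ}

theorem flatD_castSucc (γ : Fin m) :
    flatD m γ.castSucc = rename Fin.castSucc (flatCoord m m 1 γ) := by
  have hγ := γ.2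
  rw [flatCoord_eq_sum le_rfl rfl, flatD, Fin.val_castSucc, if_neg (by omega), map_sum]
  refine Finset.sum_congr rfl fun α _ => ?_
  rw [map_mul (rename Fin.castSucc), rename_C, map_prod]
  refine congrArg₂ (· * ·) ?_ (Finset.prod_congr rfl fun k _ => by rw [map_pow, rename_X])
  congr 3
  refine Finset.prod_congr rfl fun j _ => ?_
  push_cast
  ring

theorem flatD_last : flatD m (Fin.last m) = X (Fin.last m) := by
  rw [flatD, if_pos (Fin.val_last m)]

theorem aeval_flatD_rename (f : MvPolynomial (Fin m) ℂ) :
    aeval (flatD m) (rename Fin.castSucc f) =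
      rename Fin.castSucc (aeval (flatCoord m m 1) f) := by
  induction f using MvPolynomial.induction_on with
  | C x => simp only [algHom_C, algebraMap_eq]
  | add p q hp hq => simp only [map_add, hp, hq]
  | mul_X p i hp => simp only [map_mul, hp, rename_X, aeval_X, flatD_castSucc]

theorem pderiv_last_rename (f : MvPolynomial (Fin m) ℂ) :
    pderiv (Fin.last m) (rename Fin.castSucc f) = 0 := by
  induction f using MvPolynomial.induction_on with
  | C x => rw [rename_C, pderiv_C]
  | add p q hp hq => rw [map_add, map_add, hp, hq, add_zero]
  | mul_X p i hp =>
    rw [map_mul, pderiv_mul, hp, rename_X, pderiv_X_of_ne (Fin.castSucc_ne_last i)]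
    ring

theorem pderiv_castSucc_rename (a : Fin m) (f : MvPolynomial (Fin m) ℂ) :
    pderiv a.castSucc (rename Fin.castSucc f) = rename Fin.castSucc (pderiv a f) :=
  pderiv_rename (Fin.castSucc_injective m) a f

theorem pderiv_castSucc_X_last (a : Fin m) :
    pderiv a.castSucc (X (Fin.last m) : MvPolynomial (Fin (m + 1)) ℂ) = 0 :=
  pderiv_X_of_ne (Fin.castSucc_ne_last a).symm

theorem eval_rename_castSucc (v : Fin (m + 1) → ℂ) (f : MvPolynomial (Fin m) ℂ) :
    eval v (rename Fin.castSucc f) = eval (fun k => v k.castSucc) f := eval_rename _ _ _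

/-- The potential of `D_{m+1}`. -/
noncomputable def potentialD (hm : 1 ≤ m) : MvPolynomial (Fin (m + 1)) ℂ :=
  rename Fin.castSucc (flatPotential (r := m) (c := m) (e := 1) le_rfl rfl) +
    C (1 / 2) * X (Fin.last m) ^ 2 * rename Fin.castSucc (flatV hm)

theorem pderiv_castSucc_potentialD (hm : 1 ≤ m) (γ : Fin m) :
    pderiv γ.castSucc (potentialD hm) =
      rename Fin.castSucc (pderiv γ (flatPotential (r := m) (c := m) (e := 1) le_rfl rfl)) +
        C (1 / 2) * X (Fin.last m) ^ 2 * rename Fin.castSucc (pderiv γ (flatV hm)) := by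
  rw [potentialD, map_add, pderiv_mul, pderiv_mul, pderiv_C, pderiv_pow, pderiv_castSucc_X_last,
    pderiv_castSucc_rename, pderiv_castSucc_rename]
  ring

theorem pderiv_last_potentialD (hm : 1 ≤ m) :
    pderiv (Fin.last m) (potentialD hm) = X (Fin.last m) * rename Fin.castSucc (flatV hm) := by
  have h : (C (1 / 2) * C 2 : MvPolynomial (Fin (m + 1)) ℂ) = 1 := by
    rw [← C_mul, ← C_1]; norm_num
  have h2 : ((2 : ℕ) : MvPolynomial (Fin (m + 1)) ℂ) = C 2 := by rw [← C_eq_coe_nat]; rfl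
  rw [potentialD, map_add, pderiv_mul, pderiv_mul, pderiv_C, pderiv_pow, pderiv_X_self,
    pderiv_last_rename, pderiv_last_rename, h2, pow_one]
  linear_combination X (Fin.last m) * rename Fin.castSucc (flatV hm) * h

theorem aeval_pderiv_castSucc_potentialD (hm : 1 ≤ m) (γ : Fin m) :
    aeval (flatD m) (pderiv γ.castSucc (potentialD hm)) =
      rename Fin.castSucc (flatGrad m m 1 γ) +
        C (1 / 2) * X (Fin.last m) ^ 2 * rename Fin.castSucc (gradV m γ) := by
  rw [pderiv_castSucc_potentialD, map_add, map_mul, map_mul, map_pow, aeval_X, flatD_last,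
    algHom_C, algebraMap_eq, aeval_flatD_rename, aeval_flatD_rename,
    aeval_pderiv_flatPotential le_rfl rfl hm, aeval_pderiv_flatV]

theorem aeval_pderiv_last_potentialD (hm : 1 ≤ m) :
    aeval (flatD m) (pderiv (Fin.last m) (potentialD hm)) =
      X (Fin.last m) * X (Fin.castSucc ⟨0, hm⟩) := by
  rw [pderiv_last_potentialD, map_mul, aeval_X, flatD_last, aeval_flatD_rename, aeval_flatV,
    rename_X]

theorem euler_potentialD (hm : 1 ≤ m) :
    ∑ α, C ((dataD m).weight α) * X α * pderiv α (potentialD hm) =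
      C (3 - (dataD m).charge) * potentialD hm := by
  have hm0 : (m : ℂ) ≠ 0 := by exact_mod_cast (show m ≠ 0 by omega)
  have h1 := congrArg (rename Fin.castSucc)
    (euler_flatPotential (r := m) (c := m) (e := 1) le_rfl rfl hm)
  have h2 := congrArg (rename Fin.castSucc) (euler_flatV hm)
  simp only [map_sum, map_mul, rename_C, rename_X] at h1 h2
  have hw : ∀ γ : Fin m, (dataD m).weight γ.castSucc = flatWeight m γ := by
    intro γ
    have := γ.2
    simp only [dataD, Fin.val_castSucc, flatWeight]
    rw [if_neg (by omega)]
    ring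
  have hl : (dataD m).weight (Fin.last m) = ((m : ℂ) + 1) / (2 * (m : ℂ)) := by
    simp only [dataD, Fin.val_last, if_true]
  have hk : 3 - (dataD m).charge = potentialDegree m 1 := by
    simp only [dataD, potentialDegree]
    push_cast
    field_simp
    ring
  rw [Fin.sum_univ_castSucc, pderiv_last_potentialD, hl, hk]
  have h3 : ∑ γ : Fin m, C ((dataD m).weight γ.castSucc) * X γ.castSucc *
      pderiv γ.castSucc (potentialD hm) =
      C (potentialDegree m 1) *
          rename Fin.castSucc (flatPotential (r := m) (c := m) (e := 1) le_rfl rfl) +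
        C (1 / 2) * X (Fin.last m) ^ 2 * rename Fin.castSucc (flatV hm) := by
    rw [← h1]
    conv_rhs => rw [← h2]
    rw [Finset.mul_sum, ← Finset.sum_add_distrib]
    refine Finset.sum_congr rfl fun γ _ => ?_
    rw [pderiv_castSucc_potentialD, hw]
    ring
  rw [h3, potentialD]
  have h4 : (C (potentialDegree m 1) * C (1 / 2) : MvPolynomial (Fin (m + 1)) ℂ) =
      C (1 / 2) + C (((m : ℂ) + 1) / (2 * (m : ℂ))) := by
    rw [← C_mul, ← C_add]
    congr 1
    rw [potentialDegree]
    push_cast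
    field_simp
    ring
  linear_combination (-(X (Fin.last m) ^ 2 * rename Fin.castSucc (flatV hm))) * h4

end D

end SingularityData

theorem pderiv_pderiv_comm {σ : Type*} (a b : σ) (f : MvPolynomial σ ℂ) :
    pderiv a (pderiv b f) = pderiv b (pderiv a f) := by
  classical
  have h : ∀ a b i : σ, pderiv a (pderiv b (X i : MvPolynomial σ ℂ)) = 0 := by
    intro a b i
    rw [pderiv_X, Pi.single_apply]
    split_ifs
    · exact pderiv_one
    · exact map_zero _
  induction f using MvPolynomial.induction_on with
  | C x => rw [pderiv_C, pderiv_C, map_zero, map_zero]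
  | add p q hp hq => simp only [map_add, hp, hq]
  | mul_X p i hp =>
    simp only [pderiv_mul, map_add, h, hp, mul_zero, add_zero]
    ring

/-! ### Pairing and product of `D_{m+1}` -/

namespace SingularityData

section Hessian

variable {n : ℕ} {S : SingularityData n}

theorem eta_mul_eta_of_involutive {σ : Fin n → Fin n} (hσ : Function.Involutive σ)
    (heta : ∀ a b, S.eta a b = if b = σ a then 1 else 0) : S.eta * S.eta = 1 := by
  ext a b
  rw [Matrix.mul_apply, Finset.sum_eq_single (σ a)]
  · rw [heta, heta, if_pos rfl, one_mul, hσ, Matrix.one_apply]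
    simp only [eq_comm]
  · intro k _ hk
    rw [heta, if_neg hk, zero_mul]
  · simp

/-- The product of a potential, expressed by its covariant Hessians. -/
theorem product_of_hessian {σ : Fin n → Fin n} (hσ : Function.Involutive σ)
    (heta : ∀ a b, S.eta a b = if b = σ a then 1 else 0) {F : MvPolynomial (Fin n) ℂ}
    (v : Fin n → ℂ) (a b δ : Fin n) (Γ : Fin n → MvPolynomial (Fin n) ℂ)
    (h : ∀ β, pderiv a (pderiv b (S.flat β)) = ∑ s, Γ s * pderiv s (S.flat β))
    (hG : ∑ s, S.structureConst v a b s * eval v (pderiv s (S.flat δ)) =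
      eval v (pderiv a (pderiv b (aeval S.flat (pderiv (σ δ) F))) -
        ∑ s, Γ s * pderiv s (aeval S.flat (pderiv (σ δ) F)))) :
    ∑ s, S.structureConst v a b s * eval v (pderiv s (S.flat δ)) =
      ∑ α, ∑ β, ∑ γ, eval v (pderiv a (S.flat α)) * eval v (pderiv b (S.flat β)) *
        eval (S.flatPoint v) (pderiv α (pderiv β (pderiv γ F))) * S.eta⁻¹ γ δ := by
  rw [Matrix.inv_eq_right_inv (eta_mul_eta_of_involutive hσ heta), hG,
    ← sum_pderiv_mul_pderiv_mul_aeval S.flat a b Γ h]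
  simp only [map_sum, map_mul, eval_flatPoint]
  refine Finset.sum_congr rfl fun α _ => Finset.sum_congr rfl fun β _ => ?_
  rw [Finset.sum_eq_single (σ δ)]
  · rw [heta, hσ, if_pos rfl, mul_one]
  · intro γ _ hγ
    rw [heta, if_neg, mul_zero]
    rintro rfl
    exact hγ (hσ γ).symm
  · simp

end Hessian

section D

variable {m : ℕ}

/-- The index paired with a given one by the pairing of `D_{m+1}`. -/
def dualD (m : ℕ) : Fin (m + 1) → Fin (m + 1) :=
  Fin.snoc (α := fun _ => Fin (m + 1)) (fun γ => (Fin.rev γ).castSucc) (Fin.last m)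

theorem dualD_castSucc (γ : Fin m) : dualD m γ.castSucc = (Fin.rev γ).castSucc :=
  Fin.snoc_castSucc (α := fun _ => Fin (m + 1)) _ _ _

theorem dualD_last : dualD m (Fin.last m) = Fin.last m :=
  Fin.snoc_last (α := fun _ => Fin (m + 1)) _ _

theorem dualD_involutive : Function.Involutive (dualD m) := by
  intro a
  cases a using Fin.lastCases with
  | last => rw [dualD_last, dualD_last]
  | cast γ => rw [dualD_castSucc, dualD_castSucc, Fin.rev_rev]

theorem eta_dataD (a b : Fin (m + 1)) :
    (dataD m).eta a b = if b = dualD m a then 1 else 0 := by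
  cases a using Fin.lastCases with
  | last =>
    rw [dualD_last]
    have := b.2
    simp only [dataD, Fin.val_last, Fin.ext_iff, true_and]
    by_cases h : (b : ℕ) = m
    · rw [if_pos h, if_pos h]
    · rw [if_neg h, if_neg h, if_neg (by omega)]
  | cast γ =>
    rw [dualD_castSucc]
    have := b.2
    have hγ := γ.2
    simp only [dataD, Fin.val_castSucc, Fin.ext_iff, Fin.val_rev]
    rw [if_neg (by omega)]
    congr 1
    rw [eq_iff_iff]
    omega

/-- The pairing does not see `w`: the correction `w^2 divX K` has degree below `m - 1`. -/
theorem pairing_dataD_xx (v : Fin (m + 1) → ℂ) (hm : 1 ≤ m) (a b : Fin m) :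
    (dataD m).pairing v a.castSucc b.castSucc =
      eval (fun k => v k.castSucc) (topCoeff (unfPoly m 1) (Polynomial.X ^ ((a : ℕ) + b))) := by
  have hP := polyD_monic v
  have hd : (Polynomial.divX (Polynomial.X ^ ((a : ℕ) + b) /ₘ polyD v)).degree <
      ((m - 1 : ℕ) : WithBot ℕ) := by
    refine degree_divX_lt_of_lt (degree_divByMonic_lt_of_lt hP ?_)
    rw [Polynomial.degree_X_pow, Polynomial.natDegree_eq_of_degree_eq_some (degree_polyD v)]
    have := a.2
    have := b.2
    exact_mod_cast (show (a : ℕ) + b < m + (m - 1 + 1) by omega)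
  rw [pairing_eq (s := (⟨m - 1, by omega⟩ : Fin m).castSucc)
      (by simp only [dataD, Fin.val_castSucc]; omega),
    structureConst_dataD_xx v hm, coordD, Fin.snoc_castSucc, Polynomial.coeff_add,
    Polynomial.coeff_smul, Polynomial.coeff_eq_zero_of_degree_lt hd, smul_zero, add_zero,
    topCoeff_apply, natDegree_unfPoly m le_rfl, ← Polynomial.coeff_map,
    map_X_pow_modByMonic le_rfl]
  rfl

theorem pairing_dataD_xy (v : Fin (m + 1) → ℂ) (hm : 1 ≤ m) (a : Fin m) :
    (dataD m).pairing v a.castSucc (Fin.last m) = 0 := by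
  rw [pairing_eq (s := (⟨m - 1, by omega⟩ : Fin m).castSucc)
      (by simp only [dataD, Fin.val_castSucc]; omega),
    structureConst_dataD_xy v hm, Fin.snoc_castSucc, if_neg]
  have := a.2
  simp only
  omega

theorem pairing_dataD_yy (v : Fin (m + 1) → ℂ) (hm : 1 ≤ m) :
    (dataD m).pairing v (Fin.last m) (Fin.last m) = 1 := by
  have hP := polyD_monic v
  rw [pairing_eq (s := (⟨m - 1, by omega⟩ : Fin m).castSucc)
      (by simp only [dataD, Fin.val_castSucc]; omega),
    structureConst_dataD_yy v hm, Fin.snoc_castSucc, Polynomial.coeff_divX, Nat.sub_add_cancel hm]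
  have := hP.coeff_natDegree
  rwa [Polynomial.natDegree_eq_of_degree_eq_some (degree_polyD v)] at this

theorem pairing_comm {n : ℕ} (S : SingularityData n) (v : Fin n → ℂ) (a b : Fin n) :
    S.pairing v a b = S.pairing v b a := by
  simp only [pairing, structureConst_comm S v a b]

theorem pderiv_castSucc_flatD_castSucc (s γ : Fin m) :
    pderiv s.castSucc (flatD m γ.castSucc) =
      rename Fin.castSucc (resSeries m m (1 + 1) (γ : ℕ) (s : ℕ)) := by
  rw [flatD_castSucc, pderiv_castSucc_rename, pderiv_flatCoord le_rfl rfl]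

theorem pderiv_last_flatD_castSucc (γ : Fin m) :
    pderiv (Fin.last m) (flatD m γ.castSucc) = 0 := by
  rw [flatD_castSucc, pderiv_last_rename]

theorem pderiv_castSucc_flatD_last (s : Fin m) :
    pderiv s.castSucc (flatD m (Fin.last m)) = 0 := by
  rw [flatD_last, pderiv_castSucc_X_last]

theorem pderiv_last_flatD_last :
    pderiv (Fin.last m) (flatD m (Fin.last m)) = 1 := by
  rw [flatD_last, pderiv_X_self]

theorem pairing_flat_dataD (hm : 1 ≤ m) (v : Fin (m + 1) → ℂ) (a b : Fin (m + 1)) :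
    (dataD m).pairing v a b = ∑ α, ∑ β, (dataD m).eta α β *
      eval v (pderiv a ((dataD m).flat α)) * eval v (pderiv b ((dataD m).flat β)) := by
  have hflat : (dataD m).flat = flatD m := rfl
  have h1 : ∑ α, ∑ β, (dataD m).eta α β *
      eval v (pderiv a ((dataD m).flat α)) * eval v (pderiv b ((dataD m).flat β)) =
      ∑ α, eval v (pderiv a (flatD m α)) * eval v (pderiv b (flatD m (dualD m α))) := by
    refine Finset.sum_congr rfl fun α _ => ?_
    rw [Finset.sum_eq_single (dualD m α)]
    · rw [eta_dataD, if_pos rfl, one_mul, hflat]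
    · intro β _ hβ
      rw [eta_dataD, if_neg hβ, zero_mul, zero_mul]
    · simp
  rw [h1, Fin.sum_univ_castSucc]
  simp only [dualD_castSucc, dualD_last]
  cases a using Fin.lastCases with
  | last =>
    simp only [pderiv_last_flatD_castSucc, map_zero, zero_mul, Finset.sum_const_zero, zero_add,
      pderiv_last_flatD_last, map_one, one_mul]
    cases b using Fin.lastCases with
    | last => rw [pairing_dataD_yy v hm, pderiv_last_flatD_last, map_one]
    | cast b => rw [pairing_comm, pairing_dataD_xy v hm, pderiv_castSucc_flatD_last, map_zero]
  | cast a =>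
    simp only [pderiv_castSucc_flatD_last, map_zero, zero_mul, add_zero,
      pderiv_castSucc_flatD_castSucc]
    cases b using Fin.lastCases with
    | last => simp only [pairing_dataD_xy v hm, pderiv_last_flatD_castSucc, map_zero, mul_zero,
        Finset.sum_const_zero]
    | cast b =>
      rw [pairing_dataD_xx v hm, ← sum_resSeries_mul_resSeries le_rfl rfl hm, map_sum]
      refine Finset.sum_congr rfl fun γ _ => ?_
      rw [pderiv_castSucc_flatD_castSucc, eval_rename_castSucc, eval_rename_castSucc, map_mul,
        Fin.val_rev, show m - ((γ : ℕ) + 1) = m - 1 - γ by omega]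

theorem pderiv_castSucc_X_zero (hm : 1 ≤ m) (a : Fin m) :
    pderiv a.castSucc (X (Fin.castSucc ⟨0, hm⟩) : MvPolynomial (Fin (m + 1)) ℂ) =
      C (if (a : ℕ) = 0 then 1 else 0) := by
  rw [← rename_X, pderiv_castSucc_rename, pderiv_X_zero]
  split_ifs <;> simp

/-- The Hessian of `flatGrad` gives the remainder of `x^(a+b)`, and `w^2 / 2` times that of `gradV`
gives `w^2 divX K`. The component along `y` comes from `∂F/∂t_{m+1} = w v_1`. -/
theorem product_dataD_xx (hm : 1 ≤ m) (v : Fin (m + 1) → ℂ) (a b : Fin m) (δ : Fin (m + 1)) :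
    ∑ s, (dataD m).structureConst v a.castSucc b.castSucc s *
        eval v (pderiv s ((dataD m).flat δ)) =
      ∑ α, ∑ β, ∑ γ, eval v (pderiv a.castSucc ((dataD m).flat α)) *
        eval v (pderiv b.castSucc ((dataD m).flat β)) *
        eval ((dataD m).flatPoint v) (pderiv α (pderiv β (pderiv γ (potentialD hm)))) *
        (dataD m).eta⁻¹ γ δ := by
  have hflat : (dataD m).flat = flatD m := rfl
  set Γ : Fin (m + 1) → MvPolynomial (Fin (m + 1)) ℂ :=
    Fin.snoc (α := fun _ => MvPolynomial (Fin (m + 1)) ℂ) (fun s : Fin m => rename Fin.castSucc (christoffel m 1 a b s)) 0 with hΓ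
  have hΓc : ∀ s : Fin m, Γ s.castSucc = rename Fin.castSucc (christoffel m 1 a b s) := fun s =>
    Fin.snoc_castSucc (α := fun _ => MvPolynomial (Fin (m + 1)) ℂ) _ _ _
  have hΓl : Γ (Fin.last m) = 0 :=
    Fin.snoc_last (α := fun _ => MvPolynomial (Fin (m + 1)) ℂ) _ _
  refine product_of_hessian dualD_involutive eta_dataD v _ _ δ Γ (fun β => ?_) ?_
  · rw [Fin.sum_univ_castSucc, hΓl, zero_mul, add_zero, hflat]
    cases β using Fin.lastCases with
    | last => simp only [pderiv_castSucc_flatD_last, map_zero, mul_zero, Finset.sum_const_zero]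
    | cast β =>
      simp only [flatD_castSucc, pderiv_castSucc_rename, hΓc]
      rw [pderiv_pderiv_flatCoord le_rfl rfl, map_sum]
      simp only [map_mul]
  · rw [Fin.sum_univ_castSucc, Fin.sum_univ_castSucc, hΓl, zero_mul, add_zero, hflat]
    simp only [structureConst_dataD_xx v hm, coordD, Fin.snoc_castSucc, Fin.snoc_last, hΓc]
    cases δ using Fin.lastCases with
    | last =>
      simp only [pderiv_castSucc_flatD_last, map_zero, mul_zero, Finset.sum_const_zero, zero_add,
        pderiv_last_flatD_last, map_one, mul_one, dualD_last, aeval_pderiv_last_potentialD,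
        pderiv_mul, pderiv_castSucc_X_last, zero_mul, zero_add]
      simp only [pderiv_castSucc_X_zero hm, pderiv_C, mul_zero, zero_sub]
      -- Only the symbol with `s = 0` meets the derivative of `v_1`; it equals `-K(0)`, which
      -- produces the coefficient `w K(0)` of `y`.
      rw [Finset.sum_eq_single ⟨0, hm⟩]
      · rw [if_pos rfl, C_1, mul_one, christoffel, coeff_eulerAdj_one, map_neg (eval v),
          map_mul (eval v), eval_rename_castSucc, eval_X, polyD, ← map_X_pow_divByMonic le_rfl,
          Polynomial.coeff_map, map_neg, map_mul]
        simp only [Nat.cast_zero, mul_zero, zero_add, map_one, one_mul]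
        ring
      · intro k _ hk
        rw [if_neg fun h => hk (Fin.ext h), C_0, mul_zero, mul_zero]
      · simp
    | cast γ =>
      have hr : m - 1 - (Fin.rev γ : Fin m) = (γ : ℕ) := by
        rw [Fin.val_rev]; have := γ.2; omega
      have hE : ∀ k : Fin m, pderiv k.castSucc (aeval (flatD m)
          (pderiv (Fin.rev γ).castSucc (potentialD hm))) =
          rename Fin.castSucc (pderiv k (flatGrad m m 1 (Fin.rev γ))) +
            C (1 / 2) * X (Fin.last m) ^ 2 *
              rename Fin.castSucc (pderiv k (gradV m (Fin.rev γ))) := by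
        intro k
        rw [aeval_pderiv_castSucc_potentialD, map_add, pderiv_mul, pderiv_mul, pderiv_C, pderiv_pow,
          pderiv_castSucc_X_last, pderiv_castSucc_rename, pderiv_castSucc_rename]
        ring
      have hE2 : pderiv a.castSucc (pderiv b.castSucc (aeval (flatD m)
          (pderiv (Fin.rev γ).castSucc (potentialD hm)))) =
          rename Fin.castSucc (pderiv a (pderiv b (flatGrad m m 1 (Fin.rev γ)))) +
            C (1 / 2) * X (Fin.last m) ^ 2 *
              rename Fin.castSucc (pderiv a (pderiv b (gradV m (Fin.rev γ)))) := by
        rw [hE, map_add, pderiv_mul, pderiv_mul, pderiv_C, pderiv_pow,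
          pderiv_castSucc_X_last, pderiv_castSucc_rename, pderiv_castSucc_rename]
        ring
      have h1 := hessian_flatGrad (r := m) (c := m) (e := 1) le_rfl rfl a b (Fin.rev γ)
      have h2 := hessian_gradV hm a b (Fin.rev γ)
      rw [hr, resFun_eq_sum _ (degree_modByMonic_unfPoly_lt le_rfl _), sub_eq_iff_eq_add] at h1
      rw [hr, resFun_eq_sum _ (degree_divX_lt_of_lt
        ((degree_divByMonic_lt_of_lt (k := m + 1) (monic_unfPoly m le_rfl) (by
          rw [Polynomial.degree_X_pow, natDegree_unfPoly m le_rfl]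
          exact_mod_cast (show (a : ℕ) + b < m + (m + 1) by omega)))
          )), sub_eq_iff_eq_add] at h2
      rw [dualD_castSucc, hE2, h1, h2]
      simp only [hE, pderiv_last_flatD_castSucc, map_zero, mul_zero, add_zero,
        pderiv_castSucc_flatD_castSucc, eval_rename_castSucc, map_add, map_sub, map_mul, map_sum,
        map_pow, eval_X, eval_C, mul_add, Finset.sum_add_distrib, Finset.mul_sum, map_ofNat,
        Polynomial.coeff_add, Polynomial.coeff_smul, add_mul, smul_eq_mul, polyD,
        ← map_X_pow_modByMonic le_rfl, ← map_X_pow_divByMonic le_rfl, ← map_divX,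
        Polynomial.coeff_map]
      have e1 : ∀ f g : Fin m → ℂ, ∑ x, 1 / 2 * v (Fin.last m) ^ 2 * (2 * (f x * g x)) =
          ∑ x, v (Fin.last m) ^ 2 * f x * g x := fun f g =>
        Finset.sum_congr rfl fun x _ => by ring
      have e2 : ∀ f g : Fin m → ℂ, ∑ x, 1 / 2 * v (Fin.last m) ^ 2 * (f x * g x) =
          ∑ x, f x * (1 / 2 * v (Fin.last m) ^ 2 * g x) := fun f g =>
        Finset.sum_congr rfl fun x _ => by ring
      rw [e1, e2]
      ring

/-- The Christoffel symbols with an index `m + 1` vanish. The derivative of `gradV` is a residue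
with exponent `a - 1`, in accordance with `x^a y = w x^(a-1)`; for `a = 0` that residue is zero. -/
theorem product_dataD_xy (hm : 1 ≤ m) (v : Fin (m + 1) → ℂ) (a : Fin m) (δ : Fin (m + 1)) :
    ∑ s, (dataD m).structureConst v (Fin.last m) a.castSucc s *
        eval v (pderiv s ((dataD m).flat δ)) =
      ∑ α, ∑ β, ∑ γ, eval v (pderiv (Fin.last m) ((dataD m).flat α)) *
        eval v (pderiv a.castSucc ((dataD m).flat β)) *
        eval ((dataD m).flatPoint v) (pderiv α (pderiv β (pderiv γ (potentialD hm)))) *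
        (dataD m).eta⁻¹ γ δ := by
  have hflat : (dataD m).flat = flatD m := rfl
  refine product_of_hessian dualD_involutive eta_dataD v _ _ δ 0 (fun β => ?_) ?_
  · simp only [Pi.zero_apply, zero_mul, Finset.sum_const_zero, hflat]
    cases β using Fin.lastCases with
    | last => rw [pderiv_castSucc_flatD_last, map_zero]
    | cast β => rw [pderiv_castSucc_flatD_castSucc, pderiv_last_rename]
  · rw [Fin.sum_univ_castSucc]
    simp only [Pi.zero_apply, zero_mul, Finset.sum_const_zero, sub_zero, hflat,
      structureConst_comm _ _ (Fin.last m), structureConst_dataD_xy v hm, Fin.snoc_castSucc,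
      Fin.snoc_last]
    cases δ using Fin.lastCases with
    | last =>
      simp only [pderiv_castSucc_flatD_last, map_zero, mul_zero, Finset.sum_const_zero, zero_add,
        pderiv_last_flatD_last, map_one, mul_one, dualD_last, aeval_pderiv_last_potentialD,
        pderiv_mul, pderiv_castSucc_X_last, zero_mul, zero_add, pderiv_castSucc_X_zero hm,
        pderiv_X_self, one_mul, pderiv_C, mul_zero, add_zero, eval_C]
    | cast γ =>
      have hr : m - 1 - (Fin.rev γ : Fin m) = (γ : ℕ) := by
        rw [Fin.val_rev]; have := γ.2; omega
      have hE : pderiv (Fin.last m) (pderiv a.castSucc (aeval (flatD m)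
          (pderiv (Fin.rev γ).castSucc (potentialD hm)))) =
          X (Fin.last m) * rename Fin.castSucc (pderiv a (gradV m (Fin.rev γ))) := by
        have h : (C (1 / 2) * C 2 : MvPolynomial (Fin (m + 1)) ℂ) = 1 := by
          rw [← C_mul, ← C_1]; norm_num
        have h2 : ((2 : ℕ) : MvPolynomial (Fin (m + 1)) ℂ) = C 2 := by rw [← C_eq_coe_nat]; rfl
        rw [aeval_pderiv_castSucc_potentialD, map_add, pderiv_mul, pderiv_mul, pderiv_C, pderiv_pow,
          pderiv_castSucc_X_last, pderiv_castSucc_rename, pderiv_castSucc_rename, map_add,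
          pderiv_last_rename]
        simp only [mul_zero, zero_mul, zero_add, add_zero]
        rw [pderiv_mul, pderiv_mul, pderiv_C, pderiv_pow, pderiv_X_self, pderiv_last_rename, h2,
          pow_one]
        linear_combination X (Fin.last m) * rename Fin.castSucc (pderiv a (gradV m (Fin.rev γ))) * h
      rw [dualD_castSucc, hE, pderiv_gradV hm, hr, pderiv_last_flatD_castSucc, map_zero, mul_zero,
        add_zero, map_mul, eval_X, eval_rename_castSucc]
      simp only [pderiv_castSucc_flatD_castSucc, eval_rename_castSucc, ite_mul, zero_mul]
      rcases Nat.eq_zero_or_pos (a : ℕ) with h0 | h0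
      · rw [resSeries_of_lt (j := (a : ℕ) - 1) (by omega), map_zero, mul_zero]
        exact Finset.sum_eq_zero fun s _ => if_neg (by omega)
      · have ha := a.2
        rw [Finset.sum_eq_single ⟨(a : ℕ) - 1, by omega⟩]
        · rw [if_pos (Nat.sub_add_cancel h0), Nat.cast_sub h0, Nat.cast_one]
        · intro k _ hk
          rw [if_neg]
          intro h'
          exact hk (Fin.ext (by simp only; omega))
        · simp

/-- The second `w`-derivative of `∂F/∂t_γ` is `gradV`, defined as the residue of `P / x`, which is
`y^2`. -/
theorem product_dataD_yy (hm : 1 ≤ m) (v : Fin (m + 1) → ℂ) (δ : Fin (m + 1)) :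
    ∑ s, (dataD m).structureConst v (Fin.last m) (Fin.last m) s *
        eval v (pderiv s ((dataD m).flat δ)) =
      ∑ α, ∑ β, ∑ γ, eval v (pderiv (Fin.last m) ((dataD m).flat α)) *
        eval v (pderiv (Fin.last m) ((dataD m).flat β)) *
        eval ((dataD m).flatPoint v) (pderiv α (pderiv β (pderiv γ (potentialD hm)))) *
        (dataD m).eta⁻¹ γ δ := by
  have hflat : (dataD m).flat = flatD m := rfl
  refine product_of_hessian dualD_involutive eta_dataD v _ _ δ 0 (fun β => ?_) ?_
  · simp only [Pi.zero_apply, zero_mul, Finset.sum_const_zero, hflat]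
    cases β using Fin.lastCases with
    | last => rw [pderiv_last_flatD_last, pderiv_one]
    | cast β => rw [pderiv_last_flatD_castSucc, map_zero]
  · rw [Fin.sum_univ_castSucc]
    simp only [Pi.zero_apply, zero_mul, Finset.sum_const_zero, sub_zero, hflat,
      structureConst_dataD_yy v hm, Fin.snoc_castSucc, Fin.snoc_last, add_zero]
    cases δ using Fin.lastCases with
    | last =>
      simp only [pderiv_castSucc_flatD_last, map_zero, mul_zero, Finset.sum_const_zero,
        dualD_last, aeval_pderiv_last_potentialD, pderiv_mul, pderiv_X_self, one_mul,
        pderiv_X_of_ne (Fin.castSucc_ne_last _), add_zero]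
    | cast γ =>
      have hr : m - 1 - (Fin.rev γ : Fin m) = (γ : ℕ) := by
        rw [Fin.val_rev]; have := γ.2; omega
      have hE : pderiv (Fin.last m) (pderiv (Fin.last m) (aeval (flatD m)
          (pderiv (Fin.rev γ).castSucc (potentialD hm)))) =
          rename Fin.castSucc (gradV m (Fin.rev γ)) := by
        have h : (C (1 / 2) * C 2 : MvPolynomial (Fin (m + 1)) ℂ) = 1 := by
          rw [← C_mul, ← C_1]; norm_num
        have h2 : ((2 : ℕ) : MvPolynomial (Fin (m + 1)) ℂ) = C 2 := by rw [← C_eq_coe_nat]; rfl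
        rw [aeval_pderiv_castSucc_potentialD, map_add, pderiv_last_rename, pderiv_mul, pderiv_mul,
          pderiv_C, pderiv_pow, pderiv_X_self, pderiv_last_rename, h2, pow_one]
        simp only [mul_zero, zero_mul, zero_add, add_zero, mul_one]
        rw [pderiv_mul, ← mul_assoc, h, one_mul, pderiv_X_self, pderiv_last_rename]
        ring
      rw [dualD_castSucc, hE, gradV, hr, resFun_eq_sum _ (degree_divX_unfPoly_lt m), map_sum,
        map_sum]
      simp only [pderiv_castSucc_flatD_castSucc, eval_rename_castSucc, map_mul, polyD, ← map_divX,
        Polynomial.coeff_map]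

theorem isPotential_dataD (hm : 1 ≤ m) : (dataD m).IsPotential (potentialD hm) := by
  refine ⟨pairing_flat_dataD hm, fun v a b δ => ?_, euler_potentialD hm⟩
  cases a using Fin.lastCases with
  | last =>
    cases b using Fin.lastCases with
    | last => exact product_dataD_yy hm v δ
    | cast b => exact product_dataD_xy hm v b δ
  | cast a =>
    cases b using Fin.lastCases with
    | last =>
      have h := product_dataD_xy hm v a δ
      simp only [structureConst_comm _ _ (Fin.last m)] at h
      rw [h, Finset.sum_comm]
      refine Finset.sum_congr rfl fun α _ => Finset.sum_congr rfl fun β _ =>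
        Finset.sum_congr rfl fun γ _ => ?_
      rw [pderiv_pderiv_comm]
      ring
    | cast b => exact product_dataD_xx hm v a b δ

theorem aeval_flatD_injective :
    Function.Injective (aeval (flatD m) : MvPolynomial (Fin (m + 1)) ℂ →ₐ[ℂ] _) := by
  refine injective_of_surjective_of_isNoetherianRing (aeval (flatD m)).toRingHom ?_
  change Function.Surjective (aeval (flatD m) : MvPolynomial (Fin (m + 1)) ℂ →ₐ[ℂ] _)
  rw [← AlgHom.range_eq_top, eq_top_iff, ← adjoin_range_X, Algebra.adjoin_le_iff]
  rintro _ ⟨k, rfl⟩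
  cases k using Fin.lastCases with
  | last => exact ⟨X (Fin.last m), (aeval_X _ _).trans flatD_last⟩
  | cast k =>
    obtain ⟨f, hf⟩ := aeval_flatCoord_surjective (r := m) (c := m) (e := 1) le_rfl rfl (X k)
    exact ⟨rename Fin.castSucc f, (aeval_flatD_rename f).trans (by rw [hf, rename_X])⟩

theorem isPotential_dataD_iff (hm : 1 ≤ m) (F : MvPolynomial (Fin (m + 1)) ℂ) :
    (dataD m).IsPotential F ↔ F = potentialD hm := by
  have hm0 : (m : ℂ) ≠ 0 := by exact_mod_cast (show m ≠ 0 by omega)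
  have hflat : (dataD m).flat = flatD m := rfl
  -- The scale is `2m` rather than `m` because `t_{m+1}` has weight `(m + 1)/(2m)`.
  refine ⟨fun h => h.eq (isPotential_dataD hm) aeval_flatD_injective
    (eta_mul_eta_of_involutive dualD_involutive eta_dataD) ?_ (d := 2 * m) (M := 2 * (2 * m + 1))
    (ω := Fin.snoc (α := fun _ => ℕ) (fun γ : Fin m => 2 * (m - (γ : ℕ))) (m + 1)) ?_ ?_ ?_ ?_,
    fun h => h ▸ isPotential_dataD hm⟩
  · intro y hy
    rw [hflat] at hy
    have h1 : ∀ γ : Fin m, y γ.castSucc = 0 := by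
      refine eq_zero_of_sum_mul_resSeries (r := m) (c := m) (e := 1) le_rfl
        (rename Fin.castSucc).toRingHom (y := fun γ => y γ.castSucc) fun a => ?_
      have h2 := hy a.castSucc
      rw [Fin.sum_univ_castSucc, pderiv_castSucc_flatD_last, mul_zero, add_zero] at h2
      simp only [pderiv_castSucc_flatD_castSucc] at h2
      exact h2
    intro γ
    cases γ using Fin.lastCases with
    | last =>
      have h2 := hy (Fin.last m)
      rw [Fin.sum_univ_castSucc, pderiv_last_flatD_last, mul_one, Finset.sum_eq_zero,
        zero_add] at h2
      · exact h2
      · intro γ _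
        rw [h1, zero_mul]
    | cast γ => exact h1 γ
  · intro α
    cases α using Fin.lastCases with
    | last =>
      simp only [dataD, Fin.val_last, if_true, Fin.snoc_last]
      push_cast
      field_simp
    | cast γ =>
      have hγ := γ.2
      simp only [dataD, Fin.val_castSucc, Fin.snoc_castSucc]
      rw [if_neg (by omega), Nat.cast_mul 2 (m - (γ : ℕ)), Nat.cast_sub hγ.le]
      push_cast
      field_simp
      ring
  · simp only [dataD]
    push_cast
    field_simp
    ring
  · intro α
    cases α using Fin.lastCases with
    | last => rw [Fin.snoc_last]; omega
    | cast γ => rw [Fin.snoc_castSucc]; omega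
  · omega

end D

end SingularityData

/-! ### Restriction of `A_{2N-1}` and comparison with `D_{N+1}` -/

section InsertZeros

variable {N : ℕ}

theorem insertZeros_oddIndex {R : Type*} [Zero R] (t : Fin N → R) (a : Fin N) :
    insertZeros N t (oddIndex N a) = t a := by
  have h : (oddIndex N a : ℕ) % 2 = 0 := Nat.mul_mod_right 2 a
  rw [insertZeros, dif_pos h]
  congr 1
  exact Fin.ext (Nat.mul_div_cancel_left _ (by norm_num))

theorem insertZeros_of_odd {R : Type*} [Zero R] (t : Fin N → R) {i : Fin (2 * N - 1)}
    (hi : (i : ℕ) % 2 = 1) : insertZeros N t i = 0 := by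
  rw [insertZeros, dif_neg (by omega)]

theorem exists_eq_oddIndex {i : Fin (2 * N - 1)} (hi : (i : ℕ) % 2 = 0) :
    ∃ a, i = oddIndex N a := by
  have := i.2
  exact ⟨⟨i / 2, by omega⟩, Fin.ext (by simp only [oddIndex]; omega)⟩

theorem oddIndex_injective : Function.Injective (oddIndex N) := fun a b h => by
  have := congrArg Fin.val h
  simp only [oddIndex] at this
  exact Fin.ext (by omega)

theorem sum_eq_sum_oddIndex {M : Type*} [AddCommMonoid M] {f : Fin (2 * N - 1) → M}
    (hf : ∀ i : Fin (2 * N - 1), (i : ℕ) % 2 = 1 → f i = 0) :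
    ∑ i, f i = ∑ a : Fin N, f (oddIndex N a) := by
  refine Eq.trans ?_ (Finset.sum_map Finset.univ ⟨oddIndex N, oddIndex_injective⟩ f)
  refine (Finset.sum_subset (Finset.subset_univ _) fun i _ hi => ?_).symm
  refine hf i ?_
  by_contra h
  obtain ⟨a, rfl⟩ := exists_eq_oddIndex (i := i) (by omega)
  exact hi (Finset.mem_map.2 ⟨a, Finset.mem_univ a, rfl⟩)

/-- The restriction to `v = (u_1, 0, u_2, 0, …, 0, u_N)`. -/
noncomputable def insertHom (N : ℕ) : MvPolynomial (Fin (2 * N - 1)) ℂ →ₐ[ℂ] MvPolynomial (Fin N) ℂ :=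
  aeval (insertZeros N X)

theorem eval_insertHom (u : Fin N → ℂ) (f : MvPolynomial (Fin (2 * N - 1)) ℂ) :
    eval u (insertHom N f) = eval (insertZeros N u) f := by
  rw [insertHom, eval_aeval_eq]
  congr 2
  funext i
  rcases Nat.mod_two_eq_zero_or_one i with h | h
  · obtain ⟨a, rfl⟩ := exists_eq_oddIndex h
    rw [insertZeros_oddIndex, insertZeros_oddIndex, eval_X]
  · rw [insertZeros_of_odd _ h, insertZeros_of_odd _ h, map_zero]

theorem constantCoeff_insertHom (f : MvPolynomial (Fin (2 * N - 1)) ℂ) :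
    constantCoeff (insertHom N f) = constantCoeff f := by
  rw [← eval_zero', ← eval_zero']
  rw [eval_insertHom]
  congr 2
  funext i
  rw [insertZeros]
  split_ifs <;> rfl

theorem pderiv_insertHom (a : Fin N) (f : MvPolynomial (Fin (2 * N - 1)) ℂ) :
    pderiv a (insertHom N f) = insertHom N (pderiv (oddIndex N a) f) := by
  rw [insertHom, pderiv_aeval_chain, sum_eq_sum_oddIndex, Finset.sum_eq_single a]
  · rw [insertZeros_oddIndex, pderiv_X_self, mul_one]
  · intro b _ hb
    rw [insertZeros_oddIndex, pderiv_X_of_ne hb, mul_zero]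
  · simp
  · intro i hi
    rw [insertZeros_of_odd _ hi, map_zero, mul_zero]

/-- On the restricted locus both series are residues of the same function, with `h = 2N`. Each
derivative lowers `j - g` by `N - a > 0`, which makes the induction terminate. -/
theorem insertHom_resSeries (g j : ℤ) :
    insertHom N (resSeries (2 * N - 1) (2 * N - 1 + 1) (0 + 1) (2 * g) (2 * j)) =
      resSeries N N (1 + 1) g j := by
  obtain ⟨n, hn⟩ : ∃ n, (j - g + 1).toNat = n := ⟨_, rfl⟩
  induction n using Nat.strong_induction_on generalizing g j with
  | _ n ih =>
  rcases lt_or_ge j g with h | h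
  · rw [resSeries_of_lt h, resSeries_of_lt (by omega), map_zero]
  refine eq_of_pderiv_eq (fun a => ?_) ?_
  · have ha := a.2
    have h1 := ih (j + (a : ℕ) - (g + N) + 1).toNat (by omega) (g + N) (j + (a : ℕ)) rfl
    rw [pderiv_insertHom, pderiv_resSeries (by omega), pderiv_resSeries le_rfl, map_mul, ← h1,
      algHom_C, algebraMap_eq]
    refine congrArg₂ (· * ·) (congrArg C ?_) (congrArg (insertHom N) ?_)
    · push_cast; ring
    · congr 1
      · omega
      · simp only [oddIndex]; omega
  · rw [constantCoeff_insertHom, constantCoeff_resSeries (by omega), constantCoeff_resSeries le_rfl]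
    congr 1
    rw [eq_iff_iff]
    omega

/-- On this locus `z` is odd in `x`, so `x^j z^(-(1+g))` is even when `j - g` is odd and has no term
`x^(-1)`. -/
theorem insertHom_resSeries_of_odd (g j : ℤ) (hgj : (j - g) % 2 = 1) :
    insertHom N (resSeries (2 * N - 1) (2 * N - 1 + 1) (0 + 1) g j) = 0 := by
  obtain ⟨n, hn⟩ : ∃ n, (j - g + 1).toNat = n := ⟨_, rfl⟩
  induction n using Nat.strong_induction_on generalizing g j with
  | _ n ih =>
  rcases lt_or_ge j g with h | h
  · rw [resSeries_of_lt h, map_zero]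
  refine eq_of_pderiv_eq (fun a => ?_) ?_
  · have ha := a.2
    rw [pderiv_insertHom, pderiv_resSeries (by omega), map_mul, map_zero,
      ih _ _ _ _ ?_ rfl, mul_zero]
    · simp only [oddIndex]; omega
    · simp only [oddIndex]; omega
  · rw [constantCoeff_insertHom, constantCoeff_resSeries (by omega), if_neg (by omega), map_zero]

theorem insertHom_flatCoord_oddIndex (γ : Fin N) :
    insertHom N (flatCoord (2 * N - 1) (2 * N - 1 + 1) 0 (oddIndex N γ)) = flatCoord N N 1 γ := by
  have hN : 1 ≤ N := by have := γ.2; omega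
  have h1 : (((oddIndex N γ : ℕ) : ℤ) - ((2 * N - 1 + 1 : ℕ) : ℤ)) = 2 * ((γ : ℕ) - N) := by
    simp only [oddIndex]; omega
  rw [flatCoord, flatCoord, map_mul, algHom_C, algebraMap_eq, h1, ← insertHom_resSeries, mul_zero]
  refine congrArg₂ (· * ·) (congrArg C ?_) rfl
  push_cast
  ring

theorem insertHom_flatCoord_of_odd {i : Fin (2 * N - 1)} (hi : (i : ℕ) % 2 = 1) :
    insertHom N (flatCoord (2 * N - 1) (2 * N - 1 + 1) 0 i) = 0 := by
  have := i.2
  rw [flatCoord, map_mul, insertHom_resSeries_of_odd _ _ (by omega), mul_zero]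

theorem insertHom_flatCoord (i : Fin (2 * N - 1)) :
    insertHom N (flatCoord (2 * N - 1) (2 * N - 1 + 1) 0 i) =
      insertZeros N (flatCoord N N 1) i := by
  rcases Nat.mod_two_eq_zero_or_one i with h | h
  · obtain ⟨a, rfl⟩ := exists_eq_oddIndex h
    rw [insertHom_flatCoord_oddIndex, insertZeros_oddIndex]
  · rw [insertHom_flatCoord_of_odd h, insertZeros_of_odd _ h]

theorem insertHom_flatGrad_oddIndex (γ : Fin N) :
    insertHom N (flatGrad (2 * N - 1) (2 * N - 1 + 1) 0 (oddIndex N γ)) = flatGrad N N 1 γ := by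
  have hN : 1 ≤ N := by have := γ.2; omega
  have h0 : dualIndex 0 (oddIndex N γ : ℕ) = 2 * dualIndex 1 γ := by
    simp only [oddIndex, dualIndex]; omega
  have h1 : dualIndex 0 (oddIndex N γ : ℕ) - ((2 * N - 1 + 1 : ℕ) : ℤ) =
      2 * (dualIndex 1 γ - N) := by omega
  rw [flatGrad, flatGrad, map_mul, algHom_C, algebraMap_eq, h1, ← insertHom_resSeries, mul_zero, h0]
  refine congrArg₂ (· * ·) (congrArg C ?_) rfl
  push_cast
  ring

/-- In Euler's formula the summands with odd zero-based index vanish with their `t_γ`; the others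
agree, also in weight, because `c` and the index are both doubled. -/
theorem insertHom_unfPotential (hN : 1 ≤ N) :
    insertHom N (unfPotential (2 * N - 1) (2 * N - 1 + 1) 0) = unfPotential N N 1 := by
  have hN0 : (N : ℂ) ≠ 0 := by exact_mod_cast (show N ≠ 0 by omega)
  have hc : ((2 * N - 1 + 1 : ℕ) : ℂ) = 2 * N := by
    rw [Nat.sub_add_cancel (by omega)]; push_cast; rfl
  have hk : potentialDegree (2 * N - 1 + 1) 0 = potentialDegree N 1 := by
    rw [potentialDegree, potentialDegree, hc]
    push_cast
    field_simp
    ring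
  rw [unfPotential, unfPotential, map_mul, map_sum, sum_eq_sum_oddIndex, algHom_C, algebraMap_eq]
  · refine congrArg₂ (· * ·) (by rw [hk]) (Finset.sum_congr rfl fun γ _ => ?_)
    · rw [map_mul, map_mul, insertHom_flatCoord_oddIndex, insertHom_flatGrad_oddIndex, algHom_C,
        algebraMap_eq, flatWeight, flatWeight, hc]
      refine congrArg₂ (· * ·) (congrArg₂ (· * ·) (congrArg C ?_) rfl) rfl
      simp only [oddIndex]
      push_cast
      field_simp
  · intro i hi
    rw [map_mul, map_mul, insertHom_flatCoord_of_odd hi, mul_zero, zero_mul]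

theorem aeval_flatCoord_insertHom (F : MvPolynomial (Fin (2 * N - 1)) ℂ) :
    aeval (flatCoord N N 1) (insertHom N F) =
      insertHom N (aeval (flatCoord (2 * N - 1) (2 * N - 1 + 1) 0) F) := by
  induction F using MvPolynomial.induction_on with
  | C x => simp only [algHom_C, algebraMap_eq]
  | add p q hp hq => simp only [map_add, hp, hq]
  | mul_X p i hp =>
    have hX : insertHom N (X i) = insertZeros N X i := aeval_X _ _
    rw [map_mul, map_mul, map_mul, map_mul, hp, aeval_X, insertHom_flatCoord, hX]
    refine congrArg₂ (· * ·) rfl ?_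
    rcases Nat.mod_two_eq_zero_or_one i with h | h
    · obtain ⟨a, rfl⟩ := exists_eq_oddIndex h
      rw [insertZeros_oddIndex, insertZeros_oddIndex, aeval_X]
    · rw [insertZeros_of_odd _ h, insertZeros_of_odd _ h, map_zero]

theorem potentialB_flatPotential (hN : 1 ≤ N) :
    potentialB N (flatPotential (r := 2 * N - 1) (c := 2 * N - 1 + 1) (e := 0) (by omega) rfl) =
      flatPotential (r := N) (c := N) (e := 1) le_rfl rfl := by
  apply (flatEquiv (r := N) (c := N) (e := 1) le_rfl rfl).injective
  change aeval _ (insertHom N _) = aeval _ _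
  rw [aeval_flatCoord_insertHom, aeval_flatPotential, aeval_flatPotential,
    insertHom_unfPotential hN]

/-- The expansions of both pairings in flat coordinates are compared, which avoids relating division
by the two different polynomials `P`. -/
theorem insertHom_topCoeff (hN : 1 ≤ N) (a b : Fin N) :
    insertHom N (topCoeff (unfPoly (2 * N - 1) 0)
        (Polynomial.X ^ ((oddIndex N a : ℕ) + (oddIndex N b : ℕ)))) =
      topCoeff (unfPoly N 1) (Polynomial.X ^ ((a : ℕ) + b)) := by
  rw [← sum_resSeries_mul_resSeries (r := 2 * N - 1) (c := 2 * N - 1 + 1) (e := 0) (by omega) rfl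
      (by omega), ← sum_resSeries_mul_resSeries (r := N) (c := N) (e := 1) le_rfl rfl hN,
    map_sum, sum_eq_sum_oddIndex]
  · refine Finset.sum_congr rfl fun γ _ => ?_
    have hγ := γ.2
    rw [map_mul, ← insertHom_resSeries, ← insertHom_resSeries]
    refine congrArg₂ (· * ·) (congrArg (insertHom N) ?_) (congrArg (insertHom N) ?_)
    · simp only [oddIndex]
      push_cast
      rfl
    · congr 1
      simp only [oddIndex]
      omega
  · intro i hi
    rw [map_mul, insertHom_resSeries_of_odd (i : ℕ) _ (by simp only [oddIndex]; omega), zero_mul]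

theorem appendZero_castSucc {R : Type*} [Zero R] (t : Fin N → R) (a : Fin N) :
    appendZero N t a.castSucc = t a := dif_pos a.2

theorem appendZero_last {R : Type*} [Zero R] (t : Fin N → R) :
    appendZero N t (Fin.last N) = 0 := dif_neg (lt_irrefl N)

theorem aeval_appendZero_potentialD (hN : 1 ≤ N) :
    aeval (appendZero N (X : Fin N → MvPolynomial (Fin N) ℂ)) (SingularityData.potentialD hN) =
      flatPotential (r := N) (c := N) (e := 1) le_rfl rfl := by
  rw [SingularityData.potentialD, map_add, map_mul, map_mul, map_pow, aeval_X, appendZero_last,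
    aeval_rename, zero_pow two_ne_zero, mul_zero, zero_mul, add_zero]
  have h : appendZero N (X : Fin N → MvPolynomial (Fin N) ℂ) ∘ Fin.castSucc = X :=
    funext fun a => appendZero_castSucc _ a
  rw [h, aeval_X_left_apply]

theorem flatPoint_dataA_insertZeros (u : Fin N → ℂ) :
    (dataA (2 * N - 1)).flatPoint (insertZeros N u) =
      insertZeros N fun γ => eval u (flatCoord N N 1 γ) := by
  funext i
  rw [SingularityData.flatPoint]
  change eval _ (flatA _ i) = _
  rw [SingularityData.flatA_eq, ← eval_insertHom, insertHom_flatCoord]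
  rcases Nat.mod_two_eq_zero_or_one i with h | h
  · obtain ⟨a, rfl⟩ := exists_eq_oddIndex h
    rw [insertZeros_oddIndex, insertZeros_oddIndex]
  · rw [insertZeros_of_odd _ h, insertZeros_of_odd _ h, map_zero]

theorem flatPoint_dataD_appendZero (u : Fin N → ℂ) :
    (dataD N).flatPoint (appendZero N u) =
      appendZero N fun γ => eval u (flatCoord N N 1 γ) := by
  funext i
  rw [SingularityData.flatPoint]
  change eval _ (flatD _ i) = _
  cases i using Fin.lastCases with
  | last => rw [SingularityData.flatD_last, eval_X, appendZero_last, appendZero_last]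
  | cast a =>
    rw [SingularityData.flatD_castSucc, SingularityData.eval_rename_castSucc, appendZero_castSucc]
    simp only [appendZero_castSucc]

theorem pairing_dataA_insertZeros (hN : 1 ≤ N) (u : Fin N → ℂ) (a b : Fin N) :
    (dataA (2 * N - 1)).pairing (insertZeros N u) (oddIndex N a) (oddIndex N b) =
      (dataD N).pairing (appendZero N u) a.castSucc b.castSucc := by
  rw [SingularityData.pairing_dataA _ (by omega), SingularityData.pairing_dataD_xx _ hN,
    ← eval_insertHom, insertHom_topCoeff hN]
  simp only [appendZero_castSucc]

end InsertZeros

theorem mainTheorem10 (N : ℕ) (hN : 1 ≤ N) :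
    ∃ (FA : MvPolynomial (Fin (2 * N - 1)) ℂ) (FD : MvPolynomial (Fin (N + 1)) ℂ),
      -- `FA` is the potential of `A_{2N-1}` and `FD` is the potential of `D_{N+1}`
      (∀ F, (dataA (2 * N - 1)).IsPotential F ↔ F = FA) ∧
      (∀ F, (dataD N).IsPotential F ↔ F = FD) ∧
      -- the potentials agree
      potentialB N FA =
        MvPolynomial.aeval
          (appendZero N (MvPolynomial.X : Fin N → MvPolynomial (Fin N) ℂ)) FD ∧
      -- the flat coordinates and the flat pairings agree
      ∀ u : Fin N → ℂ,
        (∃ t : Fin N → ℂ,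
          (dataA (2 * N - 1)).flatPoint (insertZeros N u) = insertZeros N t ∧
          (dataD N).flatPoint (appendZero N u) = appendZero N t) ∧
        ∀ a b : Fin N,
          (dataA (2 * N - 1)).pairing (insertZeros N u) (oddIndex N a) (oddIndex N b) =
            (dataD N).pairing (appendZero N u) a.castSucc b.castSucc :=
  ⟨_, _, SingularityData.isPotential_dataA_iff (by omega),
    SingularityData.isPotential_dataD_iff hN,
    (potentialB_flatPotential hN).trans (aeval_appendZero_potentialD hN).symm,
    fun u => ⟨⟨_, flatPoint_dataA_insertZeros u, flatPoint_dataD_appendZero u⟩,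
      pairing_dataA_insertZeros hN u⟩⟩
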